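/- **Definitions.** A *partial field* $\mathbb P=(P,+,\cdot,0,1)$ is a set $P$ with a binary operation $\cdot$, a partial binary operation $+$ and elements $0,1$ such that: $(P\setminus\{0\},\cdot,1)$ is an abelian group and $0\cdot p=p\cdot 0=0$ for all $p$; $p+0=p$ for all $p$; for each $p$ there is a unique element $-p$ with $p+(-p)=0$; if $p+q$ is defined then $q+p$ is defined and equal to it; for $p\neq 0$, $p(q+r)$ is defined if and only if $pq+pr$ is defined, and then they are equal; and the associative law below holds. An *association* of a nonempty finite multiset $S$ over $P$ is a full binary tree whose leaves are labelled bijectively by the elements of $S$ and in which the label of each inner node is the (defined) sum of the labels of its two children; its value is the label of the root. A *pre-association* of a multiset with at least two elements is the same, except that the root is not labelled and the sum of the labels of its children need not be defined. The *associative law*: if $S$ has an association with value $r$, then for each pre-association of $S$ the sum of the labels of the two children of the root is defined and equals $r$. A sum $p_1+\dots+p_n$ is *defined* with value $r$ if, for some finite multiset $Z=\{z_1,-z_1,\dots,z_k,-z_k\}$ over $P$, the multiset $\{p_1,\dots,p_n\}\cup Z$ has an association with value $r$. Every field is a partial field in which all sums are defined. A determinant $\det A=\sum_\sigma \operatorname{sgn}(\sigma)\prod_i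 a_{i\sigma(i)}$ over $\mathbb P$ is *defined* if this sum is defined. A $\mathbb P$*-matrix* is a matrix over $\mathbb P$ such that the determinant of every square submatrix is defined. A finite matroid $M$ with ground set $E$ is *representable over* $\mathbb P$ ($\mathbb P$*-representable*) if for some $r$ there is an $r\times E$ $\mathbb P$-matrix $A$ such that the bases of $M$ are exactly the sets $B\subseteq E$ with $|B|=r$ and $\det A[r,B]\neq 0$, where $A[r,B]$ is the submatrix of $A$ formed by the columns in $B$. The *direct product* $\mathbb P_1\otimes\mathbb P_2$ of partial fields has underlying set $\{(p_1,p_2) : p_1\ne 0\iff p_2\neq 0\}$, zero $(0,0)$, identity $(1,1)$ and componentwise multiplication; $(p_1,p_2)+(q_1,q_2)$ is defined, with value $(p_1+q_1,p_2+q_2)$, if and only if both $p_i+q_i$ are defined and $p_1+q_1=0\iff p_2+q_2=0$. For a nonzero commutative ring $R$ and a set $S$ of units of $R$, $\mathbb P(R,S)$ is the partial field with underlying set $\langle S\cup\{-1\}\rangle\cup\{0\}$, where $\langle\cdot\rangle$ denotes the generated subgroup of the group of units, with the multiplication of $R$ and with $p+q$ defined, and equal to the sum in $R$, if and only if that sum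 lies in this set. Let $\mathbb U_1:=\mathbb P(\mathbb Q(\alpha),\{\alpha,1-\alpha\})$, where $\alpha$ is an indeterminate; a matroid is *near-regular* if it is $\mathbb U_1$-representable. **Theorem (Whittle).** Let $M$ be a finite matroid. The following are equivalent: 1. $M$ is representable over $\mathrm{GF}(3)\otimes\mathrm{GF}(4)\otimes\mathrm{GF}(5)$; 2. $M$ is representable over $\mathrm{GF}(3)\otimes\mathrm{GF}(8)$; 3. $M$ is near-regular, i.e. $\mathbb U_1$-representable; 4. $M$ is representable over every field with at least 3 elements. -/

import Mathlib

/-- `Association add s r`: there is an association (a full binary tree with leaves labelled by the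
elements of the multiset `s`, every inner node being labelled by the defined sum of the labels of
its children) whose root is labelled `r`. Here `x ∈ add u w` reads "`u + w` is defined and equal
to `x`". -/
inductive Association {P : Type*} (add : P → P → Part P) : Multiset P → P → Prop
  | leaf (p : P) : Association add {p} p
  | node {s t : Multiset P} {u w r : P} (hs : Association add s u) (ht : Association add t w)
      (hr : r ∈ add u w) : Association add (s + t) r

/-- A partial field. The multiplicative part is a `CommGroupWithZero`: the nonzero elements form an
abelian group with identity `1`, and `0` is absorbing. Addition `padd` is a partial binary
operation. The distributive law is imposed for nonzero `p`: for `p = 0` the product `p * (q + r)`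
is `0` by convention. -/
class PartialField (P : Type*) extends CommGroupWithZero P where
  /-- partial addition -/
  padd : P → P → Part P
  /-- the additive inverse -/
  pneg : P → P
  padd_zero : ∀ p : P, padd p 0 = Part.some p
  zero_mem_padd_pneg : ∀ p : P, 0 ∈ padd p (pneg p)
  eq_pneg_of_zero_mem : ∀ p q : P, 0 ∈ padd p q → q = pneg p
  padd_comm : ∀ p q : P, padd p q = padd q p
  mul_padd : ∀ p q r : P, p ≠ 0 → (padd q r).map (fun x => p * x) = padd (p * q) (p * r)
  /-- The associative law: if the multiset `s + t` has an association with value `r`, then every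
  pre-association of it, with children of the root labelled `u` and `w`, satisfies `u + w = r`. -/
  assoc_law : ∀ (s t : Multiset P) (r u w : P), Association padd (s + t) r →
    Association padd s u → Association padd t w → r ∈ padd u w

namespace PartialField

section Sums

variable {P : Type*} [PartialField P]

/-- The sum of the multiset `s` is defined and equal to `r`: for some finite multiset of the form
`{z₁, -z₁, …, zₖ, -zₖ}`, adding it to `s` gives a multiset that has an association with
value `r`. -/
def SumIs (s : Multiset P) (r : P) : Prop :=
  ∃ z : Multiset P, Association (padd (P := P)) (s + (z + z.map pneg)) r

/-- The sign of a permutation as an element `1` or `-1` of the partial field. -/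
def signOf (P : Type*) [PartialField P] (e : ℤˣ) : P := if e = 1 then 1 else pneg 1

/-- The determinant of the square matrix `A`, i.e. the sum over all permutations `σ` of
`sign σ * ∏ i, A i (σ i)`, is defined and equal to `d`. -/
def DetIs {k : ℕ} (A : Matrix (Fin k) (Fin k) P) (d : P) : Prop :=
  SumIs ((Finset.univ : Finset (Equiv.Perm (Fin k))).val.map
    (fun σ => signOf P (Equiv.Perm.sign σ) * ∏ i, A i (σ i))) d

/-- `A` is a `P`-matrix: the determinant of every square submatrix is defined. -/
def IsPMatrix {X Y : Type*} (A : Matrix X Y P) : Prop :=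
  ∀ (k : ℕ) (f : Fin k ↪ X) (g : Fin k ↪ Y), ∃ d : P, DetIs (A.submatrix f g) d

end Sums

/-- The matroid `M` is `P`-representable: there is an `r × E` `P`-matrix `A` such that the bases of
`M` are exactly the `r`-subsets `B` of the ground set `E` with `det A[r, B] ≠ 0`; here `B` is
enumerated by an injection `f : Fin r ↪ E`, whose choice affects only the sign of the determinant.
Since a matroid has a basis, such an `A` has rank `r`. -/
def Representable {α : Type*} (P : Type*) [PartialField P] (M : Matroid α) : Prop :=
  ∃ (r : ℕ) (A : Matrix (Fin r) M.E P), IsPMatrix A ∧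
    ∀ B : Set α, M.IsBase B ↔
      ∃ f : Fin r ↪ M.E, Set.range (fun i => (f i : α)) = B ∧
        ∃ d : P, d ≠ 0 ∧ DetIs (A.submatrix id f) d

/-- A map to a commutative monoid that respects defined sums takes the value of an association to the
sum of the images of its leaves. -/
theorem association_hom {P R : Type*} [AddCommMonoid R] {add : P → P → Part P} (φ : P → R)
    (h : ∀ p q r, r ∈ add p q → φ r = φ p + φ q) {s : Multiset P} {r : P}
    (hs : Association add s r) : (s.map φ).sum = φ r := by
  induction hs with
  | leaf p => simp
  | node hs ht hr ihs iht => rw [Multiset.map_add, Multiset.sum_add, ihs, iht, h _ _ _ hr]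

/-- A map that respects defined sums maps associations to associations. -/
theorem Association.map {P Q : Type*} {add : P → P → Part P} {add' : Q → Q → Part Q} (φ : P → Q)
    (h : ∀ p q r, r ∈ add p q → φ r ∈ add' (φ p) (φ q)) {s : Multiset P} {r : P}
    (hs : Association add s r) : Association add' (s.map φ) (φ r) := by
  induction hs with
  | leaf p => simpa using Association.leaf (φ p)
  | node hs ht hr ihs iht => rw [Multiset.map_add]; exact .node ihs iht (h _ _ _ hr)

/-- A field is a partial field in which all sums are defined. -/
instance ofField (F : Type*) [Field F] : PartialField F where
  padd p q := Part.some (p + q)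
  pneg p := -p
  padd_zero p := by simp
  zero_mem_padd_pneg p := by simp
  eq_pneg_of_zero_mem p q h := by
    rw [Part.mem_some_iff] at h
    exact (neg_eq_of_add_eq_zero_right h.symm).symm
  padd_comm p q := by rw [add_comm]
  mul_padd p q r _ := by simp [mul_add]
  assoc_law s t r u w h hs ht := by
    have key := fun {s : Multiset F} {r : F} => association_hom (R := F)
      (add := fun p q : F => Part.some (p + q)) id (by simp) (s := s) (r := r)
    have h1 := key h
    rw [Multiset.map_add, Multiset.sum_add, key hs, key ht] at h1
    exact Part.mem_some_iff.2 h1.symm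

/-- The subset `⟨S ∪ {-1}⟩ ∪ {0}` of the commutative ring `R`, where `⟨S ∪ {-1}⟩` is the subgroup
of the group of units generated by `S` and `-1`. -/
def fromRingSet (R : Type*) [CommRing R] (S : Set Rˣ) : Set R :=
  insert 0 (Units.val '' (Subgroup.closure (S ∪ {-1}) : Set Rˣ))

/-- The underlying type of the partial field `ℙ(R, S)`. -/
def FromRing (R : Type*) [CommRing R] (S : Set Rˣ) := fromRingSet R S

section FromRing

variable {R : Type*} [CommRing R] {S : Set Rˣ}

theorem fromRingSet.zero_mem : (0 : R) ∈ fromRingSet R S := Or.inl rfl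

theorem fromRingSet.one_mem : (1 : R) ∈ fromRingSet R S :=
  Or.inr ⟨1, Subgroup.one_mem _, by simp⟩

theorem fromRingSet.mul_mem {x y : R} (hx : x ∈ fromRingSet R S) (hy : y ∈ fromRingSet R S) :
    x * y ∈ fromRingSet R S := by
  rcases hx with rfl | ⟨u, hu, rfl⟩
  · rw [zero_mul]; exact fromRingSet.zero_mem
  rcases hy with rfl | ⟨v, hv, rfl⟩
  · rw [mul_zero]; exact fromRingSet.zero_mem
  exact Or.inr ⟨u * v, Subgroup.mul_mem _ hu hv, by simp⟩

theorem fromRingSet.inverse_mem {x : R} (hx : x ∈ fromRingSet R S) :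
    Ring.inverse x ∈ fromRingSet R S := by
  rcases hx with rfl | ⟨u, hu, rfl⟩
  · rw [Ring.inverse_zero]; exact fromRingSet.zero_mem
  exact Or.inr ⟨u⁻¹, Subgroup.inv_mem _ hu, by simp⟩

theorem fromRingSet.neg_mem {x : R} (hx : x ∈ fromRingSet R S) : -x ∈ fromRingSet R S := by
  rw [← neg_one_mul]
  exact fromRingSet.mul_mem (Or.inr ⟨-1, Subgroup.subset_closure (by simp), by simp⟩) hx

noncomputable instance FromRing.commGroupWithZero [Nontrivial R] :
    CommGroupWithZero (FromRing R S) where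
  mul x y := ⟨x.1 * y.1, fromRingSet.mul_mem x.2 y.2⟩
  one := ⟨1, fromRingSet.one_mem⟩
  zero := ⟨0, fromRingSet.zero_mem⟩
  inv x := ⟨Ring.inverse x.1, fromRingSet.inverse_mem x.2⟩
  mul_assoc x y z := Subtype.ext (mul_assoc x.1 y.1 z.1)
  mul_comm x y := Subtype.ext (mul_comm x.1 y.1)
  one_mul x := Subtype.ext (one_mul x.1)
  mul_one x := Subtype.ext (mul_one x.1)
  zero_mul x := Subtype.ext (zero_mul x.1)
  mul_zero x := Subtype.ext (mul_zero x.1)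
  exists_pair_ne := ⟨⟨0, fromRingSet.zero_mem⟩, ⟨1, fromRingSet.one_mem⟩,
    fun h => zero_ne_one (congrArg Subtype.val h)⟩
  inv_zero := Subtype.ext (Ring.inverse_zero R)
  mul_inv_cancel x hx := by
    apply Subtype.ext
    obtain ⟨x, rfl | ⟨u, hu, rfl⟩⟩ := x
    · exact absurd rfl hx
    · exact Ring.mul_inverse_cancel _ u.isUnit

/-- Addition in `ℙ(R, S)`, restricted from `R`: the sum `x + y` is defined if and only if the sum
in `R` lies in `⟨S ∪ {-1}⟩ ∪ {0}`. -/
def FromRing.add (x y : FromRing R S) : Part (FromRing R S) :=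
  ⟨x.1 + y.1 ∈ fromRingSet R S, fun h => ⟨x.1 + y.1, h⟩⟩

theorem FromRing.mem_add {x y z : FromRing R S} : z ∈ FromRing.add x y ↔ z.1 = x.1 + y.1 := by
  constructor
  · rintro ⟨h, rfl⟩
    rfl
  · intro h
    have hz : x.1 + y.1 ∈ fromRingSet R S := h ▸ z.2
    exact ⟨hz, Subtype.ext h.symm⟩

/-- The partial field `ℙ(R, S)`, with multiplication and addition restricted from `R`. -/
noncomputable instance fromRing [Nontrivial R] : PartialField (FromRing R S) where
  padd := FromRing.add
  pneg x := ⟨-x.1, fromRingSet.neg_mem x.2⟩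
  padd_zero p := Part.eq_some_iff.2 (FromRing.mem_add.2 (add_zero p.1).symm)
  zero_mem_padd_pneg p := FromRing.mem_add.2 (add_neg_cancel p.1).symm
  eq_pneg_of_zero_mem p q h := by
    have h' : (0 : R) = p.1 + q.1 := FromRing.mem_add.1 h
    exact Subtype.ext (neg_eq_of_add_eq_zero_right h'.symm).symm
  padd_comm p q := by
    ext x
    rw [FromRing.mem_add, FromRing.mem_add, add_comm]
  mul_padd p q r hp := by
    ext x
    rw [Part.mem_map_iff, FromRing.mem_add]
    change _ ↔ x.1 = p.1 * q.1 + p.1 * r.1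
    have hi : (p⁻¹ : FromRing R S).1 * p.1 = 1 := congrArg Subtype.val (inv_mul_cancel₀ hp)
    constructor
    · rintro ⟨y, hy, rfl⟩
      change p.1 * y.1 = _
      rw [FromRing.mem_add.1 hy, mul_add]
    · intro h
      refine ⟨p⁻¹ * x, FromRing.mem_add.2 ?_, mul_inv_cancel_left₀ hp x⟩
      change (p⁻¹ : FromRing R S).1 * x.1 = _
      rw [h, ← mul_add, ← mul_assoc, hi, one_mul]
  assoc_law s t r u w h hs ht := by
    have key := fun {s : Multiset (FromRing R S)} {r : FromRing R S} =>
      association_hom (R := R) (add := FromRing.add) Subtype.val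
        (fun _ _ _ => FromRing.mem_add.1) (s := s) (r := r)
    have h1 := key h
    rw [Multiset.map_add, Multiset.sum_add, key hs, key ht] at h1
    exact FromRing.mem_add.2 h1.symm

end FromRing

/-- The underlying set of the direct product `P ⊗ Q` of two partial fields. -/
def DirectProduct (P Q : Type*) [PartialField P] [PartialField Q] :=
  {x : P × Q // x.1 ≠ 0 ↔ x.2 ≠ 0}

section DirectProduct

variable {P Q : Type*} [PartialField P] [PartialField Q]

theorem pneg_eq_zero_iff (p : P) : pneg p = 0 ↔ p = 0 := by
  constructor
  · intro e
    have h := zero_mem_padd_pneg p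
    rw [e, padd_zero, Part.mem_some_iff] at h
    exact h.symm
  · rintro rfl
    refine (eq_pneg_of_zero_mem (0 : P) 0 ?_).symm
    rw [padd_zero]
    exact Part.mem_some _

instance DirectProduct.commGroupWithZero : CommGroupWithZero (DirectProduct P Q) where
  mul x y := ⟨x.1 * y.1, by
    have hx := x.2
    have hy := y.2
    simp only [Prod.fst_mul, Prod.snd_mul, mul_ne_zero_iff, hx, hy]⟩
  one := ⟨1, by simp⟩
  zero := ⟨0, by simp⟩
  inv x := ⟨(x.1.1⁻¹, x.1.2⁻¹), by
    have hx := x.2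
    simpa using hx⟩
  mul_assoc x y z := Subtype.ext (mul_assoc x.1 y.1 z.1)
  mul_comm x y := Subtype.ext (mul_comm x.1 y.1)
  one_mul x := Subtype.ext (one_mul x.1)
  mul_one x := Subtype.ext (mul_one x.1)
  zero_mul x := Subtype.ext (zero_mul x.1)
  mul_zero x := Subtype.ext (mul_zero x.1)
  exists_pair_ne := ⟨⟨0, by simp⟩, ⟨1, by simp⟩, fun h => zero_ne_one (congrArg Subtype.val h)⟩
  inv_zero := Subtype.ext (Prod.ext (inv_zero (G₀ := P)) (inv_zero (G₀ := Q)))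
  mul_inv_cancel x hx := by
    have hx' : x.1.1 ≠ 0 := by
      intro h
      have h2 : x.1.2 = 0 := by
        by_contra h2
        exact x.2.2 h2 h
      exact hx (Subtype.ext (Prod.ext h h2))
    exact Subtype.ext (Prod.ext (mul_inv_cancel₀ hx') (mul_inv_cancel₀ (x.2.1 hx')))

/-- Componentwise partial addition: `(p₁, p₂) + (q₁, q₂)` is defined if and only if both
`p₁ + q₁` and `p₂ + q₂` are defined and `p₁ + q₁ = 0 ↔ p₂ + q₂ = 0`. -/
def DirectProduct.add (x y : DirectProduct P Q) : Part (DirectProduct P Q) :=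
  ⟨∃ (h₁ : (padd x.1.1 y.1.1).Dom) (h₂ : (padd x.1.2 y.1.2).Dom),
      (padd x.1.1 y.1.1).get h₁ = 0 ↔ (padd x.1.2 y.1.2).get h₂ = 0,
    fun h => ⟨((padd x.1.1 y.1.1).get h.1, (padd x.1.2 y.1.2).get h.2.1), not_congr h.2.2⟩⟩

theorem DirectProduct.mem_add {x y z : DirectProduct P Q} :
    z ∈ DirectProduct.add x y ↔ z.1.1 ∈ padd x.1.1 y.1.1 ∧ z.1.2 ∈ padd x.1.2 y.1.2 := by
  constructor
  · rintro ⟨⟨h₁, h₂, h⟩, rfl⟩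
    exact ⟨Part.get_mem h₁, Part.get_mem h₂⟩
  · rintro ⟨⟨h₁, e₁⟩, ⟨h₂, e₂⟩⟩
    refine ⟨⟨h₁, h₂, ?_⟩, Subtype.ext (Prod.ext e₁ e₂)⟩
    rw [e₁, e₂]
    exact not_iff_not.1 z.2

/-- The direct product `P ⊗ Q` of two partial fields. -/
instance directProduct : PartialField (DirectProduct P Q) where
  padd := DirectProduct.add
  pneg x := ⟨(pneg x.1.1, pneg x.1.2), by
    simpa only [ne_eq, pneg_eq_zero_iff] using x.2⟩
  padd_zero p := by
    refine Part.eq_some_iff.2 (DirectProduct.mem_add.2 ⟨?_, ?_⟩)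
    · exact (padd_zero p.1.1).symm ▸ Part.mem_some _
    · exact (padd_zero p.1.2).symm ▸ Part.mem_some _
  zero_mem_padd_pneg p :=
    DirectProduct.mem_add.2 ⟨zero_mem_padd_pneg p.1.1, zero_mem_padd_pneg p.1.2⟩
  eq_pneg_of_zero_mem p q h := by
    obtain ⟨h₁, h₂⟩ := DirectProduct.mem_add.1 h
    exact Subtype.ext (Prod.ext (eq_pneg_of_zero_mem _ _ h₁) (eq_pneg_of_zero_mem _ _ h₂))
  padd_comm p q := by
    ext x
    rw [DirectProduct.mem_add, DirectProduct.mem_add, padd_comm p.1.1, padd_comm p.1.2]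
  mul_padd p q r hp := by
    have hp₁ : p.1.1 ≠ 0 := by
      intro h
      have h2 : p.1.2 = 0 := by
        by_contra h2
        exact p.2.2 h2 h
      exact hp (Subtype.ext (Prod.ext h h2))
    have hp₂ : p.1.2 ≠ 0 := p.2.1 hp₁
    ext x
    rw [Part.mem_map_iff, DirectProduct.mem_add]
    change _ ↔ x.1.1 ∈ padd (p.1.1 * q.1.1) (p.1.1 * r.1.1) ∧
      x.1.2 ∈ padd (p.1.2 * q.1.2) (p.1.2 * r.1.2)
    rw [← mul_padd _ _ _ hp₁, ← mul_padd _ _ _ hp₂, Part.mem_map_iff, Part.mem_map_iff]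
    constructor
    · rintro ⟨y, hy, rfl⟩
      obtain ⟨h₁, h₂⟩ := DirectProduct.mem_add.1 hy
      exact ⟨⟨_, h₁, rfl⟩, ⟨_, h₂, rfl⟩⟩
    · rintro ⟨⟨y₁, h₁, e₁⟩, ⟨y₂, h₂, e₂⟩⟩
      have hy : y₁ ≠ 0 ↔ y₂ ≠ 0 := by
        have hx := x.2
        rw [← e₁, ← e₂, mul_ne_zero_iff, mul_ne_zero_iff] at hx
        simpa [hp₁, hp₂] using hx
      exact ⟨⟨(y₁, y₂), hy⟩, DirectProduct.mem_add.2 ⟨h₁, h₂⟩, Subtype.ext (Prod.ext e₁ e₂)⟩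
  assoc_law s t r u w h hs ht := by
    have key₁ := fun {s : Multiset (DirectProduct P Q)} {r : DirectProduct P Q} =>
      Association.map (add := DirectProduct.add) (add' := padd (P := P))
        (fun x : DirectProduct P Q => x.1.1) (fun _ _ _ h => (DirectProduct.mem_add.1 h).1)
        (s := s) (r := r)
    have key₂ := fun {s : Multiset (DirectProduct P Q)} {r : DirectProduct P Q} =>
      Association.map (add := DirectProduct.add) (add' := padd (P := Q))
        (fun x : DirectProduct P Q => x.1.2) (fun _ _ _ h => (DirectProduct.mem_add.1 h).2)
        (s := s) (r := r)
    refine DirectProduct.mem_add.2 ⟨?_, ?_⟩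
    · exact assoc_law _ _ _ _ _ (Multiset.map_add _ s t ▸ key₁ h) (key₁ hs) (key₁ ht)
    · exact assoc_law _ _ _ _ _ (Multiset.map_add _ s t ▸ key₂ h) (key₂ hs) (key₂ ht)

end DirectProduct

/-- The near-regular partial field `𝕌₁ = ℙ(ℚ(α), {α, 1 - α})`. -/
abbrev NearRegularField : Type :=
  FromRing (RatFunc ℚ) {u : (RatFunc ℚ)ˣ | (u : RatFunc ℚ) = RatFunc.X ∨
    (u : RatFunc ℚ) = 1 - RatFunc.X}

/-- A matroid is near-regular if it is representable over `𝕌₁`. -/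
def NearRegular {α : Type*} (M : Matroid α) : Prop := Representable NearRegularField M

instance fact_prime_five : Fact (Nat.Prime 5) := ⟨by norm_num⟩

end PartialField

/-! All four conditions are moved from partial fields to rings. If a partial field sits in a
commutative ring as `G ∪ {0}` with restricted addition, then `M` is representable over it exactly
when `M` has a matrix over the ring all of whose minors are zero or in `G`
(`IsRingEmbedding.representable_iff`). For the two products of finite fields the ring is the product
`R` of the fields and `G` consists of all units. For 𝕌₁ the ring can be taken to be `O = ℤ[α, 1/α,
1/(1-α)]`, with `G` generated by `-1`, `α`, `1 - α`.

Ring homomorphisms that respect the groups transport representations. Evaluating `α` at any element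
other than `0`, `1` of a field takes near-regular matrices to that field, and the evaluation `O → R`
takes them to `R`. Conversely, if `M` is representable over two fields, normalize both matrices to
be the identity on the same basis. Every minor is then a maximal minor, so corresponding minors
vanish together and the pair is a matrix over the product ring whose minors are zero or units
(`RingRepresentable.prod`).

The hard direction lifts a matrix over `R` with all minors zero or units to a matrix over `O` with
all minors zero or in `G` (`IsLifting.liftable`). Call `x` an exceptional unit if `x` and `1 - x`
are units. `GF(3)`, `GF(4)`, `GF(5)`, `GF(8)` have 1, 2, 3, 6 of them, so `R` has six in both cases.
They are the six associates of one suitable element, and the evaluation `φ : O → R` matches them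
with the associates of `α`, which are all the elements `f` of `G`, other than possibly `-1`, with `1
- f` in `G`. A cross ratio of a 2 × 2 submatrix without zeros is `1` or an exceptional unit, hence
has a unique lift. The factor `GF(3)` makes these lifts compatible: a fundamental element other than
`1` reduces to `-1` in `GF(3)`, so a product of two of them can be fundamental only if it is `1`
(`IsLifting.fundamental_mul`).

The lift is built by induction on the size of the matrix, along the bipartite graph of its nonzero
entries. Disconnected graphs and vertices of degree at most one are immediate. If some vertex has
degree three, there are two rows or two columns, say columns `u` and `v`, whose removal leaves the
graph connected. The lifts with `u` and with `v` deleted agree on the common columns after rescaling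
(`exists_scaling`) and are glued. Minors that meet both `u` and `v` are reduced by pivoting to 2 × 2
minors (`minorsIn_of_two_columns`), and walks between their two rows are shortened by pivoting
(`zeroOrMem_of_joined`) until only cross ratios and one 3 × 4 pattern remain (`lift_path_three`). If
all degrees are two, the graph is a cycle: the 2 × 2 case is done by hand, and in a longer cycle one
pivot creates a vertex of degree three. -/

namespace PartialField

open Matrix

/-! ### Minors that are zero or in a group of units, and pivoting. -/

section Minors

variable {R X Y Z : Type*} [CommRing R] {G : Subgroup Rˣ}

/-- `x` is zero or a unit that belongs to the group `G`. -/
def ZeroOrMem (G : Subgroup Rˣ) (x : R) : Prop := x = 0 ∨ ∃ g ∈ G, (g : R) = x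

theorem ZeroOrMem.zero : ZeroOrMem G (0 : R) := Or.inl rfl

theorem ZeroOrMem.of_mem {g : Rˣ} (hg : g ∈ G) : ZeroOrMem G (g : R) := Or.inr ⟨g, hg, rfl⟩

theorem ZeroOrMem.one : ZeroOrMem G (1 : R) := Or.inr ⟨1, G.one_mem, rfl⟩

theorem ZeroOrMem.mul {x y : R} (hx : ZeroOrMem G x) (hy : ZeroOrMem G y) :
    ZeroOrMem G (x * y) := by
  rcases hx with rfl | ⟨g, hg, rfl⟩
  · rw [zero_mul]; exact .zero
  rcases hy with rfl | ⟨k, hk, rfl⟩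
  · rw [mul_zero]; exact .zero
  exact Or.inr ⟨g * k, G.mul_mem hg hk, rfl⟩

theorem ZeroOrMem.neg (hG : -1 ∈ G) {x : R} (hx : ZeroOrMem G x) : ZeroOrMem G (-x) := by
  simpa using (ZeroOrMem.of_mem hG).mul hx

theorem ZeroOrMem.neg_iff (hG : -1 ∈ G) {x : R} : ZeroOrMem G (-x) ↔ ZeroOrMem G x :=
  ⟨fun h => by simpa using h.neg hG, fun h => h.neg hG⟩

theorem ZeroOrMem.sub_comm_iff (hG : -1 ∈ G) {x y : R} :
    ZeroOrMem G (x - y) ↔ ZeroOrMem G (y - x) := by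
  rw [← ZeroOrMem.neg_iff hG, neg_sub]

theorem ZeroOrMem.neg_one_pow_mul (hG : -1 ∈ G) (n : ℕ) {x : R} (hx : ZeroOrMem G x) :
    ZeroOrMem G ((-1) ^ n * x) := by
  rcases neg_one_pow_eq_or R n with h | h <;> rw [h]
  · simpa using hx
  · simpa using hx.neg hG

theorem ZeroOrMem.mul_iff {g : Rˣ} (hg : g ∈ G) {x : R} :
    ZeroOrMem G (g * x) ↔ ZeroOrMem G x :=
  ⟨fun h => by simpa using (ZeroOrMem.of_mem (G.inv_mem hg)).mul h,
    fun h => (ZeroOrMem.of_mem hg).mul h⟩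

theorem ZeroOrMem.exists_of_ne {x : R} (hx : ZeroOrMem G x) (h : x ≠ 0) :
    ∃ g ∈ G, (g : R) = x := hx.resolve_left h

theorem ZeroOrMem.isUnit {x : R} (hx : ZeroOrMem G x) (h : x ≠ 0) : IsUnit x := by
  obtain ⟨g, -, rfl⟩ := hx.exists_of_ne h
  exact g.isUnit

theorem zeroOrMem_top_iff {x : R} : ZeroOrMem (⊤ : Subgroup Rˣ) x ↔ x = 0 ∨ IsUnit x := by
  constructor
  · rintro (h | ⟨g, -, rfl⟩)
    exacts [Or.inl h, Or.inr g.isUnit]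
  · rintro (h | ⟨g, rfl⟩)
    exacts [Or.inl h, .of_mem trivial]

theorem ZeroOrMem.sign_mul (hG : -1 ∈ G) (e : ℤˣ) {x : R} :
    ZeroOrMem G (((e : ℤ) : R) * x) ↔ ZeroOrMem G x := by
  rcases Int.units_eq_one_or e with rfl | rfl
  · simp
  · simpa using ZeroOrMem.neg_iff hG

/-- All minors of `A` with columns in `T` are zero or in `G`. -/
def MinorsOn (G : Subgroup Rˣ) (A : Matrix X Y R) (T : Set Y) : Prop :=
  ∀ (k : ℕ) (f : Fin k → X) (g : Fin k → Y), (∀ i, g i ∈ T) → ZeroOrMem G (A.submatrix f g).det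

/-- All minors of `A` are zero or in `G`. -/
def MinorsIn (G : Subgroup Rˣ) (A : Matrix X Y R) : Prop :=
  ∀ (k : ℕ) (f : Fin k → X) (g : Fin k → Y), ZeroOrMem G (A.submatrix f g).det

theorem MinorsIn.minorsOn {A : Matrix X Y R} (h : MinorsIn G A) (T : Set Y) : MinorsOn G A T :=
  fun k f g _ => h k f g

theorem MinorsOn.mono {A : Matrix X Y R} {S T : Set Y} (h : MinorsOn G A T) (hST : S ⊆ T) :
    MinorsOn G A S := fun k f g hg => h k f g fun i => hST (hg i)

theorem minorsOn_iff {A : Matrix X Y R} {T : Set Y} :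
    MinorsOn G A T ↔ MinorsIn G (A.submatrix id (Subtype.val : T → Y)) :=
  ⟨fun h k f g => h k f (fun i => (g i).1) fun i => (g i).2,
    fun h k f g hg => h k f fun i => ⟨g i, hg i⟩⟩

theorem MinorsOn.congr {A B : Matrix X Y R} {T : Set Y} (h : MinorsOn G A T)
    (hAB : ∀ x, ∀ y ∈ T, A x y = B x y) : MinorsOn G B T := by
  intro k f g hg
  convert h k f g hg using 2
  ext i j
  exact (hAB _ _ (hg j)).symm

theorem MinorsIn.submatrix {A : Matrix X Y R} (h : MinorsIn G A) {X' Y' : Type*}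
    (f : X' → X) (g : Y' → Y) : MinorsIn G (A.submatrix f g) :=
  fun k f' g' => h k (f ∘ f') (g ∘ g')

theorem MinorsIn.transpose {A : Matrix X Y R} (h : MinorsIn G A) : MinorsIn G Aᵀ := by
  intro k f g
  rw [← det_transpose]
  exact h k g f

theorem MinorsOn.det {A : Matrix X Y R} {T : Set Y} (h : MinorsOn G A T) {m : Type*} [Fintype m]
    [DecidableEq m] (f : m → X) (g : m → Y) (hg : ∀ i, g i ∈ T) :
    ZeroOrMem G (A.submatrix f g).det := by
  let e := (Fintype.equivFin m).symm
  rw [← det_submatrix_equiv_self e]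
  exact h _ (f ∘ e) (g ∘ e) fun i => hg _

theorem MinorsIn.det {A : Matrix X Y R} (h : MinorsIn G A) {m : Type*} [Fintype m]
    [DecidableEq m] (f : m → X) (g : m → Y) : ZeroOrMem G (A.submatrix f g).det :=
  (h.minorsOn Set.univ).det f g fun _ => trivial

theorem MinorsOn.apply {A : Matrix X Y R} {T : Set Y} (h : MinorsOn G A T) (x : X) {y : Y}
    (hy : y ∈ T) : ZeroOrMem G (A x y) := by
  simpa using h 1 (fun _ => x) (fun _ => y) fun _ => hy

theorem MinorsIn.apply {A : Matrix X Y R} (h : MinorsIn G A) (x : X) (y : Y) :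
    ZeroOrMem G (A x y) := (h.minorsOn Set.univ).apply x trivial

theorem MinorsOn.two {A : Matrix X Y R} {T : Set Y} (h : MinorsOn G A T) (p q : X) {u v : Y}
    (hu : u ∈ T) (hv : v ∈ T) : ZeroOrMem G (A p u * A q v - A p v * A q u) := by
  have := h 2 ![p, q] ![u, v] (by intro i; fin_cases i <;> simpa)
  rwa [det_fin_two] at this

theorem MinorsOn.three {A : Matrix X Y R} {T : Set Y} (h : MinorsOn G A T) (p q r : X) {u v w : Y}
    (hu : u ∈ T) (hv : v ∈ T) (hw : w ∈ T) :
    ZeroOrMem G (A p u * A q v * A r w - A p u * A q w * A r v - A p v * A q u * A r w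
      + A p v * A q w * A r u + A p w * A q u * A r v - A p w * A q v * A r u) := by
  have := h 3 ![p, q, r] ![u, v, w] (by intro i; fin_cases i <;> simpa)
  rwa [det_fin_three] at this

theorem det_submatrix_eq_zero_of_not_injective_left (A : Matrix X Y R) {m : Type*} [Fintype m]
    [DecidableEq m] {f : m → X} (g : m → Y) (hf : ¬ Function.Injective f) :
    (A.submatrix f g).det = 0 := by
  simp only [Function.Injective, not_forall] at hf
  obtain ⟨i, j, h, hij⟩ := hf
  exact det_zero_of_row_eq hij (by ext c; simp [h])

theorem det_submatrix_eq_zero_of_not_injective_right (A : Matrix X Y R) {m : Type*} [Fintype m]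
    [DecidableEq m] (f : m → X) {g : m → Y} (hg : ¬ Function.Injective g) :
    (A.submatrix f g).det = 0 := by
  rw [← det_transpose, transpose_submatrix]
  exact det_submatrix_eq_zero_of_not_injective_left _ _ hg

/-- If column `j` has at most one nonzero entry, then expanding along it leaves one term. -/
theorem zeroOrMem_det_of_column (hG : -1 ∈ G) {n : ℕ} (N : Matrix (Fin (n + 1)) (Fin (n + 1)) R)
    (i j : Fin (n + 1)) (h0 : ∀ i', i' ≠ i → N i' j = 0) (h1 : ZeroOrMem G (N i j))
    (h2 : ZeroOrMem G (N.submatrix i.succAbove j.succAbove).det) : ZeroOrMem G N.det := by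
  rw [det_succ_column N j, Finset.sum_eq_single i]
  · exact ((h1.neg_one_pow_mul hG _)).mul h2
  · intro i' _ hi'
    rw [h0 i' hi']; simp
  · simp

/-- Appending unit columns to `A` does not create new minors. -/
theorem MinorsIn.fromCols_one [DecidableEq X] (hG : -1 ∈ G) {A : Matrix X Y R}
    (h : MinorsIn G A) : MinorsIn G (fromCols A (1 : Matrix X X R)) := by
  intro k
  induction k with
  | zero => intro f g; simp only [det_isEmpty]; exact .one
  | succ k ih =>
    intro f g
    by_cases hg : ∀ j, ∃ y, g j = Sum.inl y
    · choose g' hg' using hg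
      convert h (k + 1) f g' using 2
      ext i j
      simp [hg']
    · push Not at hg
      obtain ⟨j, hj⟩ := hg
      obtain ⟨x, hx⟩ : ∃ x, g j = Sum.inr x := by
        rcases hgj : g j with y | x
        · exact absurd hgj (hj y)
        · exact ⟨x, rfl⟩
      by_cases hf : Function.Injective f
      · by_cases hi : ∃ i, f i = x
        · obtain ⟨i, rfl⟩ := hi
          refine zeroOrMem_det_of_column hG _ i j ?_ ?_ ?_
          · intro i' hi'
            simp [hx, one_apply, hf.eq_iff, hi']
          · simp only [submatrix_apply, hx, fromCols_apply_inr, one_apply_eq]; exact .one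
          · exact ih _ _
        · rw [det_eq_zero_of_column_eq_zero j]
          · exact .zero
          · intro i
            have : f i ≠ x := fun h => hi ⟨i, h⟩
            simp [hx, one_apply, this]
      · rw [det_submatrix_eq_zero_of_not_injective_left _ _ hf]
        exact .zero

/-- A minor of a matrix that contains an identity matrix equals a maximal minor. -/
theorem det_submatrix_eq_maximal [Fintype X] [DecidableEq X] {m : Type*} [Fintype m]
    [DecidableEq m] {E : Type*} (N : Matrix X E R) (f₀ : X → E) (h0 : N.submatrix id f₀ = 1)
    (f : m → X) (hf : Function.Injective f) (g : m → E) (h : X → E) (hg : ∀ i, h (f i) = g i)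
    (hn : ∀ x, x ∉ Set.range f → h x = f₀ x) :
    (N.submatrix f g).det = (N.submatrix id h).det := by
  classical
  rw [twoBlockTriangular_det' (N.submatrix id h) (fun x => x ∈ Set.range f)]
  · have h1 : ((N.submatrix id h).toSquareBlockProp fun x => x ∉ Set.range f) = 1 := by
      ext ⟨i, hi⟩ ⟨j, hj⟩
      have := congrFun (congrFun h0 i) j
      simp only [submatrix_apply, id] at this
      simp [toSquareBlockProp, hn j hj, this, one_apply]
    rw [h1, det_one, mul_one]
    let e : m ≃ {x // x ∈ Set.range f} := Equiv.ofInjective f hf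
    have e1 : N.submatrix f g =
        ((N.submatrix id h).toSquareBlockProp fun x => x ∈ Set.range f).submatrix e e := by
      ext i j
      simp [toSquareBlockProp, e, hg]
    rw [e1, det_submatrix_equiv_self e]
    congr!
  · intro i hi j hj
    have := congrFun (congrFun h0 i) j
    simp only [submatrix_apply, id] at this
    simp only [submatrix_apply, id, hn j hj, this]
    exact one_apply_ne (by rintro rfl; exact hj hi)

open Classical in
/-- The result of pivoting in `A` on the entry `x`, `y`: the row element `x` and the column element
`y` are exchanged, while the index sets are kept. -/
noncomputable def pivot (A : Matrix X Y R) (x : X) (y : Y) : Matrix X Y R := fun i j =>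
  if i = x then (if j = y then Ring.inverse (A x y) else Ring.inverse (A x y) * A x j)
  else if j = y then -(A i y * Ring.inverse (A x y))
  else A i j - A i y * Ring.inverse (A x y) * A x j

theorem pivot_self (A : Matrix X Y R) (x : X) (y : Y) :
    pivot A x y x y = Ring.inverse (A x y) := by simp [pivot]

theorem pivot_row (A : Matrix X Y R) (x : X) {y j : Y} (h : j ≠ y) :
    pivot A x y x j = Ring.inverse (A x y) * A x j := by simp [pivot, h]

theorem pivot_col (A : Matrix X Y R) {x i : X} (y : Y) (h : i ≠ x) :
    pivot A x y i y = -(A i y * Ring.inverse (A x y)) := by simp [pivot, h]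

theorem pivot_of_ne (A : Matrix X Y R) {x i : X} {y j : Y} (hi : i ≠ x) (hj : j ≠ y) :
    pivot A x y i j = A i j - A i y * Ring.inverse (A x y) * A x j := by simp [pivot, hi, hj]

theorem pivot_pivot (A : Matrix X Y R) (x : X) (y : Y) (h : IsUnit (A x y)) :
    pivot (pivot A x y) x y = A := by
  obtain ⟨a, ha⟩ := h
  ext i j
  have h1 : pivot A x y x y = (a⁻¹ : Rˣ) := by rw [pivot_self, ← ha, Ring.inverse_unit]
  by_cases hi : i = x
  · subst hi
    by_cases hj : j = y
    · subst hj
      rw [pivot_self, h1, Ring.inverse_unit, inv_inv, ha]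
    · rw [pivot_row _ _ hj, h1, pivot_row _ _ hj, ← ha, Ring.inverse_unit, Ring.inverse_unit,
        inv_inv, Units.mul_inv_cancel_left]
  · by_cases hj : j = y
    · subst hj
      rw [pivot_col _ _ hi, h1, pivot_col _ _ hi, ← ha, Ring.inverse_unit, Ring.inverse_unit,
        inv_inv, neg_mul, neg_neg, Units.inv_mul_cancel_right]
    · rw [pivot_of_ne _ hi hj, h1, pivot_of_ne _ hi hj, pivot_row _ _ hj, pivot_col _ _ hi, ← ha,
        Ring.inverse_unit, Ring.inverse_unit, inv_inv]
      linear_combination (A i y * A x j * (a⁻¹ : Rˣ)) * a.inv_mul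

theorem pivot_map {S : Type*} [CommRing S] (φ : R →+* S) (A : Matrix X Y R) (x : X) (y : Y)
    (h : IsUnit (A x y)) : (pivot A x y).map φ = pivot (A.map φ) x y := by
  obtain ⟨a, ha⟩ := h
  have h1 : φ (Ring.inverse (A x y)) = Ring.inverse (φ (A x y)) := by
    rw [← ha, Ring.inverse_unit]
    exact (Ring.inverse_unit (Units.map φ.toMonoidHom a)).symm
  ext i j
  by_cases hi : i = x
  · subst hi
    by_cases hj : j = y
    · subst hj
      simp [pivot_self, h1]
    · simp [pivot_row _ _ hj, h1]
  · by_cases hj : j = y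
    · subst hj
      simp [pivot_col _ _ hi, h1]
    · simp [pivot_of_ne _ hi hj, h1]

theorem pivot_submatrix_val (A : Matrix X Y R) (x : X) {T : Set Y} (y : T) :
    (pivot A x y).submatrix id (Subtype.val : T → Y) = pivot (A.submatrix id Subtype.val) x y := by
  ext i j
  by_cases hi : i = x <;> by_cases hj : j = y <;>
    simp [pivot, hi, hj, mt (Subtype.ext (a1 := j) (a2 := y))]

/-- Pivoting amounts to row operations on `[A | 1]` followed by exchanging the column `y` with the
unit column of `x`. A minor of the result extends to a maximal minor, which is a maximal minor of
`[A | 1]` divided by the pivot entry. -/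
theorem MinorsIn.pivot [Finite X] (hG : -1 ∈ G) {A : Matrix X Y R} (h : MinorsIn G A) (x : X)
    (y : Y) (hxy : IsUnit (A x y)) : MinorsIn G (pivot A x y) := by
  classical
  cases subsingleton_or_nontrivial R
  · intro k f g
    exact Or.inl (Subsingleton.elim _ _)
  have : Fintype X := Fintype.ofFinite X
  obtain ⟨a, haG, ha⟩ := (h.apply x y).exists_of_ne hxy.ne_zero
  have ha' : Ring.inverse (A x y) = (a⁻¹ : Rˣ) := by rw [← ha, Ring.inverse_unit]
  -- The matrix of the row operations that turn column `y` of `A` into the unit column of `x`.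
  let E : Matrix X X R := updateCol 1 x fun i => if i = x then (a⁻¹ : Rˣ) else -(A i y * (a⁻¹ : Rˣ))
  have hE : E.det = (a⁻¹ : Rˣ) := by
    rw [← cramer_apply, cramer_one]; simp
  let N := fromCols A (1 : Matrix X X R)
  have hN : MinorsIn G N := h.fromCols_one hG
  have hEN : ∀ i e, (E * N) i e = if i = x then (a⁻¹ : Rˣ) * N x e
      else N i e - A i y * (a⁻¹ : Rˣ) * N x e := by
    intro i e
    have key : ∀ z, E i z = (if i = z then 1 else 0) +
        if z = x then (if i = x then ((a⁻¹ : Rˣ) : R) - 1 else -(A i y * (a⁻¹ : Rˣ))) else 0 := by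
      intro z
      simp only [E, updateCol_apply, one_apply]
      split_ifs <;> simp_all
    simp only [mul_apply, key, add_mul, Finset.sum_add_distrib, ite_mul, one_mul, zero_mul,
      Finset.sum_ite_eq, Finset.sum_ite_eq', Finset.mem_univ, if_true]
    split_ifs with hi
    · subst hi; ring
    · ring
  let h0 : Y ⊕ X → Y ⊕ X := Sum.elim (fun j => if j = y then Sum.inr x else Sum.inl j)
    (fun i => if i = x then Sum.inl y else Sum.inr i)
  have hP : fromCols (PartialField.pivot A x y) (1 : Matrix X X R) = (E * N).submatrix id h0 := by
    ext i e
    rw [submatrix_apply, id, hEN]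
    rcases e with j | z
    · by_cases hj : j = y
      · subst hj
        by_cases hi : i = x
        · subst hi; simp [h0, N, pivot_self, ha']
        · simp [h0, N, pivot_col _ _ hi, ha', hi]
      · by_cases hi : i = x
        · subst hi; simp [h0, N, pivot_row _ _ hj, ha', hj]
        · simp [h0, N, pivot_of_ne _ hi hj, ha', hj, hi]
    · by_cases hz : z = x
      · subst hz
        by_cases hi : i = z
        · subst hi; simp [h0, N, ← ha]
        · simp [h0, N, ← ha, hi]
      · by_cases hi : i = x
        · subst hi; simp [h0, N, hz, one_apply, Ne.symm hz]
        · simp [h0, N, hz, hi, one_apply, Ne.symm hz]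
  intro k f g
  by_cases hf : Function.Injective f
  -- Rows outside the range of `f` are matched with their own unit columns, so that the minor
  -- becomes maximal.
  · let hh : X → Y ⊕ X := fun z => if hz : ∃ i, f i = z then Sum.inl (g hz.choose) else Sum.inr z
    have e1 := det_submatrix_eq_maximal (fromCols (PartialField.pivot A x y) (1 : Matrix X X R))
      Sum.inr (by ext i j; simp) f hf (fun i => Sum.inl (g i)) hh
      (by
        intro i
        have hz : ∃ i', f i' = f i := ⟨i, rfl⟩
        simp only [hh, dif_pos hz]
        rw [hf hz.choose_spec])
      (by
        intro z hz
        simp only [hh]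
        rw [dif_neg]
        simpa using hz)
    have e2 : (fromCols (PartialField.pivot A x y) (1 : Matrix X X R)).submatrix f
        (fun i => Sum.inl (g i)) = (PartialField.pivot A x y).submatrix f g := by
      ext i j; simp
    rw [← e2, e1, hP, submatrix_submatrix]
    have e3 : (E * N).submatrix (id ∘ id) (h0 ∘ hh) = E * N.submatrix id (h0 ∘ hh) := by
      ext i j; simp [mul_apply]
    rw [e3, det_mul, hE]
    exact (ZeroOrMem.of_mem (G.inv_mem haG)).mul (hN.det _ _)
  · rw [det_submatrix_eq_zero_of_not_injective_left _ _ hf]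
    exact .zero

theorem MinorsOn.pivot [Finite X] (hG : -1 ∈ G) {A : Matrix X Y R} {T : Set Y}
    (h : MinorsOn G A T) (x : X) {y : Y} (hy : y ∈ T) (hxy : IsUnit (A x y)) :
    MinorsOn G (pivot A x y) T := by
  rw [minorsOn_iff] at h ⊢
  rw [pivot_submatrix_val A x ⟨y, hy⟩]
  exact h.pivot hG x ⟨y, hy⟩ hxy

/-- Computing a determinant by pivoting on the entry `i`, `j`. -/
theorem det_eq_mul_det_schur {n : ℕ} (N : Matrix (Fin (n + 1)) (Fin (n + 1)) R)
    (i j : Fin (n + 1)) (hij : IsUnit (N i j)) :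
    N.det = (-1) ^ (i + j : ℕ) * N i j * Matrix.det (fun r c : Fin n =>
      N (i.succAbove r) (j.succAbove c)
        - N (i.succAbove r) j * Ring.inverse (N i j) * N i (j.succAbove c)) := by
  let N' : Matrix (Fin (n + 1)) (Fin (n + 1)) R := fun r c =>
    if r = i then N i c else N r c - N r j * Ring.inverse (N i j) * N i c
  have h1 : N.det = N'.det := by
    refine det_eq_of_forall_row_eq_smul_add_const
      (fun r => if r = i then 0 else N r j * Ring.inverse (N i j)) i (by simp) ?_
    intro r c
    by_cases hr : r = i
    · subst hr; simp [N']
    · simp [N', hr]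
  rw [h1, det_succ_column N' j, Finset.sum_eq_single i]
  · have e1 : N' i j = N i j := by simp [N']
    rw [e1]
    congr 2
    ext r c
    change N' (i.succAbove r) (j.succAbove c) = _
    simp [N']
  · intro r _ hr
    have : N' r j = 0 := by
      simp only [N', if_neg hr]
      rw [mul_assoc, Ring.inverse_mul_cancel _ hij]; ring
    rw [this]; simp
  · simp

theorem MinorsOn.scale {A : Matrix X Y R} {T : Set Y} (h : MinorsOn G A T) (s : X → Rˣ)
    (t : Y → Rˣ) (hs : ∀ x, s x ∈ G) (ht : ∀ y, t y ∈ G) :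
    MinorsOn G (Matrix.of fun x y => (s x : R) * A x y * t y) T := by
  intro k f g hg
  have : (Matrix.of fun x y => (s x : R) * A x y * t y).submatrix f g =
      diagonal (fun i => (s (f i) : R)) * A.submatrix f g * diagonal (fun i => (t (g i) : R)) := by
    ext i j
    simp
  rw [this, det_mul, det_mul, det_diagonal, det_diagonal, ← Units.coe_prod, ← Units.coe_prod]
  exact ((ZeroOrMem.of_mem (G.prod_mem fun i _ => hs _)).mul (h k f g hg)).mul
    (ZeroOrMem.of_mem (G.prod_mem fun i _ => ht _))

theorem MinorsIn.map {S : Type*} [CommRing S] {A : Matrix X Y R} (h : MinorsIn G A)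
    (φ : R →+* S) {H : Subgroup Sˣ} (hH : ∀ g ∈ G, Units.map φ.toMonoidHom g ∈ H) :
    MinorsIn H (A.map φ) := by
  intro k f g
  rw [submatrix_map, ← RingHom.mapMatrix_apply, ← RingHom.map_det]
  rcases h k f g with h | ⟨u, hu, h⟩
  · rw [h, map_zero]; exact .zero
  · rw [← h]
    exact Or.inr ⟨_, hH u hu, rfl⟩

end Minors

end PartialField

namespace PartialField

open Matrix

/-! ### The universal ring of a partial field, in which defined sums are detected. -/

section NullSums

variable {P : Type*} [PartialField P]

theorem mul_mem_padd {p q r : P} (c : P) (hc : c ≠ 0) (h : r ∈ padd p q) :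
    c * r ∈ padd (c * p) (c * q) := by
  rw [← mul_padd _ _ _ hc]
  exact Part.mem_map _ h

theorem pneg_eq_mul (p : P) : pneg p = p * pneg 1 := by
  by_cases hp : p = 0
  · subst hp
    rw [zero_mul, pneg_eq_zero_iff]
  · refine (eq_pneg_of_zero_mem p _ ?_).symm
    simpa using mul_mem_padd p hp (zero_mem_padd_pneg (1 : P))

theorem pneg_pneg (p : P) : pneg (pneg p) = p := by
  refine (eq_pneg_of_zero_mem (pneg p) p ?_).symm
  rw [padd_comm]
  exact zero_mem_padd_pneg p

theorem mul_pneg (p q : P) : p * pneg q = pneg (p * q) := by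
  rw [pneg_eq_mul q, pneg_eq_mul (p * q), mul_assoc]

theorem zero_mem_padd_zero : (0 : P) ∈ padd (0 : P) 0 := by
  rw [padd_zero]; exact Part.mem_some _

theorem mem_padd_zero (p : P) : p ∈ padd p 0 := by
  rw [padd_zero]; exact Part.mem_some _

theorem SumIs.add {s t : Multiset P} {a b c : P} (hs : SumIs s a) (ht : SumIs t b)
    (h : c ∈ padd a b) : SumIs (s + t) c := by
  obtain ⟨z, hz⟩ := hs
  obtain ⟨w, hw⟩ := ht
  refine ⟨z + w, ?_⟩
  have := Association.node hz hw h
  rw [Multiset.map_add]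
  convert this using 1
  abel

theorem SumIs.singleton (p : P) : SumIs {p} p := ⟨0, by simpa using Association.leaf p⟩

theorem SumIs.cancel {s z : Multiset P} {r : P} (h : SumIs (s + (z + z.map pneg)) r) :
    SumIs s r := by
  obtain ⟨w, hw⟩ := h
  refine ⟨z + w, ?_⟩
  rw [Multiset.map_add]
  convert hw using 1
  abel

theorem SumIs.pair (p : P) : SumIs ({p} + {pneg p}) 0 :=
  (SumIs.singleton p).add (.singleton _) (zero_mem_padd_pneg p)

/-- The empty multiset has no association, so a cancelling pair `{1, -1}` has to be inserted. -/
theorem SumIs.empty : SumIs (0 : Multiset P) 0 := by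
  refine SumIs.cancel (z := {1}) ?_
  simpa using SumIs.pair (1 : P)

theorem SumIs.zeros (s : Multiset P) : SumIs (s.map fun _ => (0 : P)) 0 := by
  induction s using Multiset.induction_on with
  | empty => simpa using SumIs.empty
  | cons p z ih =>
    simpa [← Multiset.singleton_add] using (SumIs.singleton (0 : P)).add ih zero_mem_padd_zero

theorem SumIs.mul {s : Multiset P} {r : P} (c : P) (h : SumIs s r) (hc : c ≠ 0) :
    SumIs (s.map (c * ·)) (c * r) := by
  obtain ⟨z, hz⟩ := h
  refine ⟨z.map (c * ·), ?_⟩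
  have := Association.map (add' := padd (P := P)) (c * ·)
    (fun p q r h => mul_mem_padd c hc h) hz
  simpa [Multiset.map_add, Multiset.map_map, Function.comp_def, mul_pneg] using this

theorem SumIs.zero_mul {s : Multiset P} (c : P) (h : SumIs s 0) : SumIs (s.map (c * ·)) 0 := by
  by_cases hc : c = 0
  · subst hc
    simpa using SumIs.zeros s
  · simpa using h.mul c hc

/-- Adding the single term `r` gives the value `r`, and then `r` and `-r` form a cancelling pair. -/
theorem SumIs.of_add_pneg {s : Multiset P} {r : P} (h : SumIs (s + {pneg r}) 0) : SumIs s r := by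
  refine SumIs.cancel (z := {r}) ?_
  have := (SumIs.singleton r).add h (mem_padd_zero r)
  convert this using 1
  simp only [Multiset.map_singleton]
  abel

/-- The formal sum of the elements of a multiset. -/
def formalSum (s : Multiset P) : FreeAbelianGroup P := (s.map FreeAbelianGroup.of).sum

theorem formalSum_add (s t : Multiset P) : formalSum (s + t) = formalSum s + formalSum t := by
  simp [formalSum]

theorem formalSum_singleton (p : P) : formalSum {p} = FreeAbelianGroup.of p := by
  simp [formalSum]

theorem formalSum_map_mul (c : P) (s : Multiset P) :
    formalSum (s.map (c * ·)) = FreeAbelianGroup.of c * formalSum s := by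
  simp [formalSum, ← Multiset.sum_map_mul_left, Multiset.map_map,
    FreeAbelianGroup.of_mul_of]

theorem formalSum_injective : Function.Injective (formalSum (P := P)) := by
  classical
  have key : ∀ (p : P) (s : Multiset P),
      FreeAbelianGroup.coeff p (formalSum s) = (s.count p : ℤ) := by
    intro p s
    induction s using Multiset.induction_on with
    | empty => simp [formalSum]
    | cons q s ih =>
      rw [← Multiset.singleton_add, formalSum_add, map_add, ih, formalSum_singleton]
      rw [Multiset.count_add, Multiset.count_singleton]
      simp [FreeAbelianGroup.coeff, Finsupp.single_apply, eq_comm]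
  intro s t h
  refine Multiset.ext' fun p => ?_
  have := congrArg (FreeAbelianGroup.coeff p) h
  rw [key, key] at this
  exact_mod_cast this

/-- The ideal of formal differences whose sum is defined and zero. -/
def nullIdeal (P : Type*) [PartialField P] : Ideal (FreeAbelianGroup P) where
  carrier := {x | ∃ s t : Multiset P, x = formalSum s - formalSum t ∧ SumIs (s + t.map pneg) 0}
  zero_mem' := ⟨0, 0, by simp, by simpa using SumIs.empty⟩
  add_mem' := by
    rintro _ _ ⟨s, t, rfl, h⟩ ⟨s', t', rfl, h'⟩
    refine ⟨s + s', t + t', by rw [formalSum_add, formalSum_add]; abel, ?_⟩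
    convert h.add h' zero_mem_padd_zero using 1
    rw [Multiset.map_add]
    abel
  smul_mem' := by
    intro c x hx
    have hmul : ∀ (p : P) (x : FreeAbelianGroup P),
        (∃ s t : Multiset P, x = formalSum s - formalSum t ∧ SumIs (s + t.map pneg) 0) →
        ∃ s t : Multiset P, FreeAbelianGroup.of p * x = formalSum s - formalSum t ∧
          SumIs (s + t.map pneg) 0 := by
      rintro p _ ⟨s, t, rfl, h⟩
      refine ⟨s.map (p * ·), t.map (p * ·), ?_, ?_⟩
      · rw [formalSum_map_mul, formalSum_map_mul, mul_sub]
      · have := h.zero_mul p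
        simpa [Multiset.map_add, Multiset.map_map, Function.comp_def, mul_pneg] using this
    have hneg : ∀ x : FreeAbelianGroup P,
        (∃ s t : Multiset P, x = formalSum s - formalSum t ∧ SumIs (s + t.map pneg) 0) →
        ∃ s t : Multiset P, -x = formalSum s - formalSum t ∧ SumIs (s + t.map pneg) 0 := by
      rintro _ ⟨s, t, rfl, h⟩
      refine ⟨t, s, by abel, ?_⟩
      have := h.zero_mul (pneg 1)
      rw [Multiset.map_add, Multiset.map_map, add_comm] at this
      convert this using 2
      · simp [mul_comm (pneg (1 : P)), ← pneg_eq_mul, pneg_pneg]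
      · exact Multiset.map_congr rfl fun x _ => by rw [mul_comm, ← pneg_eq_mul]
    rw [smul_eq_mul]
    induction c using FreeAbelianGroup.induction_on with
    | zero => rw [zero_mul]; exact ⟨0, 0, by simp, by simpa using SumIs.empty⟩
    | of p => exact hmul p x hx
    | neg p ih => rw [neg_mul]; exact hneg _ ih
    | add a b ha hb =>
      rw [add_mul]
      obtain ⟨s, t, e, h⟩ := ha
      obtain ⟨s', t', e', h'⟩ := hb
      refine ⟨s + s', t + t', by rw [e, e', formalSum_add, formalSum_add]; abel, ?_⟩
      convert h.add h' zero_mem_padd_zero using 1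
      rw [Multiset.map_add]
      abel

/-- Membership only says that `s` is a formal difference of some `s'` and `t`. Then `s' = s + t` as
multisets, and `t` cancels against its negatives in the null sum of `s'` and `-t`. This is what
makes the quotient detect defined sums. -/
theorem sumIs_zero_of_formalSum_mem {s : Multiset P} (h : formalSum s ∈ nullIdeal P) :
    SumIs s 0 := by
  obtain ⟨s', t, e, h⟩ := h
  have : s + t = s' := formalSum_injective (by rw [formalSum_add, e]; abel)
  rw [← this, add_assoc] at h
  exact h.cancel

theorem formalSum_mem_nullIdeal {s : Multiset P} (h : SumIs s 0) : formalSum s ∈ nullIdeal P :=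
  ⟨s, 0, by simp [formalSum], by simpa using h⟩

/-- The universal ring of the partial field `P`. -/
abbrev UniversalRing (P : Type*) [PartialField P] : Type _ := FreeAbelianGroup P ⧸ nullIdeal P

/-- The map from `P` to its universal ring. -/
def toUniversal (P : Type*) [PartialField P] : P →* UniversalRing P :=
  (Ideal.Quotient.mk (nullIdeal P)).toMonoidHom.comp FreeAbelianGroup.ofMulHom

theorem toUniversal_apply (p : P) :
    toUniversal P p = Ideal.Quotient.mk (nullIdeal P) (FreeAbelianGroup.of p) := rfl

theorem mk_formalSum (s : Multiset P) :
    Ideal.Quotient.mk (nullIdeal P) (formalSum s) = (s.map (toUniversal P)).sum := by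
  rw [formalSum, map_multiset_sum, Multiset.map_map]
  rfl

theorem toUniversal_zero : toUniversal P 0 = 0 := by
  rw [toUniversal_apply, Ideal.Quotient.eq_zero_iff_mem, ← formalSum_singleton]
  exact formalSum_mem_nullIdeal (.singleton 0)

theorem toUniversal_pneg (p : P) : toUniversal P (pneg p) = -toUniversal P p := by
  rw [eq_neg_iff_add_eq_zero, toUniversal_apply, toUniversal_apply, ← map_add,
    Ideal.Quotient.eq_zero_iff_mem, ← formalSum_singleton, ← formalSum_singleton, ← formalSum_add,
    add_comm]
  exact formalSum_mem_nullIdeal (.pair p)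

theorem toUniversal_of_mem_padd {p q r : P} (h : r ∈ padd p q) :
    toUniversal P r = toUniversal P p + toUniversal P q := by
  rw [← sub_eq_zero, sub_eq_add_neg, neg_add, ← toUniversal_pneg, ← toUniversal_pneg]
  simp only [toUniversal_apply, ← map_add, Ideal.Quotient.eq_zero_iff_mem, ← formalSum_singleton,
    ← formalSum_add]
  refine formalSum_mem_nullIdeal ?_
  have h1 : pneg r ∈ padd (pneg p) (pneg q) := by
    have := mul_mem_padd (pneg 1) (by simp [pneg_eq_zero_iff]) h
    simpa only [mul_comm (pneg (1 : P)), ← pneg_eq_mul] using this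
  exact (SumIs.singleton r).add ((SumIs.singleton _).add (.singleton _) h1) (zero_mem_padd_pneg r)

theorem toUniversal_signOf (e : ℤˣ) : toUniversal P (signOf P e) = ((e : ℤ) : UniversalRing P) := by
  rcases Int.units_eq_one_or e with rfl | rfl
  · simp [signOf]
  · simp [signOf, toUniversal_pneg]

theorem sumIs_of_toUniversal {s : Multiset P} {r : P}
    (h : (s.map (toUniversal P)).sum = toUniversal P r) : SumIs s r := by
  refine SumIs.of_add_pneg (sumIs_zero_of_formalSum_mem ?_)
  rw [← Ideal.Quotient.eq_zero_iff_mem, mk_formalSum]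
  simp [h, toUniversal_pneg]

theorem detIs_of_toUniversal {k : ℕ} {A : Matrix (Fin k) (Fin k) P} {d : P}
    (h : (A.map (toUniversal P)).det = toUniversal P d) : DetIs A d := by
  refine sumIs_of_toUniversal ?_
  rw [← h, ← det_transpose, det_apply', Multiset.map_map, Finset.sum_eq_multiset_sum]
  congr 1
  refine Multiset.map_congr rfl fun σ _ => ?_
  simp [toUniversal_signOf]

end NullSums

/-! ### Representations over a partial field as representations over a ring. -/

section Embedding

variable {P R : Type*} [PartialField P] [CommRing R] {G : Subgroup Rˣ} {e : P →*₀ R}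

/-- `e` identifies the partial field `P` with the subset `G ∪ {0}` of the ring `R`, with addition
restricted from `R`. -/
structure IsRingEmbedding (G : Subgroup Rˣ) (e : P →*₀ R) : Prop where
  mem_padd : ∀ p q r : P, r ∈ padd p q ↔ e r = e p + e q
  zeroOrMem_iff : ∀ x : R, ZeroOrMem G x ↔ ∃ p, e p = x

namespace IsRingEmbedding

theorem injective (he : IsRingEmbedding G e) : Function.Injective e := by
  intro p q h
  have : p ∈ padd q 0 := (he.mem_padd _ _ _).2 (by simpa using h)
  rw [padd_zero] at this
  exact Part.mem_some_iff.1 this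

theorem eq_zero_iff (he : IsRingEmbedding G e) {p : P} : e p = 0 ↔ p = 0 := by
  rw [← map_zero e, he.injective.eq_iff]

theorem map_pneg (he : IsRingEmbedding G e) (p : P) : e (pneg p) = -e p := by
  have := (he.mem_padd _ _ _).1 (zero_mem_padd_pneg p)
  rw [map_zero] at this
  linear_combination -this

theorem nontrivial (he : IsRingEmbedding G e) : Nontrivial R :=
  ⟨e 0, e 1, fun h => zero_ne_one (he.injective h)⟩

theorem neg_one_mem (he : IsRingEmbedding G e) : -1 ∈ G := by
  have := he.nontrivial
  have h : ZeroOrMem G (-1 : R) := (he.zeroOrMem_iff _).2 ⟨pneg 1, by simp [he.map_pneg]⟩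
  obtain ⟨g, hg, h⟩ := h.exists_of_ne (neg_ne_zero.2 one_ne_zero)
  rwa [show g = -1 from Units.ext (by simpa using h)] at hg

theorem map_sumIs (he : IsRingEmbedding G e) {s : Multiset P} {r : P} (h : SumIs s r) :
    (s.map e).sum = e r := by
  obtain ⟨z, hz⟩ := h
  have := association_hom e (fun p q r => (he.mem_padd p q r).1) hz
  rw [← this]
  simp [Multiset.map_map, he.map_pneg]

theorem map_signOf (he : IsRingEmbedding G e) (u : ℤˣ) : e (signOf P u) = ((u : ℤ) : R) := by
  rcases Int.units_eq_one_or u with rfl | rfl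
  · simp [signOf]
  · simp [signOf, he.map_pneg]

theorem map_detIs (he : IsRingEmbedding G e) {k : ℕ} {A : Matrix (Fin k) (Fin k) P} {d : P}
    (h : DetIs A d) : (A.map e).det = e d := by
  rw [← he.map_sumIs h, ← det_transpose, det_apply', Multiset.map_map, Finset.sum_eq_multiset_sum]
  congr 1
  refine Multiset.map_congr rfl fun σ _ => ?_
  simp [he.map_signOf]

/-- That the determinant in `R` lies in `G ∪ {0}` does not by itself exhibit an association.
Pivoting does: the entries of the Schur complement stay in `G ∪ {0}`, so each is a defined sum of
two terms, and the same elimination can be carried out in the universal ring. -/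
theorem exists_det_eq (he : IsRingEmbedding G e) {k : ℕ} (A : Matrix (Fin k) (Fin k) P)
    (hA : MinorsIn G (A.map e)) : ∃ d, (A.map (toUniversal P)).det = toUniversal P d := by
  induction k with
  | zero => exact ⟨1, by simp⟩
  | succ k ih =>
    by_cases h0 : ∀ i, A i 0 = 0
    · refine ⟨0, ?_⟩
      rw [toUniversal_zero]
      exact det_eq_zero_of_column_eq_zero 0 fun i => by simp [h0, toUniversal_zero]
    · push Not at h0
      obtain ⟨i, hi⟩ := h0
      have hu : IsUnit ((A.map e) i 0) := (hA.apply i 0).isUnit (by simpa [he.eq_zero_iff] using hi)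
      have hp := hA.pivot he.neg_one_mem i 0 hu
      have hB : ∀ r c : Fin k, ∃ p, e p = pivot (A.map e) i 0 (i.succAbove r) (Fin.succAbove 0 c) :=
        fun r c => (he.zeroOrMem_iff _).1 (hp.apply _ _)
      choose B hB using hB
      have hBm : (Matrix.of B).map e = (pivot (A.map e) i 0).submatrix i.succAbove (Fin.succAbove 0) := by
        ext r c
        simp [hB]
      obtain ⟨d, hd⟩ := ih (Matrix.of B) (by rw [hBm]; exact hp.submatrix _ _)
      have hinv : Ring.inverse (toUniversal P (A i 0)) = toUniversal P (A i 0)⁻¹ := by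
        have : toUniversal P (A i 0) = ((Units.map (toUniversal P) (Units.mk0 _ hi) :
            (UniversalRing P)ˣ) : UniversalRing P) := rfl
        rw [this, Ring.inverse_unit]
        rfl
      have hinv' : Ring.inverse (e (A i 0)) = e (A i 0)⁻¹ := by
        have : e (A i 0) = ((Units.map (e : P →* R) (Units.mk0 _ hi) : Rˣ) : R) := rfl
        rw [this, Ring.inverse_unit]
        rfl
      refine ⟨signOf P ((-1) ^ (i : ℕ)) * A i 0 * d, ?_⟩
      rw [det_eq_mul_det_schur _ i 0 (by
        exact (Units.map (toUniversal P) (Units.mk0 _ hi)).isUnit), map_mul, map_mul,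
        toUniversal_signOf, ← hd]
      simp only [Matrix.map_apply, Fin.val_zero, add_zero]
      congr 2
      · simp
      · ext r c
        simp only [Matrix.map_apply, Matrix.of_apply]
        have hBe := hB r c
        rw [pivot_of_ne _ (Fin.succAbove_ne _ _) (Fin.succAbove_ne _ _)] at hBe
        simp only [Matrix.map_apply, hinv'] at hBe
        -- The Schur complement entry computed in `R` is a defined sum in `P`, hence is also correct
        -- in the universal ring.
        have : B r c ∈ padd (A (i.succAbove r) (Fin.succAbove 0 c))
            (pneg (A (i.succAbove r) 0 * (A i 0)⁻¹ * A i (Fin.succAbove 0 c))) := by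
          rw [he.mem_padd, hBe, he.map_pneg, map_mul, map_mul]
          ring
        rw [toUniversal_of_mem_padd this, toUniversal_pneg, map_mul, map_mul, hinv]
        ring

theorem exists_detIs (he : IsRingEmbedding G e) {k : ℕ} (A : Matrix (Fin k) (Fin k) P)
    (hA : MinorsIn G (A.map e)) : ∃ d, DetIs A d := by
  obtain ⟨d, hd⟩ := he.exists_det_eq A hA
  exact ⟨d, detIs_of_toUniversal hd⟩

end IsRingEmbedding

/-- The matroid `M` is represented by a matrix over `R` all whose minors are zero or in `G`. -/
def RingRepresentable {α R : Type*} [CommRing R] (G : Subgroup Rˣ) (M : Matroid α) : Prop :=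
  ∃ (r : ℕ) (A : Matrix (Fin r) M.E R), MinorsIn G A ∧
    ∀ B : Set α, M.IsBase B ↔
      ∃ f : Fin r ↪ M.E, Set.range (fun i => (f i : α)) = B ∧ (A.submatrix id f).det ≠ 0

theorem IsRingEmbedding.representable_iff (he : IsRingEmbedding G e) {α : Type*} (M : Matroid α) :
    Representable P M ↔ RingRepresentable G M := by
  have key : ∀ (r : ℕ) (A : Matrix (Fin r) M.E P), IsPMatrix A → ∀ f : Fin r ↪ M.E,
      ((∃ d : P, d ≠ 0 ∧ DetIs (A.submatrix id f) d) ↔ ((A.map e).submatrix id f).det ≠ 0) := by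
    intro r A hA f
    constructor
    · rintro ⟨d, hd, h⟩
      rw [submatrix_map, he.map_detIs h, Ne, he.eq_zero_iff]
      exact hd
    · intro h
      obtain ⟨d, hd⟩ := hA r (Function.Embedding.refl _) f
      refine ⟨d, ?_, hd⟩
      rintro rfl
      apply h
      rw [submatrix_map]
      have := he.map_detIs hd
      rw [map_zero] at this
      exact this
  constructor
  · rintro ⟨r, A, hA, hM⟩
    refine ⟨r, A.map e, ?_, fun B => ?_⟩
    · intro k f g
      by_cases hf : Function.Injective f
      · by_cases hg : Function.Injective g
        · obtain ⟨d, hd⟩ := hA k ⟨f, hf⟩ ⟨g, hg⟩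
          exact (he.zeroOrMem_iff _).2 ⟨d, (he.map_detIs hd).symm⟩
        · rw [det_submatrix_eq_zero_of_not_injective_right _ _ hg]; exact .zero
      · rw [det_submatrix_eq_zero_of_not_injective_left _ _ hf]; exact .zero
    · rw [hM]
      simp only [key r A hA]
  · rintro ⟨r, A, hA, hM⟩
    have hA' : ∀ i j, ∃ p, e p = A i j := fun i j => (he.zeroOrMem_iff _).1 (hA.apply i j)
    choose A' hA' using hA'
    have hm : (Matrix.of A').map e = A := by ext i j; simp [hA']
    have hP : IsPMatrix (Matrix.of A') := by
      intro k f g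
      apply he.exists_detIs
      rw [← submatrix_map, hm]
      exact hA.submatrix _ _
    refine ⟨r, Matrix.of A', hP, fun B => ?_⟩
    rw [hM]
    simp only [key r _ hP, hm]

end Embedding

end PartialField

namespace PartialField

open Matrix

/-! ### Fundamental elements and their lifts. -/

section Fundamental

variable {O R F : Type*} [CommRing O] [CommRing R] [Field F] {G : Subgroup Oˣ}
  {φ : O →+* R} {ψ : R →+* F}

/-- The unit `f` is a fundamental element of the partial field `G ∪ {0}`. -/
def IsFundamental (G : Subgroup Oˣ) (f : Oˣ) : Prop := f ∈ G ∧ ZeroOrMem G (1 - (f : O))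

theorem IsFundamental.one : IsFundamental G (1 : Oˣ) := ⟨G.one_mem, Or.inl (by simp)⟩

theorem IsFundamental.inv (hG : -1 ∈ G) {f : Oˣ} (hf : IsFundamental G f) :
    IsFundamental G f⁻¹ := by
  refine ⟨G.inv_mem hf.1, ?_⟩
  rw [← ZeroOrMem.mul_iff hf.1, ← ZeroOrMem.neg_iff hG]
  convert hf.2 using 1
  rw [mul_sub, Units.mul_inv]
  ring

/-- The determinant `ad - bc` is `ad` times one minus the cross ratio. Conditions on 2 × 2 minors
thereby become conditions that are invariant under scaling. -/
theorem isFundamental_cross_iff {a b c d : Oˣ} (ha : a ∈ G) (hb : b ∈ G) (hc : c ∈ G)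
    (hd : d ∈ G) : IsFundamental G (b * c * a⁻¹ * d⁻¹) ↔ ZeroOrMem G (a * d - b * c : O) := by
  have h : b * c * a⁻¹ * d⁻¹ ∈ G :=
    G.mul_mem (G.mul_mem (G.mul_mem hb hc) (G.inv_mem ha)) (G.inv_mem hd)
  rw [IsFundamental, and_iff_right h, ← ZeroOrMem.mul_iff (G.mul_mem ha hd)]
  have : ((a * d : Oˣ) : O) * (1 - ((b * c * a⁻¹ * d⁻¹ : Oˣ) : O)) = a * d - b * c := by
    have h1 := a.mul_inv
    have h2 := d.mul_inv
    push_cast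
    linear_combination (-(b * c * d * (d⁻¹ : Oˣ)) : O) * h1 - (b * c : O) * h2
  rw [this]

/-- The homomorphism of unit groups induced by `φ`. -/
abbrev imageUnit (φ : O →+* R) : Oˣ →* Rˣ := Units.map φ.toMonoidHom

theorem IsFundamental.image {f : Oˣ} (hf : IsFundamental G f) :
    IsFundamental ⊤ (imageUnit φ f) := by
  refine ⟨trivial, ?_⟩
  rw [zeroOrMem_top_iff]
  rcases hf.2 with h | ⟨g, -, h⟩
  · left
    have := congrArg φ h
    simpa using this
  · right
    have := congrArg φ h
    rw [map_sub, map_one] at this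
    exact ⟨imageUnit φ g, this⟩

/-- The data that allows representations over `R` to be lifted to representations over `G ∪ {0}`:
the fundamental elements are in bijection, and those of `R` are ternary. -/
structure IsLifting (G : Subgroup Oˣ) (φ : O →+* R) (ψ : R →+* F) : Prop where
  neg_one_mem : -1 ∈ G
  surj : ∀ r : Rˣ, ∃ g ∈ G, imageUnit φ g = r
  lift : ∀ x : R, IsUnit x → IsUnit (1 - x) →
    ∃ g ∈ G, (∃ h ∈ G, (h : O) = 1 - g) ∧ φ g = x
  inj : ∀ g ∈ G, ∀ g' ∈ G, (∃ h ∈ G, (h : O) = 1 - g) → (∃ h ∈ G, (h : O) = 1 - g') →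
    φ g = φ g' → g = g'
  ternary : ∀ x : F, x = 0 ∨ x = 1 ∨ x = -1
  two_ne_zero : (2 : F) ≠ 0
  two : ¬ IsUnit (2 : R)

namespace IsLifting

variable (L : IsLifting G φ ψ)
include L

theorem three_eq_zero : (3 : F) = 0 := by
  rcases L.ternary 2 with h | h | h
  · exact absurd h L.two_ne_zero
  · exact absurd (by linear_combination h : (1 : F) = 0) one_ne_zero
  · linear_combination h

theorem map_ne_zero {x : O} (hx : ZeroOrMem G x) (h : x ≠ 0) : φ x ≠ 0 := by
  have := ψ.domain_nontrivial
  obtain ⟨g, -, rfl⟩ := hx.exists_of_ne h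
  exact (imageUnit φ g).ne_zero

theorem map_eq_zero_iff {x : O} (hx : ZeroOrMem G x) : φ x = 0 ↔ x = 0 :=
  ⟨fun h => by_contra fun h' => L.map_ne_zero hx h' h, fun h => by rw [h, map_zero]⟩

omit [CommRing O] L in
theorem eq_zero_of_ternary {x : R} (hx : ZeroOrMem (⊤ : Subgroup Rˣ) x) (h : ψ x = 0) : x = 0 := by
  rcases hx with h' | ⟨g, -, rfl⟩
  · exact h'
  · exact absurd h (Units.map ψ.toMonoidHom g).ne_zero

theorem unit_ternary (f : Rˣ) : ψ f = 1 ∨ ψ f = -1 :=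
  (L.ternary _).resolve_left (Units.map ψ.toMonoidHom f).ne_zero

/-- `1 - f` is zero or a unit, and `ψ` kills it, so it is not a unit. Hence every fundamental
element other than `1` is sent to `-1` by `ψ`. -/
theorem eq_one {f : Rˣ} (hf : IsFundamental ⊤ f) (h : ψ f = 1) : f = 1 := by
  have := eq_zero_of_ternary (ψ := ψ) hf.2 (by rw [map_sub, map_one, h, sub_self])
  exact Units.ext (by rw [Units.val_one]; linear_combination -this)

theorem not_neg_one : ¬ IsFundamental ⊤ (-1 : Rˣ) := by
  intro h
  have h2 := h.2
  rw [Units.val_neg, Units.val_one, sub_neg_eq_add, one_add_one_eq_two, zeroOrMem_top_iff] at h2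
  rcases h2 with h2 | h2
  · apply L.two_ne_zero
    rw [← map_ofNat ψ 2, h2, map_zero]
  · exact L.two h2

theorem eq_one_of_image {f : Oˣ} (hf : IsFundamental G f) (h : imageUnit φ f = 1) : f = 1 := by
  have h1 : φ (1 - f) = 0 := by
    have := congrArg Units.val h
    simp only [Units.coe_map, Units.val_one] at this
    rw [map_sub, map_one, sub_eq_zero]
    exact this.symm
  have := (L.map_eq_zero_iff hf.2).1 h1
  exact Units.ext (by rw [Units.val_one]; linear_combination -this)

/-- The field `inj` of `IsLifting` covers only elements with `1 - f` in `G`; the element `1` is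
treated separately. -/
theorem fundamental_inj {f f' : Oˣ} (hf : IsFundamental G f) (hf' : IsFundamental G f')
    (h : imageUnit φ f = imageUnit φ f') : f = f' := by
  by_cases h1 : imageUnit φ f = 1
  · rw [L.eq_one_of_image hf h1, L.eq_one_of_image hf' (h ▸ h1)]
  · have key : ∀ g : Oˣ, imageUnit φ g ≠ 1 → IsFundamental G g → ∃ h ∈ G, (h : O) = 1 - g := by
      intro g hg hf
      refine hf.2.exists_of_ne fun h0 => hg ?_
      have : g = 1 := Units.ext (by rw [Units.val_one]; linear_combination -h0)
      rw [this, map_one]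
    exact L.inj f hf.1 f' hf'.1 (key f h1 hf) (key f' (h ▸ h1) hf') (congrArg Units.val h)

theorem eq_one_of_ternary {f : Oˣ} (hf : IsFundamental G f) (h : ψ (φ f) = 1) : f = 1 :=
  L.eq_one_of_image hf (L.eq_one hf.image h)

/-- If neither factor is `1`, both reduce to `-1`, so the product reduces to `1`. Its image in `R`
is fundamental and therefore equals `1`, and uniqueness of lifts gives `g = f⁻¹`. -/
theorem fundamental_mul {f g : Oˣ} (hf : IsFundamental G f) (hg : IsFundamental G g)
    (hfg : IsFundamental ⊤ (imageUnit φ (f * g))) : IsFundamental G (f * g) := by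
  rcases L.unit_ternary (imageUnit φ f) with h1 | h1
  · rw [L.eq_one_of_ternary hf h1, one_mul]; exact hg
  rcases L.unit_ternary (imageUnit φ g) with h2 | h2
  · rw [L.eq_one_of_ternary hg h2, mul_one]; exact hf
  have h3 : imageUnit φ (f * g) = 1 := by
    refine L.eq_one hfg ?_
    rw [map_mul, Units.val_mul, map_mul, h1, h2]
    ring
  have h4 : g = f⁻¹ := by
    refine L.fundamental_inj hg (hf.inv L.neg_one_mem) ?_
    rw [map_mul] at h3
    rw [map_inv]
    exact (inv_eq_of_mul_eq_one_right h3).symm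
  rw [h4, mul_inv_cancel]
  exact .one

theorem fundamental_one_sub {f : Oˣ} (hf : IsFundamental G f) (h : ψ (φ f) = -1) :
    ∃ g : Oˣ, IsFundamental G g ∧ (g : O) = 1 - f := by
  have : (1 : O) - f ≠ 0 := by
    intro h0
    have h1 : ψ (φ (1 - f)) = 0 := by rw [h0, map_zero, map_zero]
    rw [map_sub, map_sub, map_one, map_one, h] at h1
    exact L.two_ne_zero (by linear_combination h1)
  obtain ⟨g, hg, h⟩ := hf.2.exists_of_ne this
  refine ⟨g, ⟨hg, ?_⟩, h⟩
  rw [h, sub_sub_cancel]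
  exact .of_mem hf.1

/-- This is how an additive relation in `R` is pulled back to `O`: both sides are fundamental lifts
of the same element. -/
theorem eq_one_sub {f g : Oˣ} (hf : IsFundamental G f) (h : ψ (φ f) = -1)
    (hg : IsFundamental G g) (hgf : φ g = φ (1 - f)) : (g : O) = 1 - f := by
  obtain ⟨g', hg', h'⟩ := L.fundamental_one_sub hf h
  have : g = g' := by
    refine L.fundamental_inj hg hg' (Units.ext ?_)
    change φ g = φ g'
    rw [h', hgf]
  rw [this, h']

/-- The compatibility of the lifts in a matrix of the form
`[a, 1, 1, 0; 1, 0, 1, t; d, 1, 0, 1]`. -/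
theorem lift_path_three {a d t : Oˣ} (ha : IsFundamental G a) (htd : IsFundamental G (t * d))
    (ht : IsFundamental G (-t)) (had : IsFundamental ⊤ (imageUnit φ (a * d⁻¹)))
    (h1 : ZeroOrMem ⊤ (φ (1 - a + d))) (h2 : ZeroOrMem ⊤ (φ (-(a * t) - 1 + t * d)))
    (h3 : ZeroOrMem ⊤ (φ (a - 1 + t * d))) : ZeroOrMem G (a - d : O) := by
  have three := L.three_eq_zero
  have hψ1 : ψ (φ (1 - a + d)) = 1 - ψ (φ a) + ψ (φ d) := by simp
  have hψ2 : ψ (φ (-(a * t) - 1 + t * d)) = -(ψ (φ a) * ψ (φ t)) - 1 + ψ (φ t) * ψ (φ d) := by simp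
  have hψ3 : ψ (φ (a - 1 + t * d)) = ψ (φ a) - 1 + ψ (φ t) * ψ (φ d) := by simp
  have hψtd : ψ (φ ((t * d : Oˣ) : O)) = ψ (φ t) * ψ (φ d) := by simp
  have hψt : ψ (φ ((-t : Oˣ) : O)) = - ψ (φ t) := by simp
  have hdi : ψ (φ d) * ψ (φ (d⁻¹ : Oˣ)) = 1 := by
    rw [← map_mul, ← map_mul, Units.mul_inv, map_one, map_one]
  have hψad : ψ ((imageUnit φ (a * d⁻¹) : Rˣ) : R) = ψ (φ a) * ψ (φ (d⁻¹ : Oˣ)) := by simp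
  -- Eight sign patterns of `t`, `a`, `d` in `GF(3)`. In each one, fundamental elements with sign
  -- `1` are `1`, and minors that vanish under `ψ` vanish in `R`. Four patterns make `-1`
  -- fundamental in `R`, which is impossible; the others give relations that lift by `eq_one_sub`.
  rcases L.unit_ternary (imageUnit φ t) with tt | tt <;>
    rcases L.unit_ternary (imageUnit φ a) with aa | aa <;>
    rcases L.unit_ternary (imageUnit φ d) with dd | dd <;>
    change ψ (φ t) = _ at tt <;> change ψ (φ a) = _ at aa <;> change ψ (φ d) = _ at dd
  · exfalso
    have ha1 := L.eq_one_of_ternary ha aa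
    have h4 : imageUnit φ (a * d⁻¹) = 1 := L.eq_one had (by
      rw [hψad]; rw [dd] at hdi; rw [aa]; linear_combination hdi)
    have h5 : t * d = 1 := L.eq_one_of_ternary htd (by rw [hψtd, tt, dd, one_mul])
    rw [ha1, one_mul, map_inv, inv_eq_one] at h4
    have h6 : imageUnit φ t = 1 := by
      have := congrArg (imageUnit φ) h5
      rwa [map_mul, h4, mul_one, map_one] at this
    apply L.not_neg_one
    have : imageUnit φ (-t) = -1 := by rw [← h6]; ext; simp
    rw [← this]
    exact ht.image
  · have ha1 := L.eq_one_of_ternary ha aa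
    have h4 := eq_zero_of_ternary (ψ := ψ) h2 (by rw [hψ2, aa, tt, dd]; linear_combination -three)
    have h5 := L.eq_one_sub ht (by rw [hψt, tt]) htd (by
      rw [← sub_eq_zero, ← h4, ← map_sub, ha1]
      congr 1
      push_cast
      ring)
    rw [← ZeroOrMem.mul_iff (L.neg_one_mem), ← ZeroOrMem.mul_iff ht.1, ha1]
    convert ZeroOrMem.of_mem (L.neg_one_mem) using 1
    push_cast at h5 ⊢
    linear_combination -h5
  · have h4 := eq_zero_of_ternary (ψ := ψ) h1 (by rw [hψ1, aa, dd]; linear_combination three)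
    have h5 : t * d = 1 := L.eq_one_of_ternary htd (by rw [hψtd, tt, dd, one_mul])
    have h6 : (-t)⁻¹ = -d := by
      rw [inv_eq_iff_mul_eq_one, neg_mul_neg, h5]
    have h7 := ht.inv L.neg_one_mem
    rw [h6] at h7
    have h8 := L.eq_one_sub ha aa h7 (by
      rw [← sub_eq_zero, ← neg_eq_zero, ← h4, ← map_sub, ← map_neg]
      congr 1
      push_cast
      ring)
    push_cast at h8
    rw [show (a - d : O) = 1 by linear_combination h8]
    exact .one
  · have h4 : imageUnit φ (a * d⁻¹) = 1 := L.eq_one had (by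
      rw [hψad]; rw [dd] at hdi; rw [aa]; linear_combination hdi)
    rw [map_mul, map_inv, mul_inv_eq_one] at h4
    have h4' : φ a = φ d := congrArg Units.val h4
    have h5 := eq_zero_of_ternary (ψ := ψ) h3 (by rw [hψ3, aa, tt, dd]; linear_combination -three)
    have h6 := L.eq_one_sub ha aa htd (by
      rw [← sub_eq_zero, ← h5, ← map_sub]
      congr 1
      push_cast
      ring)
    have hai := ha.inv L.neg_one_mem
    have hai' : φ a * φ (a⁻¹ : Oˣ) = 1 := by rw [← map_mul, Units.mul_inv, map_one]
    have h7 := L.eq_one_sub hai (by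
      have := congrArg ψ hai'
      rw [map_mul, aa, map_one] at this
      linear_combination -this) ht (by
      have h6' := congrArg φ h6
      simp only [Units.val_mul, map_mul, map_sub, map_one, Units.val_neg, map_neg] at h6' ⊢
      rw [← h4'] at h6'
      linear_combination (-φ (a⁻¹ : Oˣ)) * h6' + (φ t + 1) * hai')
    left
    push_cast at h6 h7
    have h8 : (t : O) * (a - d) = 0 := by
      linear_combination (-a : O) * h7 - h6 + a.mul_inv
    exact (Units.mul_right_eq_zero t).1 h8
  · exfalso
    have h5 : -t = 1 := L.eq_one_of_ternary ht (by rw [hψt, tt, neg_neg])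
    have ha1 := L.eq_one_of_ternary ha aa
    have h4 : imageUnit φ (a * d⁻¹) = 1 := L.eq_one had (by
      rw [hψad]; rw [dd] at hdi; rw [aa]; linear_combination hdi)
    rw [ha1, one_mul, map_inv, inv_eq_one] at h4
    apply L.not_neg_one
    have : imageUnit φ (t * d) = -1 := by
      rw [map_mul, h4, mul_one, neg_eq_iff_eq_neg.1 h5]; ext; simp
    rw [← this]
    exact htd.image
  · exfalso
    have h5 : -t = 1 := L.eq_one_of_ternary ht (by rw [hψt, tt, neg_neg])
    have ha1 := L.eq_one_of_ternary ha aa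
    have h6 : t * d = 1 := L.eq_one_of_ternary htd (by rw [hψtd, tt, dd]; ring)
    apply L.not_neg_one
    have : imageUnit φ (a * d⁻¹) = -1 := by
      rw [← eq_inv_iff_mul_eq_one.2 h6, ha1, neg_eq_iff_eq_neg.1 h5]; ext; simp
    rw [← this]
    exact had
  · have h5 : -t = 1 := L.eq_one_of_ternary ht (by rw [hψt, tt, neg_neg])
    have h4 := eq_zero_of_ternary (ψ := ψ) h1 (by rw [hψ1, aa, dd]; linear_combination three)
    rw [neg_eq_iff_eq_neg.1 h5] at htd
    have h8 := L.eq_one_sub ha aa htd (by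
      rw [← sub_eq_zero, ← neg_eq_zero, ← h4, ← map_sub, ← map_neg]
      congr 1
      push_cast
      ring)
    push_cast at h8
    rw [show (a - d : O) = 1 by linear_combination h8]
    exact .one
  · exfalso
    have h5 : -t = 1 := L.eq_one_of_ternary ht (by rw [hψt, tt, neg_neg])
    have h6 : t * d = 1 := L.eq_one_of_ternary htd (by rw [hψtd, tt, dd]; ring)
    have h4 : imageUnit φ (a * d⁻¹) = 1 := L.eq_one had (by
      rw [hψad]; rw [dd] at hdi; rw [aa]; linear_combination hdi)
    rw [← eq_inv_iff_mul_eq_one.2 h6, neg_eq_iff_eq_neg.1 h5, mul_neg, mul_one] at h4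
    apply L.not_neg_one
    have : imageUnit φ a = -1 := by
      rw [← h4]; ext; simp
    rw [← this]
    exact ha.image

end IsLifting

end Fundamental

end PartialField

namespace PartialField

open Matrix

/-! ### Walks in the bipartite graph of a matrix and their shortening. -/

section Walks

variable {X Y R : Type*} [CommRing R]

/-- `x 0, y 0, x 1, y 1, …, x k` is a walk in the bipartite graph of the nonzero entries of `A`,
with all column vertices in `T`. -/
def IsWalk (A : Matrix X Y R) (T : Set Y) (k : ℕ) (x : ℕ → X) (y : ℕ → Y) : Prop :=
  ∀ i < k, y i ∈ T ∧ A (x i) (y i) ≠ 0 ∧ A (x (i + 1)) (y i) ≠ 0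

/-- The rows `p` and `q` are joined by a walk of length `2 * k`. -/
def Joined (A : Matrix X Y R) (T : Set Y) (k : ℕ) (p q : X) : Prop :=
  ∃ x y, IsWalk A T k x y ∧ x 0 = p ∧ x k = q

/-- The walk is an induced path. -/
def IsInducedWalk (A : Matrix X Y R) (T : Set Y) (k : ℕ) (x : ℕ → X) (y : ℕ → Y) : Prop :=
  IsWalk A T k x y ∧ ∀ i ≤ k, ∀ j < k, A (x i) (y j) ≠ 0 → i = j ∨ i = j + 1

variable {A : Matrix X Y R} {T : Set Y}

/-- The column `y` only fills the column sequence, which a walk of length zero never reads. -/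
theorem Joined.refl (p : X) (y : Y) : Joined A T 0 p p :=
  ⟨fun _ => p, fun _ => y, fun i hi => absurd hi (Nat.not_lt_zero i), rfl, rfl⟩

theorem Joined.cons {k : ℕ} {p q r : X} {y : Y} (hy : y ∈ T) (h1 : A p y ≠ 0) (h2 : A q y ≠ 0)
    (h : Joined A T k q r) : Joined A T (k + 1) p r := by
  obtain ⟨x, z, hw, rfl, rfl⟩ := h
  refine ⟨fun n => Nat.casesOn n p x, fun n => Nat.casesOn n y z, ?_, rfl, rfl⟩
  rintro (_ | i) hi
  · exact ⟨hy, h1, h2⟩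
  · exact hw i (by omega)

theorem Joined.trans {k l : ℕ} {p q r : X} (h : Joined A T k p q) (h' : Joined A T l q r) :
    ∃ m, Joined A T m p r := by
  induction k generalizing p with
  | zero =>
    obtain ⟨x, z, -, rfl, rfl⟩ := h
    exact ⟨l, h'⟩
  | succ k ih =>
    obtain ⟨x, z, hw, rfl, rfl⟩ := h
    obtain ⟨m, hm⟩ := ih (p := x 1)
      ⟨fun n => x (n + 1), fun n => z (n + 1), fun i hi => hw (i + 1) (by omega), rfl, rfl⟩
    obtain ⟨h1, h2, h3⟩ := hw 0 (by omega)
    exact ⟨m + 1, hm.cons h1 h2 h3⟩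

theorem Joined.mono {S : Set Y} {k : ℕ} {p q : X} (h : Joined A T k p q) (hST : T ⊆ S) :
    Joined A S k p q := by
  obtain ⟨x, z, hw, h⟩ := h
  exact ⟨x, z, fun i hi => ⟨hST (hw i hi).1, (hw i hi).2⟩, h⟩

theorem IsWalk.segment {k : ℕ} {x : ℕ → X} {y : ℕ → Y} (h : IsWalk A T k x y) {i j : ℕ}
    (hij : i ≤ j) (hj : j ≤ k) : Joined A T (j - i) (x i) (x j) :=
  ⟨fun n => x (i + n), fun n => y (i + n), fun n hn => h (i + n) (by omega), rfl,
    by simp [Nat.add_sub_cancel' hij]⟩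

/-- A walk that is not an induced path can be shortened. -/
theorem Joined.shorten {k : ℕ} {p q : X} (h : Joined A T k p q) :
    (∃ l < k, Joined A T l p q) ∨ ∃ x y, IsInducedWalk A T k x y ∧ x 0 = p ∧ x k = q := by
  obtain ⟨x, y, hw, rfl, rfl⟩ := h
  by_cases hi : ∀ i ≤ k, ∀ j < k, A (x i) (y j) ≠ 0 → i = j ∨ i = j + 1
  · exact Or.inr ⟨x, y, ⟨hw, hi⟩, rfl, rfl⟩
  left
  push Not at hi
  obtain ⟨i, hi, j, hj, hA, h1, h2⟩ := hi
  -- The chord between `x i` and `y j` is a shortcut: it saves `j - i` columns of the walk if `i <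
  -- j`, and `i - j - 1` of them otherwise.
  rcases Nat.lt_or_gt_of_ne h1 with h | h
  · refine ⟨k - (j - i), by omega, fun n => if n ≤ i then x n else x (n + (j - i)),
      fun n => if n < i then y n else y (n + (j - i)), ?_, by simp, ?_⟩
    · intro n hn
      rcases lt_trichotomy n i with h3 | h3 | h3
      · simpa [h3, h3.le, Nat.succ_le_of_lt h3] using hw n (by omega)
      · subst h3
        have e : n + (j - n) = j := by omega
        have e' : n + 1 + (j - n) = j + 1 := by omega
        simpa [e, e'] using ⟨(hw j hj).1, hA, (hw j hj).2.2⟩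
      · have := hw (n + (j - i)) (by omega)
        rw [show n + (j - i) + 1 = n + 1 + (j - i) by omega] at this
        simpa [show ¬ n ≤ i by omega, show ¬ n < i by omega, show ¬ n + 1 ≤ i by omega] using this
    · simp only [show ¬ (k - (j - i) ≤ i) by omega, if_false]
      congr 1
      omega
  · refine ⟨k - (i - j - 1), by omega, fun n => if n ≤ j then x n else x (n + (i - j - 1)),
      fun n => if n ≤ j then y n else y (n + (i - j - 1)), ?_, by simp, ?_⟩
    · intro n hn
      rcases lt_trichotomy n j with h3 | h3 | h3
      · simpa [h3.le, Nat.succ_le_of_lt h3] using hw n (by omega)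
      · subst h3
        have e' : n + 1 + (i - n - 1) = i := by omega
        simpa [e'] using ⟨(hw n hj).1, (hw n hj).2.1, hA⟩
      · have := hw (n + (i - j - 1)) (by omega)
        rw [show n + (i - j - 1) + 1 = n + 1 + (i - j - 1) by omega] at this
        simpa [show ¬ n ≤ j by omega, show ¬ n + 1 ≤ j by omega] using this
    · simp only [show ¬ (k - (i - j - 1) ≤ j) by omega, if_false]
      congr 1
      omega

namespace IsInducedWalk

variable {G : Subgroup Rˣ} {k : ℕ} {x : ℕ → X} {y : ℕ → Y}

theorem eq_zero (h : IsInducedWalk A T k x y) {i j : ℕ} (hi : i ≤ k) (hj : j < k) (h1 : i ≠ j)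
    (h2 : i ≠ j + 1) : A (x i) (y j) = 0 := by
  by_contra h3
  rcases h.2 i hi j hj h3 with h4 | h4
  exacts [h1 h4, h2 h4]

theorem ne_one (h : IsInducedWalk A T (k + 2) x y) {i : ℕ} (hi : i ≤ k + 2) (h1 : i ≠ 1) :
    x i ≠ x 1 := by
  intro e
  rcases Nat.eq_zero_or_pos i with h0 | h0
  · subst h0
    apply (h.1 1 (by omega)).2.1
    rw [← e]
    exact h.eq_zero (by omega) (by omega) (by omega) (by omega)
  · apply (h.1 0 (by omega)).2.2
    rw [zero_add, ← e]
    exact h.eq_zero hi (by omega) (by omega) (by omega)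

theorem col_ne_one (h : IsInducedWalk A T (k + 2) x y) {j : ℕ} (hj : j < k + 2) (h1 : j ≠ 1) :
    y j ≠ y 1 := by
  intro e
  rcases Nat.eq_zero_or_pos j with h0 | h0
  · subst h0
    apply (h.1 0 (by omega)).2.1
    rw [e]
    exact h.eq_zero (by omega) (by omega) (by omega) (by omega)
  · apply (h.1 1 (by omega)).2.1
    rw [← e]
    exact h.eq_zero (by omega) hj (by omega) (by omega)

/-- Pivoting on an interior entry of an induced path shortens the path. -/
theorem joined_pivot (h : IsInducedWalk A T (k + 2) x y)
    (hT : ∀ x, ∀ y ∈ T, A x y ≠ 0 → IsUnit (A x y)) :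
    Joined (pivot A (x 1) (y 1)) T (k + 1) (x 0) (x (k + 2)) := by
  -- The vertices `x 1` and `y 1` are skipped: the pivot creates an edge between `y 0` and `x 2`,
  -- and the rest of the induced path is unaffected.
  refine ⟨fun n => if n = 0 then x 0 else x (n + 1), fun n => if n = 0 then y 0 else y (n + 1),
    ?_, by simp, by simp⟩
  have zero : ∀ {i j : ℕ}, i ≤ k + 2 → j < k + 2 → i ≠ j → i ≠ j + 1 → A (x i) (y j) = 0 :=
    fun hi hj h1 h2 => h.eq_zero hi hj h1 h2
  rintro (_ | n) hn
  · simp only [if_true, zero_add, one_ne_zero, if_false]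
    have hy := h.col_ne_one (j := 0) (by omega) (by omega)
    refine ⟨(h.1 0 (by omega)).1, ?_, ?_⟩
    · rw [pivot_of_ne _ (h.ne_one (by omega) (by omega)) hy,
        zero (i := 0) (j := 1) (by omega) (by omega) (by omega) (by omega), zero_mul, zero_mul,
        sub_zero]
      exact (h.1 0 (by omega)).2.1
    · rw [pivot_of_ne _ (h.ne_one (by omega) (by omega)) hy,
        zero (i := 1 + 1) (j := 0) (by omega) (by omega) (by omega) (by omega), zero_sub, neg_ne_zero]
      obtain ⟨h1, h2, h3⟩ := h.1 1 (by omega)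
      obtain ⟨h4, h5, h6⟩ := h.1 0 (by omega)
      have : Nontrivial R := ⟨_, _, h2⟩
      exact (((hT _ _ h1 h3).mul (hT _ _ h1 h2).ringInverse).mul (hT _ _ h4 h6)).ne_zero
  · simp only [Nat.add_eq_zero_iff, one_ne_zero, and_false, if_false]
    have hy := h.col_ne_one (j := n + 1 + 1) (by omega) (by omega)
    have hx1 := h.ne_one (i := n + 1 + 1) (by omega) (by omega)
    have hx2 := h.ne_one (i := n + 1 + 1 + 1) (by omega) (by omega)
    rw [pivot_of_ne _ hx1 hy, pivot_of_ne _ hx2 hy,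
      zero (i := 1) (j := n + 1 + 1) (by omega) (by omega) (by omega) (by omega), mul_zero,
      mul_zero, sub_zero, sub_zero]
    exact h.1 (n + 1 + 1) (by omega)

end IsInducedWalk

end Walks

/-! ### Comparing lifts along walks. -/

namespace IsLifting

variable {O R F X Y : Type*} [CommRing O] [CommRing R] [Field F] {G : Subgroup Oˣ}
  {φ : O →+* R} {ψ : R →+* F}

/-- Two lifts that agree on the columns in `T` have proportional entries in another column, in rows
joined by a walk in `T`. -/
theorem ratio_eq [Finite X] (L : IsLifting G φ ψ) {T : Set Y} {w : Y} (hw : w ∉ T) (k : ℕ)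
    (A B : Matrix X Y O) (hA : MinorsOn G A (insert w T)) (hB : MinorsOn G B (insert w T))
    (hAB : ∀ x, ∀ y ∈ T, A x y = B x y) (hφ : ∀ x, φ (A x w) = φ (B x w)) {p q : X}
    (hpq : Joined A T k p q) (hp : A p w ≠ 0) (hq : A q w ≠ 0) :
    A p w * B q w = A q w * B p w := by
  have hwm : w ∈ insert w T := Set.mem_insert _ _
  have hBne : ∀ {A B : Matrix X Y O}, MinorsOn G A (insert w T) →
      (∀ x, φ (A x w) = φ (B x w)) → ∀ {x}, A x w ≠ 0 → B x w ≠ 0 := by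
    intro A B hA hφ x hx h0
    have := L.map_ne_zero (hA.apply x hwm) hx
    rw [hφ, h0, map_zero] at this
    exact this rfl
  induction k using Nat.strong_induction_on generalizing A B p q with
  | _ k ih =>
    have hAT : MinorsOn G A T := hA.mono (Set.subset_insert _ _)
    rcases hpq.shorten with ⟨l, hl, hj⟩ | ⟨x, y, hi, rfl, rfl⟩
    · exact ih l hl A B hA hB hAB hφ hj hp hq
    match k, hi with
    | 0, hi => rfl
    | 1, hi =>
      obtain ⟨h1, h2, h3⟩ := hi.1 0 (by omega)
      rw [zero_add] at h3
      have hym : y 0 ∈ insert w T := Or.inr h1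
      obtain ⟨a, ha, ha'⟩ := (hA.apply (x 0) hwm).exists_of_ne hp
      obtain ⟨b, hb, hb'⟩ := (hA.apply (x 1) hwm).exists_of_ne hq
      obtain ⟨a₂, ha₂, ha₂'⟩ := (hB.apply (x 0) hwm).exists_of_ne (hBne hA hφ hp)
      obtain ⟨b₂, hb₂, hb₂'⟩ := (hB.apply (x 1) hwm).exists_of_ne (hBne hA hφ hq)
      obtain ⟨c, hc, hc'⟩ := (hA.apply (x 0) hym).exists_of_ne h2
      obtain ⟨d, hd, hd'⟩ := (hA.apply (x 1) hym).exists_of_ne h3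
      have m1 := hA.two (x 0) (x 1) hwm hym
      have m2 := hB.two (x 0) (x 1) hwm hym
      rw [← ha', ← hb', ← hc', ← hd', ← isFundamental_cross_iff ha hc hb hd] at m1
      rw [← ha₂', ← hb₂', ← hAB _ _ h1, ← hAB _ _ h1, ← hc', ← hd',
        ← isFundamental_cross_iff ha₂ hc hb₂ hd] at m2
      have e1 : imageUnit φ a = imageUnit φ a₂ := by
        ext; have := hφ (x 0); rwa [← ha', ← ha₂'] at this
      have e2 : imageUnit φ b = imageUnit φ b₂ := by
        ext; have := hφ (x 1); rwa [← hb', ← hb₂'] at this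
      have e3 := L.fundamental_inj m1 m2 (by simp only [map_mul, map_inv, e1, e2])
      rw [mul_left_inj, mul_inv_eq_iff_eq_mul, mul_right_comm, eq_mul_inv_iff_mul_eq, mul_assoc,
        mul_assoc, mul_right_inj] at e3
      rw [← ha', ← hb', ← ha₂', ← hb₂', ← Units.val_mul, ← Units.val_mul, e3, mul_comm]
    | k + 2, hi =>
      -- If `x 1` misses column `w`, pivoting on `x 1`, `y 1` leaves column `w` unchanged and
      -- shortens the path. Otherwise the path splits at `x 1` and the two ratios multiply.
      by_cases h0 : A (x 1) w = 0
      · obtain ⟨h1, h2, -⟩ := hi.1 1 (by omega)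
        have hu := (hAT.apply (x 1) h1).isUnit h2
        have hu' : IsUnit (B (x 1) (y 1)) := by rwa [← hAB _ _ h1]
        have hwy : w ≠ y 1 := fun h => hw (h ▸ h1)
        have hB0 : B (x 1) w = 0 := by
          by_contra hne
          exact hBne hB (fun x => (hφ x).symm) hne h0
        have hx0 : x 0 ≠ x 1 := fun h => hp (h ▸ h0)
        have hx2 : x (k + 2) ≠ x 1 := fun h => hq (h ▸ h0)
        have eA : ∀ i, i ≠ x 1 → pivot A (x 1) (y 1) i w = A i w := by
          intro i hi
          rw [pivot_of_ne _ hi hwy, h0, mul_zero, sub_zero]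
        have eB : ∀ i, i ≠ x 1 → pivot B (x 1) (y 1) i w = B i w := by
          intro i hi
          rw [pivot_of_ne _ hi hwy, hB0, mul_zero, sub_zero]
        have := ih (k + 1) (by omega) (pivot A (x 1) (y 1)) (pivot B (x 1) (y 1))
          (hA.pivot L.neg_one_mem _ (Or.inr h1) hu) (hB.pivot L.neg_one_mem _ (Or.inr h1) hu')
          (by
            intro i j hj
            simp only [pivot, hAB _ _ hj, hAB _ _ h1])
          (by
            intro i
            by_cases hi : i = x 1
            · subst hi
              rw [pivot_row _ _ hwy, pivot_row _ _ hwy, h0, hB0]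
              simp
            · rw [eA _ hi, eB _ hi, hφ])
          (hi.joined_pivot fun x y hy h => (hAT.apply x hy).isUnit h)
          (by rwa [eA _ hx0]) (by rwa [eA _ hx2])
        rwa [eA _ hx0, eA _ hx2, eB _ hx0, eB _ hx2] at this
      · have r1 := ih 1 (by omega) A B hA hB hAB hφ
          (hi.1.segment (i := 0) (j := 1) (by omega) (by omega)) hp h0
        have r2 := ih (k + 1) (by omega) A B hA hB hAB hφ
          (hi.1.segment (i := 1) (j := k + 2) (by omega) (by omega)) h0 hq
        obtain ⟨g, -, hg⟩ := (hA.apply (x 1) hwm).exists_of_ne h0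
        obtain ⟨g', -, hg'⟩ := (hB.apply (x 1) hwm).exists_of_ne (hBne hA hφ h0)
        rw [← hg, ← hg'] at r1 r2
        rw [← (g * g').mul_right_inj]
        push_cast
        linear_combination (g * B (x (k + 2)) w : O) * r1 + (g * B (x 0) w : O) * r2

/-- The case of an induced path of length four whose middle row meets only column `u`. -/
theorem zeroOrMem_of_path_two (L : IsLifting G φ ψ) {u v : Y} (A : Matrix X Y O)
    (hAu : MinorsOn G A {u}ᶜ) (hAv : MinorsOn G A {v}ᶜ) (hφ : MinorsIn ⊤ (A.map φ)) {T : Set Y}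
    (huT : u ∉ T) (hvT : v ∉ T) (huv : u ≠ v) {x : ℕ → X} {y : ℕ → Y}
    (hi : IsInducedWalk A T 2 x y)
    (hpu : A (x 0) u ≠ 0) (hpv : A (x 0) v ≠ 0) (hqu : A (x 2) u ≠ 0) (hqv : A (x 2) v ≠ 0)
    (hxu : A (x 1) u ≠ 0) (hxv : A (x 1) v = 0) :
    ZeroOrMem G (A (x 0) u * A (x 2) v - A (x 0) v * A (x 2) u) := by
  obtain ⟨y0T, e0, g0⟩ := hi.1 0 (by omega)
  obtain ⟨y1T, h0, l0⟩ := hi.1 1 (by omega)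
  have z1 : A (x 0) (y 1) = 0 := hi.eq_zero (by omega) (by omega) (by omega) (by omega)
  have z2 : A (x 2) (y 0) = 0 := hi.eq_zero (by omega) (by omega) (by omega) (by omega)
  rw [zero_add] at g0
  have mem_u : u ∈ ({v}ᶜ : Set Y) := huv
  have mem_v : v ∈ ({u}ᶜ : Set Y) := huv.symm
  have mem_y : ∀ {y}, y ∈ T → y ∈ ({u}ᶜ : Set Y) ∧ y ∈ ({v}ᶜ : Set Y) := fun hy =>
    ⟨fun h => huT (h ▸ hy), fun h => hvT (h ▸ hy)⟩
  obtain ⟨pu, hpuG, epu⟩ := (hAv.apply (x 0) mem_u).exists_of_ne hpu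
  obtain ⟨pv, hpvG, epv⟩ := (hAu.apply (x 0) mem_v).exists_of_ne hpv
  obtain ⟨qu, hquG, equ⟩ := (hAv.apply (x 2) mem_u).exists_of_ne hqu
  obtain ⟨qv, hqvG, eqv⟩ := (hAu.apply (x 2) mem_v).exists_of_ne hqv
  obtain ⟨c, hcG, ec⟩ := (hAv.apply (x 1) mem_u).exists_of_ne hxu
  obtain ⟨e, heG, ee⟩ := (hAu.apply (x 0) (mem_y y0T).1).exists_of_ne e0
  obtain ⟨g, hgG, eg⟩ := (hAu.apply (x 1) (mem_y y0T).1).exists_of_ne g0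
  obtain ⟨h, hhG, eh⟩ := (hAu.apply (x 1) (mem_y y1T).1).exists_of_ne h0
  obtain ⟨l, hlG, el⟩ := (hAu.apply (x 2) (mem_y y1T).1).exists_of_ne l0
  have d1 := hAv.two (x 0) (x 1) (mem_y y0T).2 mem_u
  have d2 := hAv.two (x 1) (x 2) mem_u (mem_y y1T).2
  have d3 := hAu.three (x 0) (x 1) (x 2) mem_v (mem_y y0T).1 (mem_y y1T).1
  have r0 := (hφ.minorsOn Set.univ).two (x 0) (x 2) (u := u) (v := v) trivial trivial
  have r1 := (hφ.minorsOn Set.univ).three (x 0) (x 1) (x 2) (u := u) (v := v) (w := y 0) trivial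
    trivial trivial
  have r2 := (hφ.minorsOn Set.univ).three (x 0) (x 1) (x 2) (u := u) (v := v) (w := y 1) trivial
    trivial trivial
  have r3 := (hφ.minorsOn Set.univ).three (x 0) (x 1) (x 2) (u := u) (v := y 0) (w := y 1) trivial
    trivial trivial
  simp only [map_apply, ← map_mul, ← map_sub, ← map_add] at r0 r1 r2 r3
  rw [← epu, ← epv, ← equ, ← eqv] at r0 ⊢
  simp only [hxv, z1, z2, ← epu, ← epv, ← equ, ← eqv, ← ec, ← ee, ← eg, ← eh, ← el] at d1 d2 d3 r1 r2 r3
  have mul := fun {a b : Oˣ} => G.mul_mem (x := a) (y := b)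
  have inv := fun {a : Oˣ} => G.inv_mem (x := a)
  have im : ∀ (w : Oˣ) {b b' : O}, ZeroOrMem ⊤ (φ b) → w * b' = b → ZeroOrMem ⊤ (φ b') := by
    rintro w b b' hb rfl
    rw [map_mul] at hb
    exact (ZeroOrMem.mul_iff (G := ⊤) (g := imageUnit φ w) trivial).1 hb
  -- `a`, `d` and `t` are the entries left over when rows `x 0`, `x 1`, `x 2` and columns `u`, `v`,
  -- `y 0`, `y 1` are scaled to the normal form of `lift_path_three`.
  obtain ⟨a, haG, ea⟩ : ∃ a ∈ G, (a * e * c : O) = pu * g :=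
    ⟨pu * g * (e * c)⁻¹, mul (mul hpuG hgG) (inv (mul heG hcG)), by
      rw [mul_assoc, ← Units.val_mul, ← Units.val_mul, ← Units.val_mul, inv_mul_cancel_right]⟩
  obtain ⟨d, hdG, ed⟩ : ∃ d ∈ G, (d * e * c * qv : O) = qu * g * pv :=
    ⟨qu * g * pv * (e * c * qv)⁻¹, mul (mul (mul hquG hgG) hpvG) (inv (mul (mul heG hcG) hqvG)), by
      rw [mul_assoc, mul_assoc, ← mul_assoc (e : O)]
      simp only [← Units.val_mul, inv_mul_cancel_right]⟩
  obtain ⟨t, htG, et⟩ : ∃ t ∈ G, (t * g * pv * l : O) = e * h * qv :=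
    ⟨e * h * qv * (g * pv * l)⁻¹, mul (mul (mul heG hhG) hqvG) (inv (mul (mul hgG hpvG) hlG)), by
      rw [mul_assoc, mul_assoc, ← mul_assoc (g : O)]
      simp only [← Units.val_mul, inv_mul_cancel_right]⟩
  have etd : (c * l * (t * d) : O) = h * qu := by
    refine (e * qv * g * pv).isUnit.mul_right_cancel ?_
    push_cast
    linear_combination (t * g * pv * l : O) * ed + (qu * g * pv : O) * et
  have ead : (g : O) * (pu * qv - pv * qu) = (e * c * qv : Oˣ) * (a - d : O) := by
    push_cast
    linear_combination (-qv : O) * ea + ed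
  have rad : ZeroOrMem ⊤ (φ (a - d)) := by
    refine im (e * c * qv) (b := g * (pu * qv - pv * qu)) ?_ ead.symm
    rw [map_mul]
    exact (ZeroOrMem.mul_iff (G := ⊤) (g := imageUnit φ g) trivial).2 r0
  rw [← ZeroOrMem.mul_iff hgG, ead, ZeroOrMem.mul_iff (mul (mul heG hcG) hqvG)]
  refine L.lift_path_three (t := t) ⟨haG, ?_⟩ ⟨mul htG hdG, ?_⟩
    ⟨by simpa using mul L.neg_one_mem htG, ?_⟩ ?_ ?_ ?_ ?_
  · rw [← ZeroOrMem.mul_iff (mul heG hcG)]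
    convert d1 using 1
    push_cast
    linear_combination -ea
  · rw [← ZeroOrMem.mul_iff (mul hcG hlG)]
    convert d2 using 1
    push_cast
    linear_combination -etd
  · rw [← ZeroOrMem.mul_iff (mul (mul hpvG hgG) hlG)]
    convert d3 using 1
    push_cast
    linear_combination et
  · have := (isFundamental_cross_iff (G := (⊤ : Subgroup Rˣ)) (a := imageUnit φ d)
      (b := imageUnit φ a) (c := 1) (d := 1) trivial trivial trivial trivial).2 (by
        rw [ZeroOrMem.sub_comm_iff (G := ⊤) trivial]
        convert rad using 1
        simp)
    simpa using this
  · refine im (e * c * qv) r1 ?_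
    push_cast
    linear_combination (-qv : O) * ea + ed
  · refine im (pv * c * l) r2 ?_
    refine (e : Oˣ).isUnit.mul_left_cancel ?_
    push_cast
    linear_combination (-pv * l * t : O) * ea + (e * pv : O) * etd - (pu : O) * et
  · refine im (e * c * l) r3 ?_
    push_cast
    linear_combination (l : O) * ea + (e : O) * etd

end IsLifting

end PartialField

namespace PartialField

open Matrix

/-! ### Connectivity of the bipartite graph and its invariance under pivoting. -/

section Connected

variable {X Y R : Type*} [CommRing R] {A : Matrix X Y R} {T : Set Y}

/-- The bipartite graph of the nonzero entries of `A` in the columns `T` is connected. -/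
def IsConnectedOn (A : Matrix X Y R) (T : Set Y) : Prop :=
  ∀ (S : Set X) (B : Set Y), B ⊆ T → (S.Nonempty ∨ B.Nonempty) →
    (∀ x, ∀ y ∈ T, A x y ≠ 0 → (x ∈ S ↔ y ∈ B)) → S = Set.univ ∧ B = T

theorem IsConnectedOn.congr {S : Type*} [CommRing S] {B : Matrix X Y S} (h : IsConnectedOn A T)
    (hAB : ∀ x, ∀ y ∈ T, A x y ≠ 0 → B x y ≠ 0) : IsConnectedOn B T :=
  fun S C hC hne hcl => h S C hC hne fun x y hy hxy => hcl x y hy (hAB x y hy hxy)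

theorem IsConnectedOn.joined (h : IsConnectedOn A T) (y₀ : Y) (p q : X) :
    ∃ k, Joined A T k p q := by
  have := (h {q | ∃ k, Joined A T k q p} {y | y ∈ T ∧ ∃ x, (∃ k, Joined A T k x p) ∧ A x y ≠ 0}
    (fun y hy => hy.1) (Or.inl ⟨p, 0, Joined.refl p y₀⟩) (by
      intro x y hy hxy
      constructor
      · intro hx
        exact ⟨hy, x, hx, hxy⟩
      · rintro ⟨-, x', ⟨k, hk⟩, hx'⟩
        exact ⟨k + 1, hk.cons hy hxy hx'⟩)).1
  have hall : ∀ x, ∃ k, Joined A T k x p := fun x => by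
    have hx : x ∈ {q | ∃ k, Joined A T k q p} := by rw [this]; trivial
    exact hx
  have hp : ({x | ∃ k, Joined A T k p x} : Set X) = Set.univ :=
    (h {x | ∃ k, Joined A T k p x} {y | y ∈ T ∧ ∃ x, (∃ k, Joined A T k p x) ∧ A x y ≠ 0}
    (fun y hy => hy.1) (Or.inl ⟨p, 0, Joined.refl p y₀⟩) (by
      intro x y hy hxy
      constructor
      · intro hx
        exact ⟨hy, x, hx, hxy⟩
      · rintro ⟨-, x', ⟨k, hk⟩, hx'⟩
        exact hk.trans ((Joined.refl (A := A) (T := T) x y₀).cons hy hx' hxy))).1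
  have hq : q ∈ {x | ∃ k, Joined A T k p x} := by rw [hp]; trivial
  exact hq

theorem IsConnectedOn.pivot (h : IsConnectedOn A T) {x₀ : X} {y₀ : Y} (hy₀ : y₀ ∈ T)
    (hu : IsUnit (A x₀ y₀)) : IsConnectedOn (pivot A x₀ y₀) T := by
  cases subsingleton_or_nontrivial R
  · intro S B hB hne _
    exact h S B hB hne fun x y _ hxy => absurd (Subsingleton.elim _ _) hxy
  intro S B hB hne hcl
  refine h S B hB hne ?_
  have h0 : PartialField.pivot A x₀ y₀ x₀ y₀ ≠ 0 := by
    rw [pivot_self]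
    exact hu.ringInverse.ne_zero
  -- `A` is itself a pivot of the pivoted matrix `A'`. A nonzero entry of `A` is then an edge of
  -- `A'` or joins the ends of the path `x`, `y₀`, `x₀`, `y` in `A'`, so closed sets stay closed.
  rw [← pivot_pivot A x₀ y₀ hu]
  generalize PartialField.pivot A x₀ y₀ = A' at hcl h0
  have e0 := hcl x₀ y₀ hy₀ h0
  intro x y hy hxy
  by_cases hx : x = x₀
  · subst hx
    by_cases hyy : y = y₀
    · subst hyy
      exact e0
    · rw [pivot_row _ _ hyy] at hxy
      exact hcl x y hy (right_ne_zero_of_mul hxy)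
  · by_cases hyy : y = y₀
    · subst hyy
      rw [pivot_col _ _ hx, neg_ne_zero] at hxy
      exact hcl x y hy (left_ne_zero_of_mul hxy)
    · rw [pivot_of_ne _ hx hyy] at hxy
      by_cases h1 : A' x y = 0
      · rw [h1, zero_sub, neg_ne_zero] at hxy
        have h2 := hcl x y₀ hy₀ (left_ne_zero_of_mul (left_ne_zero_of_mul hxy))
        have h3 := hcl x₀ y hy (right_ne_zero_of_mul hxy)
        rw [h2, ← e0, h3]
      · exact hcl x y hy h1

end Connected

/-! ### Minors that meet two distinguished columns. -/

namespace IsLifting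

variable {O R F X Y : Type*} [CommRing O] [CommRing R] [Field F] {G : Subgroup Oˣ}
  {φ : O →+* R} {ψ : R →+* F}

/-- The cross ratio of rows `p`, `q` is the product of those of `p`, `c` and of `c`, `q`, so
`fundamental_mul` applies. -/
theorem zeroOrMem_of_middle (L : IsLifting G φ ψ) {pu pv cu cv qu qv : O}
    (hpu : ZeroOrMem G pu) (hpv : ZeroOrMem G pv) (hcu : ZeroOrMem G cu) (hcv : ZeroOrMem G cv)
    (hqu : ZeroOrMem G qu) (hqv : ZeroOrMem G qv)
    (pu0 : pu ≠ 0) (pv0 : pv ≠ 0) (cu0 : cu ≠ 0) (cv0 : cv ≠ 0) (qu0 : qu ≠ 0) (qv0 : qv ≠ 0)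
    (h1 : ZeroOrMem G (pu * cv - pv * cu)) (h2 : ZeroOrMem G (cu * qv - cv * qu))
    (h3 : ZeroOrMem ⊤ (φ (pu * qv - pv * qu))) : ZeroOrMem G (pu * qv - pv * qu) := by
  obtain ⟨pu, gpu, rfl⟩ := hpu.exists_of_ne pu0
  obtain ⟨pv, gpv, rfl⟩ := hpv.exists_of_ne pv0
  obtain ⟨cu, gcu, rfl⟩ := hcu.exists_of_ne cu0
  obtain ⟨cv, gcv, rfl⟩ := hcv.exists_of_ne cv0
  obtain ⟨qu, gqu, rfl⟩ := hqu.exists_of_ne qu0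
  obtain ⟨qv, gqv, rfl⟩ := hqv.exists_of_ne qv0
  rw [← isFundamental_cross_iff gpu gpv gcu gcv] at h1
  rw [← isFundamental_cross_iff gcu gcv gqu gqv] at h2
  rw [← isFundamental_cross_iff gpu gpv gqu gqv]
  have e : pv * cu * pu⁻¹ * cv⁻¹ * (cv * qu * cu⁻¹ * qv⁻¹) = pv * qu * pu⁻¹ * qv⁻¹ := by
    rw [show pv * cu * pu⁻¹ * cv⁻¹ * (cv * qu * cu⁻¹ * qv⁻¹) =
      pv * qu * pu⁻¹ * qv⁻¹ * (cu * cu⁻¹) * (cv * cv⁻¹) by ac_rfl]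
    simp
  rw [← e]
  refine L.fundamental_mul h1 h2 ?_
  rw [e]
  simp only [map_mul, map_inv]
  rw [isFundamental_cross_iff (G := (⊤ : Subgroup Rˣ)) trivial trivial trivial trivial]
  simpa using h3

/-- If deleting column `u` or `v` leaves only good minors, then so are the `2 × 2` minors in the
columns `u` and `v` whose rows are joined by a walk. -/
theorem zeroOrMem_of_joined [Finite X] (L : IsLifting G φ ψ) {u v : Y} (huv : u ≠ v) {T : Set Y}
    (huT : u ∉ T) (hvT : v ∉ T) (k : ℕ) (A : Matrix X Y O)
    (hAu : MinorsOn G A {u}ᶜ) (hAv : MinorsOn G A {v}ᶜ) (hφ : MinorsIn ⊤ (A.map φ))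
    {p q : X} (hpq : Joined A T k p q)
    (hpu : A p u ≠ 0) (hpv : A p v ≠ 0) (hqu : A q u ≠ 0) (hqv : A q v ≠ 0) :
    ZeroOrMem G (A p u * A q v - A p v * A q u) := by
  have mem_u : u ∈ ({v}ᶜ : Set Y) := huv
  have mem_v : v ∈ ({u}ᶜ : Set Y) := huv.symm
  have mem_y : ∀ {y}, y ∈ T → y ∈ ({u}ᶜ : Set Y) ∧ y ∈ ({v}ᶜ : Set Y) := fun hy =>
    ⟨fun h => huT (h ▸ hy), fun h => hvT (h ▸ hy)⟩
  induction k using Nat.strong_induction_on generalizing A p q with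
  | _ k ih =>
    have r0 : ∀ p q, ZeroOrMem ⊤ (φ (A p u * A q v - A p v * A q u)) := by
      intro p q
      have := (hφ.minorsOn Set.univ).two p q (u := u) (v := v) trivial trivial
      simpa only [map_apply, ← map_mul, ← map_sub] using this
    have gu := fun p => hAv.apply p mem_u
    have gv := fun p => hAu.apply p mem_v
    rcases hpq.shorten with ⟨l, hl, hj⟩ | ⟨x, y, hi, rfl, rfl⟩
    · exact ih l hl A hAu hAv hφ hj hpu hpv hqu hqv
    match k, hi with
    | 0, hi => rw [mul_comm, sub_self]; exact .zero
    | 1, hi =>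
      obtain ⟨h1, h2, h3⟩ := hi.1 0 (by omega)
      rw [zero_add] at h3
      have e1 := hAv.two (x 0) (x 1) mem_u (mem_y h1).2
      have e2 := hAu.two (x 0) (x 1) (mem_y h1).1 mem_v
      have := L.zeroOrMem_of_middle (gu (x 0)) (gv (x 0)) (hAu.apply (x 0) (mem_y h1).1)
        (hAu.apply (x 0) (mem_y h1).1) (gu (x 1)) (gv (x 1)) hpu hpv h2 h2 hqu hqv
      obtain ⟨pu, gpu, epu⟩ := (gu (x 0)).exists_of_ne hpu
      obtain ⟨pv, gpv, epv⟩ := (gv (x 0)).exists_of_ne hpv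
      obtain ⟨qu, gqu, equ⟩ := (gu (x 1)).exists_of_ne hqu
      obtain ⟨qv, gqv, eqv⟩ := (gv (x 1)).exists_of_ne hqv
      obtain ⟨c, gc, ec⟩ := (hAu.apply (x 0) (mem_y h1).1).exists_of_ne h2
      obtain ⟨d, gd, ed⟩ := (hAu.apply (x 1) (mem_y h1).1).exists_of_ne h3
      have r := r0 (x 0) (x 1)
      rw [← epu, ← epv, ← equ, ← eqv] at r ⊢
      rw [← epu, ← equ, ← ec, ← ed, ← isFundamental_cross_iff gpu gc gqu gd] at e1
      rw [← epv, ← eqv, ← ec, ← ed, ← isFundamental_cross_iff gc gpv gd gqv] at e2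
      -- The column `y 0` is the intermediary: the cross ratio of `u`, `v` factors into those of
      -- `u`, `y 0` and of `y 0`, `v`.
      have e : c * qu * pu⁻¹ * d⁻¹ * (pv * d * c⁻¹ * qv⁻¹) = pv * qu * pu⁻¹ * qv⁻¹ := by
        rw [show c * qu * pu⁻¹ * d⁻¹ * (pv * d * c⁻¹ * qv⁻¹) =
          pv * qu * pu⁻¹ * qv⁻¹ * (c * c⁻¹) * (d * d⁻¹) by ac_rfl]
        simp
      rw [← isFundamental_cross_iff gpu gpv gqu gqv, ← e]
      refine L.fundamental_mul e1 e2 ?_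
      rw [e]
      simp only [map_mul, map_inv]
      rw [isFundamental_cross_iff (G := (⊤ : Subgroup Rˣ)) trivial trivial trivial trivial]
      simpa using r
    | k + 2, hi =>
      obtain ⟨h1, h2, h3⟩ := hi.1 1 (by omega)
      by_cases hxu : A (x 1) u = 0 <;> by_cases hxv : A (x 1) v = 0
      on_goal 4 =>
        exact L.zeroOrMem_of_middle (gu _) (gv _) (gu _) (gv _) (gu _) (gv _) hpu hpv hxu hxv hqu hqv
          (ih 1 (by omega) A hAu hAv hφ (hi.1.segment (i := 0) (j := 1) (by omega) (by omega))
            hpu hpv hxu hxv)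
          (ih (k + 1) (by omega) A hAu hAv hφ
            (hi.1.segment (i := 1) (j := k + 2) (by omega) (by omega)) hxu hxv hqu hqv)
          (r0 _ _)
      all_goals
        have hu := (hAu.apply (x 1) (mem_y h1).1).isUnit h2
        have huy : u ≠ y 1 := fun h => huT (h ▸ h1)
        have hvy : v ≠ y 1 := fun h => hvT (h ▸ h1)
        -- A pivot on `x 1`, `y 1` shortens the path. It is usable when the correction terms in
        -- columns `u` and `v` vanish in the two end rows, because the 2 × 2 minor is then
        -- unchanged.
        have step : (∀ w, w = u ∨ w = v → A (x 0) (y 1) * A (x 1) w = 0 ∧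
            A (x (k + 2)) (y 1) * A (x 1) w = 0) →
            ZeroOrMem G (A (x 0) u * A (x (k + 2)) v - A (x 0) v * A (x (k + 2)) u) := by
          intro hz
          have hx0 := hi.ne_one (i := 0) (by omega) (by omega)
          have hx2 := hi.ne_one (i := k + 2) (by omega) (by omega)
          have ep : ∀ i w, i ≠ x 1 → (w = u ∨ w = v) → A i (y 1) * A (x 1) w = 0 →
              pivot A (x 1) (y 1) i w = A i w := by
            intro i w hi hw h
            rw [pivot_of_ne _ hi (by rcases hw with rfl | rfl <;> assumption), mul_right_comm, h,
              zero_mul, sub_zero]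
          have e1 := ep _ u hx0 (Or.inl rfl) (hz u (Or.inl rfl)).1
          have e2 := ep _ v hx0 (Or.inr rfl) (hz v (Or.inr rfl)).1
          have e3 := ep _ u hx2 (Or.inl rfl) (hz u (Or.inl rfl)).2
          have e4 := ep _ v hx2 (Or.inr rfl) (hz v (Or.inr rfl)).2
          have := ih (k + 1) (by omega) (pivot A (x 1) (y 1))
            (hAu.pivot L.neg_one_mem _ (mem_y h1).1 hu) (hAv.pivot L.neg_one_mem _ (mem_y h1).2 hu)
            (by rw [pivot_map φ _ _ _ hu]; exact hφ.pivot (G := ⊤) trivial _ _ (hu.map φ))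
            (hi.joined_pivot fun x y hy h => (hAu.apply x (mem_y hy).1).isUnit h)
            (by rwa [e1]) (by rwa [e2]) (by rwa [e3]) (by rwa [e4])
          rwa [e1, e2, e3, e4] at this
      · refine step ?_
        rintro w (rfl | rfl) <;> simp [hxu, hxv]
      all_goals
        -- For longer paths the end rows miss column `y 1`, so `step` applies. In a path with three
        -- rows the last row meets `y 1`, and the special case `zeroOrMem_of_path_two` is needed.
        rcases Nat.eq_zero_or_pos k with hk | hk
        · subst hk
          first
            | exact L.zeroOrMem_of_path_two A hAu hAv hφ huT hvT huv hi hpu hpv hqu hqv hxu hxv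
            | rw [ZeroOrMem.sub_comm_iff L.neg_one_mem]
              exact L.zeroOrMem_of_path_two A hAv hAu hφ hvT huT huv.symm hi hpv hpu hqv hqu hxv hxu
        · refine step fun w _ => ?_
          rw [hi.eq_zero (i := 0) (j := 1) (by omega) (by omega) (by omega) (by omega),
            hi.eq_zero (i := k + 2) (j := 1) (by omega) (by omega) (by omega) (by omega)]
          simp

/-- Minors avoiding `u` or `v` are good by assumption. A larger minor using both has a third column,
and pivoting there lowers the order while preserving all hypotheses, connectivity included. This
leaves the 2 × 2 minors, whose rows are joined by a walk. -/
theorem minorsIn_of_two_columns [Finite X] (L : IsLifting G φ ψ) {u v : Y} (huv : u ≠ v)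
    (A : Matrix X Y O) (hAu : MinorsOn G A {u}ᶜ) (hAv : MinorsOn G A {v}ᶜ)
    (hφ : MinorsIn ⊤ (A.map φ)) (hc : IsConnectedOn A {u, v}ᶜ) : MinorsIn G A := by
  have mem_u : u ∈ ({v}ᶜ : Set Y) := huv
  have mem_v : v ∈ ({u}ᶜ : Set Y) := huv.symm
  intro k
  induction k using Nat.strong_induction_on generalizing A with
  | _ k ih =>
    intro f g
    by_cases hf : Function.Injective f
    swap
    · rw [det_submatrix_eq_zero_of_not_injective_left _ _ hf]; exact .zero
    by_cases hg : Function.Injective g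
    swap
    · rw [det_submatrix_eq_zero_of_not_injective_right _ _ hg]; exact .zero
    by_cases hu : ∃ i, g i = u
    swap
    · exact hAu k f g fun i h => hu ⟨i, h⟩
    by_cases hv : ∃ i, g i = v
    swap
    · exact hAv k f g fun i h => hv ⟨i, h⟩
    have two : ∀ p q, ZeroOrMem G (A p u * A q v - A p v * A q u) := by
      intro p q
      have gu := fun p => hAv.apply p mem_u
      have gv := fun p => hAu.apply p mem_v
      by_cases h1 : A p u = 0
      · rw [h1, zero_mul, zero_sub]
        exact ((gv p).mul (gu q)).neg L.neg_one_mem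
      by_cases h2 : A q v = 0
      · rw [h2, mul_zero, zero_sub]
        exact ((gv p).mul (gu q)).neg L.neg_one_mem
      by_cases h3 : A p v = 0
      · rw [h3, zero_mul, sub_zero]
        exact (gu p).mul (gv q)
      by_cases h4 : A q u = 0
      · rw [h4, mul_zero, sub_zero]
        exact (gu p).mul (gv q)
      obtain ⟨k, hk⟩ := hc.joined u p q
      exact L.zeroOrMem_of_joined huv (by simp) (by simp) k A hAu hAv hφ hk h1 h3 h4 h2
    obtain ⟨i₁, rfl⟩ := hu
    obtain ⟨i₂, rfl⟩ := hv
    match k, f, g, i₁, i₂ with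
    | 1, f, g, i₁, i₂ => exact absurd (by rw [Subsingleton.elim i₁ i₂]) huv
    | 2, f, g, i₁, i₂ =>
      rw [det_fin_two]
      simp only [submatrix_apply]
      have h12 : i₁ ≠ i₂ := fun h => huv (by rw [h])
      fin_cases i₁ <;> fin_cases i₂ <;> simp at h12 two ⊢
      · exact two _ _
      · rw [ZeroOrMem.sub_comm_iff L.neg_one_mem]
        exact two _ _
    | k + 3, f, g, i₁, i₂ =>
      obtain ⟨j, hj⟩ : ∃ j : Fin (k + 3), j ∉ ({i₁, i₂} : Finset (Fin (k + 3))) := by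
        by_contra! h
        have h1 := Finset.card_le_card (fun j _ => h j : Finset.univ ⊆ ({i₁, i₂} : Finset _))
        have h2 : ({i₁, i₂} : Finset (Fin (k + 3))).card ≤ 2 := Finset.card_le_two
        simp only [Finset.card_univ, Fintype.card_fin] at h1
        omega
      simp only [Finset.mem_insert, Finset.mem_singleton, not_or] at hj
      have hj1 : g j ≠ g i₁ := hg.ne hj.1
      have hj2 : g j ≠ g i₂ := hg.ne hj.2
      by_cases h0 : ∀ i, A (f i) (g j) = 0
      · rw [det_eq_zero_of_column_eq_zero j h0]; exact .zero
      push Not at h0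
      obtain ⟨i, hi⟩ := h0
      have hgood := hAu.apply (f i) (y := g j) hj1
      have hunit := hgood.isUnit hi
      rw [det_eq_mul_det_schur _ i j hunit, mul_assoc]
      refine ZeroOrMem.neg_one_pow_mul L.neg_one_mem _ (hgood.mul ?_)
      have := ih (k + 2) (by omega) (pivot A (f i) (g j))
        (hAu.pivot L.neg_one_mem _ hj1 hunit) (hAv.pivot L.neg_one_mem _ hj2 hunit)
        (by rw [pivot_map φ _ _ _ hunit]; exact hφ.pivot (G := ⊤) trivial _ _ (hunit.map φ))
        (hc.pivot (by simp [hj1, hj2]) hunit) (f ∘ i.succAbove) (g ∘ j.succAbove)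
      convert this using 2
      refine congrArg Matrix.det ?_
      funext r c
      exact (pivot_of_ne A (hf.ne (Fin.succAbove_ne i r)) (hg.ne (Fin.succAbove_ne j c))).symm

end IsLifting

end PartialField

namespace PartialField

open Matrix

/-! ### Adding a sparse row, and block sums. -/

section Gluing

variable {R X Y : Type*} [CommRing R] {G : Subgroup Rˣ} {A : Matrix X Y R}

theorem MinorsIn.of_isEmpty [IsEmpty X] : MinorsIn G A := by
  intro k f g
  cases k with
  | zero => rw [det_isEmpty]; exact .one
  | succ k => exact isEmptyElim (f 0)

theorem MinorsIn.of_row (hG : -1 ∈ G) (w : X) (y : Y) (h0 : ∀ j, j ≠ y → A w j = 0)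
    (h1 : ZeroOrMem G (A w y)) (h : MinorsIn G (A.submatrix (Subtype.val : ({w}ᶜ : Set X) → X) id)) :
    MinorsIn G A := by
  intro k f g
  by_cases hf : Function.Injective f
  swap
  · rw [det_submatrix_eq_zero_of_not_injective_left _ _ hf]; exact .zero
  by_cases hg : Function.Injective g
  swap
  · rw [det_submatrix_eq_zero_of_not_injective_right _ _ hg]; exact .zero
  by_cases hi : ∃ i, f i = w
  · obtain ⟨i, rfl⟩ := hi
    by_cases hj : ∃ j, g j = y
    · obtain ⟨j, rfl⟩ := hj
      cases k with
      | zero => exact i.elim0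
      | succ k =>
        rw [← det_transpose]
        refine zeroOrMem_det_of_column hG _ j i ?_ h1 ?_
        · intro j' hj'
          exact h0 _ (hg.ne hj')
        · rw [← det_transpose]
          exact h k (fun r => ⟨f (i.succAbove r), hf.ne (Fin.succAbove_ne _ _)⟩)
            (fun c => g (j.succAbove c))
    · rw [det_eq_zero_of_row_eq_zero i]
      · exact .zero
      · intro j
        exact h0 _ fun h => hj ⟨j, h⟩
  · exact h k (fun i => ⟨f i, fun h => hi ⟨i, h⟩⟩) g

/-- If the selected rows and columns are evenly split between the blocks, a permutation of the
columns makes the minor block triangular. Otherwise every term of the Leibniz expansion contains a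
zero. -/
theorem MinorsIn.of_blocks (hG : -1 ∈ G) (S : Set X) (B : Set Y)
    (h0 : ∀ x y, A x y ≠ 0 → (x ∈ S ↔ y ∈ B))
    (h1 : MinorsIn G (A.submatrix (Subtype.val : S → X) (Subtype.val : B → Y)))
    (h2 : MinorsIn G (A.submatrix (Subtype.val : (Sᶜ : Set X) → X)
      (Subtype.val : (Bᶜ : Set Y) → Y))) : MinorsIn G A := by
  classical
  intro k f g
  by_cases hσ : ∃ σ : Equiv.Perm (Fin k), ∀ i, f i ∈ S ↔ g (σ i) ∈ B
  · obtain ⟨σ, hσ⟩ := hσ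
    rw [← ZeroOrMem.sign_mul hG (Equiv.Perm.sign σ), ← det_permute' σ,
      twoBlockTriangular_det _ fun i => f i ∈ S]
    · refine ZeroOrMem.mul ?_ ?_
      · exact h1.det (m := {i // f i ∈ S}) (fun i => ⟨f i.1, i.2⟩)
          (fun i => ⟨g (σ i.1), (hσ _).1 i.2⟩)
      · exact h2.det (m := {i // ¬ f i ∈ S}) (fun i => ⟨f i.1, i.2⟩)
          (fun i => ⟨g (σ i.1), fun h => i.2 ((hσ _).2 h)⟩)
    · intro i hi j hj
      by_contra hne
      exact hi ((h0 _ _ hne).2 ((hσ j).1 hj))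
  · left
    push Not at hσ
    rw [det_apply']
    refine Finset.sum_eq_zero fun σ _ => ?_
    obtain ⟨i, hi⟩ := hσ σ⁻¹
    rw [Finset.prod_eq_zero (Finset.mem_univ (σ⁻¹ i)), mul_zero]
    rw [submatrix_apply, show σ (σ⁻¹ i) = i from σ.apply_symm_apply i]
    by_contra hne
    have := h0 _ _ hne
    tauto

end Gluing

/-! ### Removing pairs of vertices from a connected graph. -/

section ConnectedSet

variable {V : Type*} {adj : V → V → Prop}

/-- The set `S` induces a connected subgraph (or is empty). -/
def IsConnectedSet (adj : V → V → Prop) (S : Set V) : Prop :=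
  ∀ C ⊆ S, C.Nonempty → (∀ a ∈ C, ∀ b ∈ S, adj a b → b ∈ C) → C = S

theorem IsConnectedSet.insert (hs : ∀ a b, adj a b → adj b a) {K : Set V}
    (hK : IsConnectedSet adj K) {a b : V} (ha : a ∈ K) (hab : adj a b) :
    IsConnectedSet adj (insert b K) := by
  intro C hC hne hcl
  have hmem : (C ∩ K).Nonempty := by
    obtain ⟨c, hc⟩ := hne
    rcases hC hc with rfl | hcK
    · exact ⟨a, hcl c hc a (Or.inr ha) (hs _ _ hab), ha⟩
    · exact ⟨c, hc, hcK⟩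
  have h1 : C ∩ K = K := hK _ Set.inter_subset_right hmem fun x hx y hy hxy =>
    ⟨hcl x hx.1 y (Or.inr hy) hxy, hy⟩
  have h2 : K ⊆ C := by rw [← h1]; exact Set.inter_subset_left
  refine hC.antisymm (Set.insert_subset ?_ h2)
  exact hcl a (h2 ha) b (Or.inl rfl) hab

theorem IsConnectedSet.singleton (c : V) : IsConnectedSet adj {c} := by
  intro C hC hne _
  exact (Set.subset_singleton_iff_eq.1 hC).resolve_left hne.ne_empty

/-- A connected graph with a vertex of degree at least three has three vertices that can be removed
one after the other in any order without destroying connectivity. -/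
theorem exists_three_leaves [Finite V] (hs : ∀ a b, adj a b → adj b a)
    (hc : IsConnectedSet adj (Set.univ : Set V)) (n : ℕ) (K : Set V) (hn : Kᶜ.ncard = n)
    (hK : IsConnectedSet adj K) {l₁ l₂ l₃ : V} (h₁ : l₁ ∉ K) (h₂ : l₂ ∉ K) (h₃ : l₃ ∉ K)
    (h₁₂ : l₁ ≠ l₂) (h₁₃ : l₁ ≠ l₃) (h₂₃ : l₂ ≠ l₃)
    (a₁ : ∃ a ∈ K, adj a l₁) (a₂ : ∃ a ∈ K, adj a l₂) (a₃ : ∃ a ∈ K, adj a l₃) :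
    ∃ m₁ m₂ m₃ : V, m₁ ≠ m₂ ∧ m₁ ≠ m₃ ∧ m₂ ≠ m₃ ∧ IsConnectedSet adj ({m₁, m₂}ᶜ) ∧
      IsConnectedSet adj ({m₁, m₃}ᶜ) ∧ IsConnectedSet adj ({m₂, m₃}ᶜ) := by
  induction n using Nat.strong_induction_on generalizing K l₁ l₂ l₃ with
  | _ n ih =>
    by_cases hall : ∀ b, b ∈ K ∨ b = l₁ ∨ b = l₂ ∨ b = l₃
    · obtain ⟨b₁, hb₁, e₁⟩ := a₁
      obtain ⟨b₂, hb₂, e₂⟩ := a₂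
      obtain ⟨b₃, hb₃, e₃⟩ := a₃
      refine ⟨l₁, l₂, l₃, h₁₂, h₁₃, h₂₃, ?_, ?_, ?_⟩
      · convert hK.insert hs hb₃ e₃ using 1
        ext b
        simp only [Set.mem_compl_iff, Set.mem_insert_iff, Set.mem_singleton_iff, not_or]
        constructor
        · rintro ⟨c1, c2⟩; have := hall b; tauto
        · rintro (rfl | hb)
          · exact ⟨h₁₃.symm, h₂₃.symm⟩
          · exact ⟨fun h => h₁ (h ▸ hb), fun h => h₂ (h ▸ hb)⟩
      · convert hK.insert hs hb₂ e₂ using 1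
        ext b
        simp only [Set.mem_compl_iff, Set.mem_insert_iff, Set.mem_singleton_iff, not_or]
        constructor
        · rintro ⟨c1, c2⟩; have := hall b; tauto
        · rintro (rfl | hb)
          · exact ⟨h₁₂.symm, h₂₃⟩
          · exact ⟨fun h => h₁ (h ▸ hb), fun h => h₃ (h ▸ hb)⟩
      · convert hK.insert hs hb₁ e₁ using 1
        ext b
        simp only [Set.mem_compl_iff, Set.mem_insert_iff, Set.mem_singleton_iff, not_or]
        constructor
        · rintro ⟨c1, c2⟩; have := hall b; tauto
        · rintro (rfl | hb)
          · exact ⟨h₁₂, h₁₃⟩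
          · exact ⟨fun h => h₂ (h ▸ hb), fun h => h₃ (h ▸ hb)⟩
    -- While vertices remain, `K` grows and keeps three neighbours outside it. At the end only those
    -- three are outside, and restoring any one of them to `K` keeps it connected.
    · have hlt : ∀ b, b ∉ K → (insert b K)ᶜ.ncard < n := by
        intro b hb
        rw [← hn]
        refine Set.ncard_lt_ncard ⟨Set.compl_subset_compl.2 (Set.subset_insert _ _), fun h => ?_⟩
          (Set.toFinite _)
        exact h hb (Set.mem_insert _ _)
      have hex : ∃ a b, (a ∈ K ∨ a = l₁ ∨ a = l₂ ∨ a = l₃) ∧ ¬ (b ∈ K ∨ b = l₁ ∨ b = l₂ ∨ b = l₃) ∧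
          adj a b := by
        by_contra! hno
        apply hall
        intro b
        have := hc {b | b ∈ K ∨ b = l₁ ∨ b = l₂ ∨ b = l₃} (Set.subset_univ _)
          ⟨l₁, Or.inr (Or.inl rfl)⟩ (fun a ha b _ hab => by
            by_contra hb
            exact hno a b ha (by simpa using hb) hab)
        have hb : b ∈ {b | b ∈ K ∨ b = l₁ ∨ b = l₂ ∨ b = l₃} := by rw [this]; trivial
        exact hb
      obtain ⟨a, b, ha, hb, hab⟩ := hex
      simp only [not_or] at hb
      obtain ⟨hbK, hb1, hb2, hb3⟩ := hb
      have up : ∀ {c l}, (∃ a ∈ K, adj a l) → ∃ a ∈ insert c K, adj a l :=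
        fun ⟨a, ha, h⟩ => ⟨a, Or.inr ha, h⟩
      have out : ∀ {c l}, l ≠ c → l ∉ K → l ∉ insert c K :=
        fun h h' h'' => h''.elim h h'
      rcases ha with ha | rfl | rfl | rfl
      · exact ih _ (hlt b hbK) (insert b K) rfl (hK.insert hs ha hab) (out (Ne.symm hb1) h₁)
          (out (Ne.symm hb2) h₂) (out (Ne.symm hb3) h₃) h₁₂ h₁₃ h₂₃ (up a₁) (up a₂) (up a₃)
      -- The new vertex `b` is attached to one of the three outside neighbours: that neighbour is
      -- absorbed into `K`, and `b` takes its place.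
      · obtain ⟨c, hcK, hca⟩ := a₁
        exact ih _ (hlt a h₁) (insert a K) rfl (hK.insert hs hcK hca) (out hb1 hbK)
          (out h₁₂.symm h₂) (out h₁₃.symm h₃) hb2 hb3 h₂₃ ⟨a, Or.inl rfl, hab⟩ (up a₂) (up a₃)
      · obtain ⟨c, hcK, hca⟩ := a₂
        exact ih _ (hlt a h₂) (insert a K) rfl (hK.insert hs hcK hca) (out h₁₂ h₁)
          (out hb2 hbK) (out h₂₃.symm h₃) (Ne.symm hb1) h₁₃ hb3 (up a₁) ⟨a, Or.inl rfl, hab⟩ (up a₃)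
      · obtain ⟨c, hcK, hca⟩ := a₃
        exact ih _ (hlt a h₃) (insert a K) rfl (hK.insert hs hcK hca) (out h₁₃ h₁) (out h₂₃ h₂)
          (out hb3 hbK) h₁₂ (Ne.symm hb1) (Ne.symm hb2) (up a₁) (up a₂) ⟨a, Or.inl rfl, hab⟩

variable {X Y R : Type*} [CommRing R] {A : Matrix X Y R}

/-- Adjacency in the bipartite graph of the nonzero entries of `A`. -/
def matrixAdj (A : Matrix X Y R) : X ⊕ Y → X ⊕ Y → Prop
  | Sum.inl x, Sum.inr y => A x y ≠ 0
  | Sum.inr y, Sum.inl x => A x y ≠ 0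
  | _, _ => False

theorem matrixAdj_symm (a b : X ⊕ Y) (h : matrixAdj A a b) : matrixAdj A b a := by
  rcases a with x | y <;> rcases b with x' | y' <;> exact h

theorem IsConnectedOn.isConnectedSet (h : IsConnectedOn A Set.univ) :
    IsConnectedSet (matrixAdj A) Set.univ := by
  intro C _ hne hcl
  obtain ⟨h1, h2⟩ := h (Sum.inl ⁻¹' C) (Sum.inr ⁻¹' C) (Set.subset_univ _)
    (by
      obtain ⟨x | y, hc⟩ := hne
      exacts [Or.inl ⟨x, hc⟩, Or.inr ⟨y, hc⟩])
    (fun x y _ hxy => ⟨fun hx => hcl _ hx (Sum.inr y) trivial hxy,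
      fun hy => hcl _ hy (Sum.inl x) trivial hxy⟩)
  refine Set.eq_univ_of_forall ?_
  rintro (x | y)
  · exact Set.eq_univ_iff_forall.1 h1 x
  · exact Set.eq_univ_iff_forall.1 h2 y

theorem IsConnectedSet.isConnectedOn {u v : Y}
    (h : IsConnectedSet (matrixAdj A) {Sum.inr u, Sum.inr v}ᶜ) : IsConnectedOn A {u, v}ᶜ := by
  intro S B hB hne hcl
  have := h (Sum.inl '' S ∪ Sum.inr '' B) (by
      rintro _ (⟨x, _, rfl⟩ | ⟨y, hy, rfl⟩)
      · simp
      · simpa using hB hy)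
    (by
      rcases hne with ⟨x, hx⟩ | ⟨y, hy⟩
      exacts [⟨_, Or.inl ⟨x, hx, rfl⟩⟩, ⟨_, Or.inr ⟨y, hy, rfl⟩⟩])
    (by
      rintro _ (⟨x, hx, rfl⟩ | ⟨y, hy, rfl⟩) (x' | y') hb hab
      · exact hab.elim
      · exact Or.inr ⟨y', (hcl x y' (by simpa using hb) hab).1 hx, rfl⟩
      · exact Or.inl ⟨x', (hcl x' y (hB hy) hab).2 hy, rfl⟩
      · exact hab.elim)
  rw [Set.ext_iff] at this
  constructor
  · refine Set.eq_univ_of_forall fun x => ?_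
    simpa using this (Sum.inl x)
  · ext y
    simpa using this (Sum.inr y)

theorem IsConnectedSet.isConnectedOn_transpose {u v : X}
    (h : IsConnectedSet (matrixAdj A) {Sum.inl u, Sum.inl v}ᶜ) : IsConnectedOn Aᵀ {u, v}ᶜ := by
  intro S B hB hne hcl
  have := h (Sum.inr '' S ∪ Sum.inl '' B) (by
      rintro _ (⟨x, _, rfl⟩ | ⟨y, hy, rfl⟩)
      · simp
      · simpa using hB hy)
    (by
      rcases hne with ⟨x, hx⟩ | ⟨y, hy⟩
      exacts [⟨_, Or.inl ⟨x, hx, rfl⟩⟩, ⟨_, Or.inr ⟨y, hy, rfl⟩⟩])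
    (by
      rintro _ (⟨x, hx, rfl⟩ | ⟨y, hy, rfl⟩) (x' | y') hb hab
      · exact Or.inr ⟨x', (hcl x x' (by simpa using hb) hab).1 hx, rfl⟩
      · exact hab.elim
      · exact hab.elim
      · exact Or.inl ⟨y', (hcl y' y (hB hy) hab).2 hy, rfl⟩)
  rw [Set.ext_iff] at this
  constructor
  · refine Set.eq_univ_of_forall fun x => ?_
    simpa using this (Sum.inr x)
  · ext y
    simpa using this (Sum.inl y)

end ConnectedSet

end PartialField

namespace PartialField

open Matrix

/-! ### Uniqueness of lifts up to scaling. -/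

namespace IsLifting

variable {O R F X Y : Type*} [CommRing O] [CommRing R] [Field F] {G : Subgroup Oˣ}
  {φ : O →+* R} {ψ : R →+* F}

/-- Two lifts of a connected matrix are equal up to scaling rows and columns by elements of the
kernel of `φ`. -/
theorem exists_scaling [Finite X] [Finite Y] (L : IsLifting G φ ψ) {T : Set Y} (A B : Matrix X Y O)
    (hA : MinorsOn G A T) (hB : MinorsOn G B T) (hφ : ∀ x, ∀ y ∈ T, φ (A x y) = φ (B x y))
    (hc : IsConnectedOn A T) :
    ∃ (s : X → Oˣ) (t : Y → Oˣ), (∀ x, s x ∈ G ⊓ (imageUnit φ).ker) ∧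
      (∀ y, t y ∈ G ⊓ (imageUnit φ).ker) ∧ ∀ x, ∀ y ∈ T, A x y = s x * B x y * t y := by
  classical
  have hzero : ∀ x, ∀ y ∈ T, A x y = 0 → B x y = 0 := by
    intro x y hy h
    rw [← L.map_eq_zero_iff (hB.apply x hy), ← hφ x y hy, h, map_zero]
  -- The scaling is built one column at a time, along a set `T'` of columns that stays connected, so
  -- that `ratio_eq` applies to each new column.
  have main : ∀ n ≤ T.ncard, ∃ T' ⊆ T, T'.ncard = n ∧
      (∀ p q, (∃ y ∈ T', A p y ≠ 0) → (∃ y ∈ T', A q y ≠ 0) → ∃ k, Joined A T' k p q) ∧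
      ∃ (s : X → Oˣ) (t : Y → Oˣ), (∀ x, s x ∈ G ⊓ (imageUnit φ).ker) ∧
      (∀ y, t y ∈ G ⊓ (imageUnit φ).ker) ∧ ∀ x, ∀ y ∈ T', A x y = s x * B x y * t y := by
    intro n
    induction n with
    | zero =>
      intro _
      exact ⟨∅, Set.empty_subset _, by simp, by simp, 1, 1, fun _ => one_mem _, fun _ => one_mem _,
        by simp⟩
    | succ n ih =>
      intro hn
      obtain ⟨T', hT', hcard, hjoin, s, t, hs, ht, hst⟩ := ih (by omega)
      have hne : T' ≠ T := fun h => by rw [h] at hcard; omega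
      obtain ⟨w, hwT, hwT', hw⟩ : ∃ w ∈ T, w ∉ T' ∧
          (T' = ∅ ∨ ∃ x, (∃ y ∈ T', A x y ≠ 0) ∧ A x w ≠ 0) := by
        by_contra! hno
        rcases Set.eq_empty_or_nonempty T' with h0 | h0
        · obtain ⟨w, hw⟩ : T.Nonempty := by
            rw [Set.nonempty_iff_ne_empty, ← h0]
            exact hne.symm
          exact (hno w hw (by rw [h0]; exact Set.notMem_empty w)).1.ne_empty h0
        · refine hne (hc {x | ∃ y ∈ T', A x y ≠ 0} T' hT' (Or.inr h0) ?_).2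
          intro x y hy hxy
          refine ⟨fun hx => ?_, fun hyT => ⟨y, hyT, hxy⟩⟩
          by_contra hyT
          obtain ⟨z, hz, hxz⟩ := hx
          exact hxy ((hno y hy hyT).2 x ⟨z, hz, hxz⟩)
      refine ⟨insert w T', Set.insert_subset hwT hT', by
        rw [Set.ncard_insert_of_notMem hwT', hcard], ?_, ?_⟩
      · have hsub : T' ⊆ insert w T' := Set.subset_insert _ _
        have hwm : w ∈ insert w T' := Set.mem_insert _ _
        have hx : ∀ p, (∃ y ∈ T', A p y ≠ 0) → ∃ x, (∃ y ∈ T', A x y ≠ 0) ∧ A x w ≠ 0 := by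
          rintro p ⟨y, hy, -⟩
          exact hw.resolve_left (Set.nonempty_iff_ne_empty.1 ⟨y, hy⟩)
        rintro p q ⟨y, rfl | hy, hpy⟩ ⟨z, rfl | hz, hqz⟩
        · exact ⟨_, (Joined.refl q z).cons hwm hpy hqz⟩
        · obtain ⟨x, hx, hxw⟩ := hx q ⟨z, hz, hqz⟩
          obtain ⟨k, hk⟩ := hjoin x q hx ⟨z, hz, hqz⟩
          exact ⟨_, (hk.mono hsub).cons hwm hpy hxw⟩
        · obtain ⟨x, hx, hxw⟩ := hx p ⟨y, hy, hpy⟩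
          obtain ⟨k, hk⟩ := hjoin p x ⟨y, hy, hpy⟩ hx
          exact (hk.mono hsub).trans ((Joined.refl q z).cons hwm hxw hqz)
        · obtain ⟨k, hk⟩ := hjoin p q ⟨y, hy, hpy⟩ ⟨z, hz, hqz⟩
          exact ⟨k, hk.mono hsub⟩
      · have hρ : ∀ x, ∃ ρ ∈ G ⊓ (imageUnit φ).ker, A x w = ρ * B x w := by
          intro x
          by_cases h0 : A x w = 0
          · exact ⟨1, one_mem _, by rw [h0, hzero x w hwT h0, mul_zero]⟩
          · obtain ⟨a, ha, ha'⟩ := (hA.apply x hwT).exists_of_ne h0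
            obtain ⟨b, hb, hb'⟩ := (hB.apply x hwT).exists_of_ne (fun h => L.map_ne_zero
              (hA.apply x hwT) h0 (by rw [hφ x w hwT, h, map_zero]))
            refine ⟨a * b⁻¹, ⟨G.mul_mem ha (G.inv_mem hb), ?_⟩, ?_⟩
            · have := hφ x w hwT
              rw [← ha', ← hb'] at this
              have h' : imageUnit φ a = imageUnit φ b := Units.ext this
              change imageUnit φ (a * b⁻¹) = 1
              rw [map_mul, map_inv, h', mul_inv_cancel]
            · rw [← ha', ← hb', ← Units.val_mul, inv_mul_cancel_right]
        choose ρ hρ hρ' using hρ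
        -- By `ratio_eq`, the factor still needed in column `w` is the same in all rows already
        -- scaled. It becomes the column factor.
        obtain ⟨τ, hτ, hτ'⟩ : ∃ τ ∈ G ⊓ (imageUnit φ).ker, ∀ x, (∃ y ∈ T', A x y ≠ 0) → A x w ≠ 0 →
            ρ x = s x * τ := by
          by_cases hx₀ : ∃ x₀, (∃ y ∈ T', A x₀ y ≠ 0) ∧ A x₀ w ≠ 0
          · obtain ⟨x₀, h1, h2⟩ := hx₀
            refine ⟨(s x₀)⁻¹ * ρ x₀, mul_mem (inv_mem (hs _)) (hρ _), ?_⟩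
            intro x hx hxw
            obtain ⟨k, hk⟩ := hjoin x x₀ hx h1
            have hsub : insert w T' ⊆ T := Set.insert_subset hwT hT'
            have h3 := L.ratio_eq hwT' k A (Matrix.of fun x y => (s x : O) * B x y * t y)
              (hA.mono hsub)
              ((hB.mono hsub).scale s t (fun x => (hs x).1) (fun y => (ht y).1)) hst (by
                intro x
                have e1 : φ (s x) = 1 := congrArg Units.val (hs x).2
                have e2 : φ (t w) = 1 := congrArg Units.val (ht w).2
                simp [e1, e2, hφ x w hwT]) hk hxw h2
            have hbx : ∀ x, A x w ≠ 0 → IsUnit (B x w) := fun x hx => (hB.apply x hwT).isUnit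
              (fun h => hx (by rw [hρ' x, h, mul_zero]))
            obtain ⟨b, hb⟩ := hbx x hxw
            obtain ⟨b₀, hb₀⟩ := hbx x₀ h2
            rw [hρ' x, hρ' x₀, of_apply, of_apply, ← hb, ← hb₀] at h3
            have h4 : ρ x * b * (s x₀ * b₀ * t w) = ρ x₀ * b₀ * (s x * b * t w) := Units.ext (by
              push_cast; exact h3)
            have h5 : (ρ x * s x₀) * (b * b₀ * t w) = (s x * ρ x₀) * (b * b₀ * t w) := by
              rw [show (ρ x * s x₀) * (b * b₀ * t w) = ρ x * b * (s x₀ * b₀ * t w) by ac_rfl, h4]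
              ac_rfl
            have h6 := mul_right_cancel h5
            rw [mul_left_comm, ← h6, mul_comm (ρ x), inv_mul_cancel_left]
          · push Not at hx₀
            exact ⟨1, one_mem _, fun x hx hxw => absurd (hx₀ x hx) hxw⟩
        -- Rows that column `w` meets for the first time have zeros throughout `T'`, so their row
        -- factor may be reset.
        refine ⟨fun x => if A x w ≠ 0 ∧ ¬ ∃ y ∈ T', A x y ≠ 0 then ρ x * τ⁻¹ else s x,
          Function.update t w τ, ?_, ?_, ?_⟩
        · intro x
          dsimp only
          split_ifs
          exacts [mul_mem (hρ x) (inv_mem hτ), hs x]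
        · intro y
          by_cases hy : y = w
          · subst hy; simpa using hτ
          · rw [Function.update_of_ne hy]; exact ht y
        · rintro x y (rfl | hy)
          · rw [Function.update_self]
            by_cases h0 : A x y = 0
            · rw [h0, hzero x y hwT h0, mul_zero, zero_mul]
            · by_cases hx : ∃ z ∈ T', A x z ≠ 0
              · beta_reduce
                rw [if_neg (fun h => h.2 hx), hρ', hτ' x hx h0]
                push_cast
                ring
              · beta_reduce
                rw [if_pos ⟨h0, hx⟩, hρ', mul_right_comm, ← Units.val_mul, inv_mul_cancel_right]
          · have hyw : y ≠ w := fun h => hwT' (h ▸ hy)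
            rw [Function.update_of_ne hyw]
            by_cases hx : ∃ z ∈ T', A x z ≠ 0
            · beta_reduce
              rw [if_neg (fun h => h.2 hx)]; exact hst x y hy
            · push Not at hx
              rw [hx y hy, hzero x y (hT' hy) (hx y hy), mul_zero, zero_mul]
  obtain ⟨T', hT', hcard, -, s, t, hs, ht, hst⟩ := main _ le_rfl
  rw [Set.eq_of_subset_of_ncard_le hT' hcard.ge] at hst
  exact ⟨s, t, hs, ht, hst⟩

end IsLifting

/-! ### Constructions that preserve liftability. -/

section Liftable

variable {O R F X Y : Type*} [CommRing O] [CommRing R] [Field F] {G : Subgroup Oˣ}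
  {φ : O →+* R} {ψ : R →+* F}

/-- `D` is the image of a matrix over `O` all whose minors are zero or in `G`. -/
def Liftable (G : Subgroup Oˣ) (φ : O →+* R) (D : Matrix X Y R) : Prop :=
  ∃ A : Matrix X Y O, MinorsIn G A ∧ A.map φ = D

theorem Liftable.transpose {D : Matrix X Y R} (h : Liftable G φ D) : Liftable G φ Dᵀ := by
  obtain ⟨A, hA, rfl⟩ := h
  exact ⟨Aᵀ, hA.transpose, rfl⟩

namespace IsLifting

theorem liftable_of_pivot [Finite X] (L : IsLifting G φ ψ) {D : Matrix X Y R} {x : X} {y : Y}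
    (hu : IsUnit (D x y)) (h : Liftable G φ (pivot D x y)) : Liftable G φ D := by
  obtain ⟨A, hA, hAD⟩ := h
  have := ψ.domain_nontrivial
  have h1 : IsUnit (A x y) := by
    refine (hA.apply x y).isUnit fun h0 => ?_
    have := congrFun (congrFun hAD x) y
    rw [map_apply, h0, map_zero, pivot_self] at this
    exact hu.ringInverse.ne_zero this.symm
  exact ⟨pivot A x y, hA.pivot L.neg_one_mem x y h1, by rw [pivot_map φ _ _ _ h1, hAD,
    pivot_pivot _ _ _ hu]⟩

theorem exists_zeroOrMem (L : IsLifting G φ ψ) {r : R} (hr : ZeroOrMem (⊤ : Subgroup Rˣ) r) :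
    ∃ x : O, ZeroOrMem G x ∧ φ x = r := by
  rcases hr with rfl | ⟨r, -, rfl⟩
  · exact ⟨0, .zero, map_zero φ⟩
  · obtain ⟨g, hg, rfl⟩ := L.surj r
    exact ⟨g, .of_mem hg, rfl⟩

theorem liftable_of_row (L : IsLifting G φ ψ) {D : Matrix X Y R}
    (hD : MinorsIn (⊤ : Subgroup Rˣ) D) (w : X) (y : Y) (h0 : ∀ j, j ≠ y → D w j = 0)
    (h : Liftable G φ (D.submatrix (Subtype.val : ({w}ᶜ : Set X) → X) id)) : Liftable G φ D := by
  classical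
  obtain ⟨A, hA, hAD⟩ := h
  obtain ⟨a, ha, ha'⟩ := L.exists_zeroOrMem (hD.apply w y)
  refine ⟨Matrix.of fun i j => if h : i ∈ ({w}ᶜ : Set X) then A ⟨i, h⟩ j else if j = y then a else 0,
    MinorsIn.of_row L.neg_one_mem w y (by intro j hj; simp [hj]) (by simpa using ha) ?_, ?_⟩
  · convert hA using 1
    ext i j
    have := i.2
    simp only [submatrix_apply, of_apply, id, dif_pos this]
  · ext i j
    by_cases hi : i ∈ ({w}ᶜ : Set X)
    · have := congrFun (congrFun hAD ⟨i, hi⟩) j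
      rw [map_apply, of_apply, dif_pos hi]; exact this
    · obtain rfl : i = w := by simpa using hi
      by_cases hj : j = y
      · subst hj; simp [ha']
      · simp [hj, h0 j hj]

theorem liftable_of_blocks (L : IsLifting G φ ψ) {D : Matrix X Y R} (S : Set X) (B : Set Y)
    (h0 : ∀ x y, D x y ≠ 0 → (x ∈ S ↔ y ∈ B))
    (h1 : Liftable G φ (D.submatrix (Subtype.val : S → X) (Subtype.val : B → Y)))
    (h2 : Liftable G φ (D.submatrix (Subtype.val : (Sᶜ : Set X) → X)
      (Subtype.val : (Bᶜ : Set Y) → Y))) : Liftable G φ D := by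
  classical
  obtain ⟨A, hA, hAD⟩ := h1
  obtain ⟨A', hA', hAD'⟩ := h2
  let C : Matrix X Y O := Matrix.of fun x y => if hx : x ∈ S then (if hy : y ∈ B then A ⟨x, hx⟩ ⟨y, hy⟩ else 0)
    else (if hy : y ∈ B then 0 else A' ⟨x, hx⟩ ⟨y, hy⟩)
  have e1 : C.submatrix (Subtype.val : S → X) (Subtype.val : B → Y) = A := by
    ext x y
    simp [C]
  have e2 : C.submatrix (Subtype.val : (Sᶜ : Set X) → X) (Subtype.val : (Bᶜ : Set Y) → Y) = A' := by
    ext x y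
    have h1 := x.2
    have h2 := y.2
    rw [Set.mem_compl_iff] at h1 h2
    simp [C, h1, h2]
  refine ⟨C, MinorsIn.of_blocks L.neg_one_mem S B ?_ (by rwa [e1]) (by rwa [e2]), ?_⟩
  · intro x y h
    simp only [C, of_apply] at h
    by_cases hx : x ∈ S <;> by_cases hy : y ∈ B <;> simp_all
  · ext x y
    by_cases hx : x ∈ S <;> by_cases hy : y ∈ B
    · have := congrFun (congrFun hAD ⟨x, hx⟩) ⟨y, hy⟩
      simpa [C, hx, hy] using this
    · have : D x y = 0 := by by_contra h; exact hy ((h0 x y h).1 hx)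
      simp [C, hx, hy, this]
    · have : D x y = 0 := by by_contra h; exact hx ((h0 x y h).2 hy)
      simp [C, hx, hy, this]
    · have := congrFun (congrFun hAD' ⟨x, hx⟩) ⟨y, hy⟩
      simpa [C, hx, hy] using this

/-- The two partial lifts agree on the common columns after scaling by elements of the kernel of
`φ`, which does not change the image. They then combine into one matrix, and
`minorsIn_of_two_columns` controls the new minors. -/
theorem liftable_of_two_columns [Finite X] [Finite Y] (L : IsLifting G φ ψ) {D : Matrix X Y R}
    (hD : MinorsIn (⊤ : Subgroup Rˣ) D) {u v : Y} (huv : u ≠ v) (hc : IsConnectedOn D {u, v}ᶜ)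
    (h1 : Liftable G φ (D.submatrix id (Subtype.val : ({u}ᶜ : Set Y) → Y)))
    (h2 : Liftable G φ (D.submatrix id (Subtype.val : ({v}ᶜ : Set Y) → Y))) : Liftable G φ D := by
  classical
  have ext : ∀ u, Liftable G φ (D.submatrix id (Subtype.val : ({u}ᶜ : Set Y) → Y)) →
      ∃ A : Matrix X Y O, MinorsOn G A {u}ᶜ ∧ ∀ x, ∀ y ∈ ({u}ᶜ : Set Y), φ (A x y) = D x y := by
    rintro u ⟨A, hA, hAD⟩
    refine ⟨Matrix.of fun x y => if h : y ∈ ({u}ᶜ : Set Y) then A x ⟨y, h⟩ else 0, ?_, ?_⟩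
    · rw [minorsOn_iff]
      convert hA using 1
      ext x y
      have := y.2
      simp only [submatrix_apply, of_apply, id, dif_pos this]
    · intro x y hy
      have := congrFun (congrFun hAD x) ⟨y, hy⟩
      rw [of_apply, dif_pos hy]; exact this
  obtain ⟨A₁, hA₁, hD₁⟩ := ext u h1
  obtain ⟨A₂, hA₂, hD₂⟩ := ext v h2
  have hTu : ({u, v}ᶜ : Set Y) ⊆ {u}ᶜ := Set.compl_subset_compl.2 (by simp)
  have hTv : ({u, v}ᶜ : Set Y) ⊆ {v}ᶜ := Set.compl_subset_compl.2 (by simp)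
  obtain ⟨s, t, hs, ht, hst⟩ := L.exists_scaling A₁ A₂ (hA₁.mono hTu) (hA₂.mono hTv)
    (fun x y hy => by rw [hD₁ x y (hTu hy), hD₂ x y (hTv hy)])
    (hc.congr fun x y hy h h0 => h (by rw [← hD₁ x y (hTu hy), h0, map_zero]))
  -- `A₁` lacks only column `u`, which is taken from the rescaled `A₂`.
  let A : Matrix X Y O := Matrix.of fun x y => if y = u then s x * A₂ x y * t y else A₁ x y
  have hAu : MinorsOn G A {u}ᶜ := hA₁.congr fun x y hy => by
    simp only [A, of_apply, if_neg (show ¬ y = u from hy)]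
  have hAv : MinorsOn G A {v}ᶜ :=
    (hA₂.scale s t (fun x => (hs x).1) (fun y => (ht y).1)).congr fun x y hy => by
      by_cases hyu : y = u
      · simp [A, hyu]
      · simp only [A, if_neg hyu, of_apply]
        exact (hst x y (by simpa [hyu] using hy)).symm
  have hAD : A.map φ = D := by
    ext x y
    by_cases hyu : y = u
    · have e1 : φ (s x) = 1 := congrArg Units.val (hs x).2
      have e2 : φ (t y) = 1 := congrArg Units.val (ht y).2
      subst hyu
      simp [A, e1, e2, hD₂ x y huv]
    · simp only [map_apply, A, of_apply, if_neg hyu]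
      exact hD₁ x y hyu
  refine ⟨A, L.minorsIn_of_two_columns huv A hAu hAv (by rwa [hAD]) ?_, hAD⟩
  refine hc.congr fun x y _ h h0 => h ?_
  rw [← hAD, map_apply, h0, map_zero]

theorem exists_fundamental (L : IsLifting G φ ψ) {r : Rˣ} (hr : IsFundamental ⊤ r) :
    ∃ f, IsFundamental G f ∧ imageUnit φ f = r := by
  rcases zeroOrMem_top_iff.1 hr.2 with h | h
  · refine ⟨1, .one, ?_⟩
    ext
    rw [map_one, Units.val_one]
    linear_combination h
  · obtain ⟨g, hg, ⟨k, hk, hkg⟩, h'⟩ := L.lift r r.isUnit h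
    exact ⟨g, ⟨hg, Or.inr ⟨k, hk, hkg⟩⟩, Units.ext h'⟩

/-- Three entries are lifted arbitrarily to `G`. The fourth is then fixed by requiring the cross
ratio to be the fundamental lift of the given one. -/
theorem liftable_two_by_two (L : IsLifting G φ ψ) {D : Matrix X Y R}
    (hD : MinorsIn (⊤ : Subgroup Rˣ) D) {p q : X} {u v : Y} (hpq : p ≠ q) (huv : u ≠ v)
    (hX : ∀ x, x = p ∨ x = q) (hY : ∀ y, y = u ∨ y = v)
    (hpu : D p u ≠ 0) (hpv : D p v ≠ 0) (hqu : D q u ≠ 0) (hqv : D q v ≠ 0) :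
    Liftable G φ D := by
  classical
  obtain ⟨a, -, ha⟩ := (hD.apply p u).exists_of_ne hpu
  obtain ⟨b, -, hb⟩ := (hD.apply p v).exists_of_ne hpv
  obtain ⟨c, -, hc⟩ := (hD.apply q u).exists_of_ne hqu
  obtain ⟨d, -, hd⟩ := (hD.apply q v).exists_of_ne hqv
  have hm := (hD.minorsOn Set.univ).two p q (u := u) (v := v) trivial trivial
  rw [← ha, ← hb, ← hc, ← hd, ← isFundamental_cross_iff (G := (⊤ : Subgroup Rˣ)) trivial trivial trivial trivial] at hm
  obtain ⟨f, hf, hf'⟩ := L.exists_fundamental hm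
  obtain ⟨b', hb', rfl⟩ := L.surj b
  obtain ⟨c', hc', rfl⟩ := L.surj c
  obtain ⟨d', hd', rfl⟩ := L.surj d
  have haG : b' * c' * f⁻¹ * d'⁻¹ ∈ G := G.mul_mem (G.mul_mem (G.mul_mem hb' hc')
    (G.inv_mem hf.1)) (G.inv_mem hd')
  have ea : imageUnit φ (b' * c' * f⁻¹ * d'⁻¹) = a := by
    simp only [map_mul, map_inv, hf', _root_.mul_inv_rev, inv_inv]
    rw [show ∀ b c d : Rˣ, b * c * (d * (a * (c⁻¹ * b⁻¹))) * d⁻¹ =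
      a * (b * b⁻¹) * (c * c⁻¹) * (d * d⁻¹) from fun b c d => by ac_rfl]
    simp
  have key : ZeroOrMem G (((b' * c' * f⁻¹ * d'⁻¹ : Oˣ) : O) * d' - b' * c') := by
    rw [← isFundamental_cross_iff haG hb' hc' hd']
    convert hf using 1
    simp only [_root_.mul_inv_rev, inv_inv]
    rw [show b' * c' * (d' * (f * (c'⁻¹ * b'⁻¹))) * d'⁻¹ =
      f * (b' * b'⁻¹) * (c' * c'⁻¹) * (d' * d'⁻¹) by ac_rfl]
    simp
  generalize b' * c' * f⁻¹ * d'⁻¹ = a' at haG ea key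
  subst ea
  let A : Matrix X Y O := Matrix.of fun x y => if x = p then (if y = u then a' else b')
    else (if y = u then c' else d')
  have eA : A p u = a' ∧ A p v = b' ∧ A q u = c' ∧ A q v = d' := by
    simp [A, huv.symm, hpq.symm]
  have hAG : ∀ x y, ZeroOrMem G (A x y) := by
    intro x y
    simp only [A, of_apply]
    split_ifs
    exacts [.of_mem haG, .of_mem hb', .of_mem hc', .of_mem hd']
  refine ⟨A, ?_, ?_⟩
  · intro k f g
    by_cases hf : Function.Injective f
    swap
    · rw [det_submatrix_eq_zero_of_not_injective_left _ _ hf]; exact .zero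
    by_cases hg : Function.Injective g
    swap
    · rw [det_submatrix_eq_zero_of_not_injective_right _ _ hg]; exact .zero
    have hk : k ≤ 2 := by
      have hinj : Function.Injective fun i => decide (f i = p) := by
        intro i j hij
        apply hf
        have h1 := hX (f i)
        have h2 := hX (f j)
        have h3 : f i = p ↔ f j = p := by simpa using hij
        by_cases h : f i = p
        · rw [h, h3.1 h]
        · rw [h1.resolve_left h, h2.resolve_left (mt h3.2 h)]
      simpa using Fintype.card_le_of_injective _ hinj
    match k, hk, f, g with
    | 0, _, f, g => rw [det_isEmpty]; exact .one
    | 1, _, f, g => rw [det_unique]; exact hAG _ _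
    | 2, _, f, g =>
      have hf' : f 0 ≠ f 1 := hf.ne (by simp)
      have hg' : g 0 ≠ g 1 := hg.ne (by simp)
      have hswap : ZeroOrMem G (b' * c' - a' * d' : O) := by
        rw [ZeroOrMem.sub_comm_iff L.neg_one_mem]; exact key
      rw [det_fin_two]
      simp only [submatrix_apply]
      rcases hX (f 0) with h1 | h1 <;> rcases hX (f 1) with h2 | h2 <;>
        rcases hY (g 0) with h3 | h3 <;> rcases hY (g 1) with h4 | h4 <;>
        first
          | exact absurd (h1.trans h2.symm) hf'
          | exact absurd (h3.trans h4.symm) hg'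
          | rw [h1, h2, h3, h4, eA.1, eA.2.1, eA.2.2.1, eA.2.2.2]
      · exact key
      · exact hswap
      · rw [mul_comm (c' : O), mul_comm (d' : O)]; exact hswap
      · rw [mul_comm (c' : O), mul_comm (d' : O)]; exact key
  · ext x y
    rcases hX x with rfl | rfl <;> rcases hY y with rfl | rfl
    · rw [map_apply, eA.1, ← ha]; rfl
    · rw [map_apply, eA.2.1, ← hb]; rfl
    · rw [map_apply, eA.2.2.1, ← hc]; rfl
    · rw [map_apply, eA.2.2.2, ← hd]; rfl

/-- Of the three vertices provided by `exists_three_leaves`, two are on the same side of the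
bipartition. Two rows are handled by transposing. -/
theorem liftable_of_three_neighbours [Finite X] [Finite Y] (L : IsLifting G φ ψ)
    {D : Matrix X Y R} (hD : MinorsIn (⊤ : Subgroup Rˣ) D) (hc : IsConnectedOn D Set.univ)
    (hrow : ∀ u, Liftable G φ (D.submatrix id (Subtype.val : ({u}ᶜ : Set Y) → Y)))
    (hcol : ∀ u, Liftable G φ (D.submatrix (Subtype.val : ({u}ᶜ : Set X) → X) id))
    {c a₁ a₂ a₃ : X ⊕ Y} (h₁ : matrixAdj D c a₁) (h₂ : matrixAdj D c a₂) (h₃ : matrixAdj D c a₃)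
    (h₁₂ : a₁ ≠ a₂) (h₁₃ : a₁ ≠ a₃) (h₂₃ : a₂ ≠ a₃) : Liftable G φ D := by
  have irr : ∀ a, ¬ matrixAdj D a a := by rintro (x | y) <;> exact id
  have hne : ∀ {a}, matrixAdj D c a → a ∉ ({c} : Set (X ⊕ Y)) := by
    rintro a h rfl
    exact irr _ h
  obtain ⟨m₁, m₂, m₃, h₁₂, h₁₃, h₂₃, c₁₂, c₁₃, c₂₃⟩ := exists_three_leaves matrixAdj_symm
    hc.isConnectedSet _ {c} rfl (.singleton c) (hne h₁) (hne h₂) (hne h₃) h₁₂ h₁₃ h₂₃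
    ⟨c, rfl, h₁⟩ ⟨c, rfl, h₂⟩ ⟨c, rfl, h₃⟩
  have cols : ∀ {u v : Y}, (Sum.inr u : X ⊕ Y) ≠ Sum.inr v →
      IsConnectedSet (matrixAdj D) {Sum.inr u, Sum.inr v}ᶜ → Liftable G φ D := fun huv h =>
    L.liftable_of_two_columns hD (fun e => huv (by rw [e])) h.isConnectedOn (hrow _) (hrow _)
  have rows : ∀ {u v : X}, (Sum.inl u : X ⊕ Y) ≠ Sum.inl v →
      IsConnectedSet (matrixAdj D) {Sum.inl u, Sum.inl v}ᶜ → Liftable G φ D := by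
    intro u v huv h
    exact (L.liftable_of_two_columns hD.transpose (fun e => huv (by rw [e]))
      h.isConnectedOn_transpose (hcol u).transpose (hcol v).transpose).transpose
  rcases m₁ with x₁ | y₁ <;> rcases m₂ with x₂ | y₂ <;> rcases m₃ with x₃ | y₃
  · exact rows h₁₂ c₁₂
  · exact rows h₁₂ c₁₂
  · exact rows h₁₃ c₁₃
  · exact cols h₂₃ c₂₃
  · exact rows h₂₃ c₂₃
  · exact cols h₁₃ c₁₃
  · exact cols h₁₂ c₁₂
  · exact cols h₁₂ c₁₂

end IsLifting

end Liftable

end PartialField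

namespace PartialField

open Matrix

/-! ### The lift theorem. -/

namespace IsLifting

variable {O R F : Type*} [CommRing O] [CommRing R] [Field F] {G : Subgroup Oˣ}
  {φ : O →+* R} {ψ : R →+* F}

theorem liftable_of_card (L : IsLifting G φ ψ) (n : ℕ) :
    ∀ {X Y : Type*} [Finite X] [Finite Y], Nat.card X + Nat.card Y = n → ∀ {D : Matrix X Y R},
      MinorsIn (⊤ : Subgroup Rˣ) D → Liftable G φ D := by
  induction n using Nat.strong_induction_on with
  | _ n ih =>
  intro X Y _ _ hn D hD
  have hψ := ψ.domain_nontrivial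
  cases isEmpty_or_nonempty X with
  | inl h => exact ⟨Matrix.of fun x => isEmptyElim x, .of_isEmpty, Subsingleton.elim _ _⟩
  | inr hX =>
  cases isEmpty_or_nonempty Y with
  | inl h =>
    exact Liftable.transpose (D := Dᵀ)
      ⟨Matrix.of fun x => isEmptyElim x, .of_isEmpty, Subsingleton.elim _ _⟩
  | inr hY =>
  have sub : ∀ {D : Matrix X Y R}, MinorsIn (⊤ : Subgroup Rˣ) D → ∀ (S : Set X) (B : Set Y),
      S ≠ Set.univ ∨ B ≠ Set.univ →
      Liftable G φ (D.submatrix (Subtype.val : S → X) (Subtype.val : B → Y)) := by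
    intro D hD S B h
    refine ih (Nat.card S + Nat.card B) ?_ rfl (hD.submatrix _ _)
    have h1 : Nat.card S ≤ Nat.card X := Finite.card_subtype_le _
    have h2 : Nat.card B ≤ Nat.card Y := Finite.card_subtype_le _
    rw [Set.ne_univ_iff_exists_notMem, Set.ne_univ_iff_exists_notMem] at h
    rcases h with ⟨x, hx⟩ | ⟨y, hy⟩
    · have : Nat.card S < Nat.card X := Finite.card_subtype_lt hx
      omega
    · have : Nat.card B < Nat.card Y := Finite.card_subtype_lt hy
      omega
  have subCol : ∀ {D : Matrix X Y R}, MinorsIn (⊤ : Subgroup Rˣ) D → ∀ u,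
      Liftable G φ (D.submatrix id (Subtype.val : ({u}ᶜ : Set Y) → Y)) := by
    intro D hD u
    refine ih (Nat.card X + Nat.card ({u}ᶜ : Set Y)) ?_ rfl (hD.submatrix _ _)
    have : Nat.card ({u}ᶜ : Set Y) < Nat.card Y := Finite.card_subtype_lt (x := u) (by simp)
    omega
  have subRow : ∀ {D : Matrix X Y R}, MinorsIn (⊤ : Subgroup Rˣ) D → ∀ u,
      Liftable G φ (D.submatrix (Subtype.val : ({u}ᶜ : Set X) → X) id) := by
    intro D hD u
    refine ih (Nat.card ({u}ᶜ : Set X) + Nat.card Y) ?_ rfl (hD.submatrix _ _)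
    have : Nat.card ({u}ᶜ : Set X) < Nat.card X := Finite.card_subtype_lt (x := u) (by simp)
    omega
  by_cases hc : IsConnectedOn D Set.univ
  swap
  · simp only [IsConnectedOn, not_forall] at hc
    obtain ⟨S, B, -, hne, hcl, hSB⟩ := hc
    refine L.liftable_of_blocks S B (fun x y => hcl x y trivial) (sub hD S B ?_)
      (sub hD Sᶜ Bᶜ ?_)
    · tauto
    · simp only [ne_eq, Set.compl_univ_iff, ← Set.nonempty_iff_ne_empty]
      exact hne
  have unit : ∀ x y, D x y ≠ 0 → IsUnit (D x y) := fun x y => (hD.apply x y).isUnit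
  by_cases hr : ∀ w y, ∃ j, j ≠ y ∧ D w j ≠ 0
  swap
  · push Not at hr
    obtain ⟨w, y, h⟩ := hr
    exact L.liftable_of_row hD w y h (subRow hD w)
  by_cases hl : ∀ w x, ∃ i, i ≠ x ∧ D i w ≠ 0
  swap
  · push Not at hl
    obtain ⟨w, x, h⟩ := hl
    exact (L.liftable_of_row hD.transpose w x h (subCol hD w).transpose).transpose
  by_cases h3 : ∀ c a₁ a₂ a₃, matrixAdj D c a₁ → matrixAdj D c a₂ → matrixAdj D c a₃ →
      a₁ ≠ a₂ → a₁ ≠ a₃ → a₂ = a₃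
  swap
  · push Not at h3
    obtain ⟨c, a₁, a₂, a₃, h₁, h₂, h₃, h₁₂, h₁₃, h₂₃⟩ := h3
    exact L.liftable_of_three_neighbours hD hc (subCol hD) (subRow hD) h₁ h₂ h₃ h₁₂ h₁₃ h₂₃
  have row3 : ∀ {x y₁ y₂ y}, D x y₁ ≠ 0 → D x y₂ ≠ 0 → y₁ ≠ y₂ → D x y ≠ 0 → y = y₁ ∨ y = y₂ := by
    intro x y₁ y₂ y h₁ h₂ hne h
    by_contra! hy
    exact hy.2 (Sum.inr_injective (h3 (Sum.inl x) (Sum.inr y₁) (Sum.inr y) (Sum.inr y₂) h₁ h h₂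
      (fun e => hy.1 (Sum.inr_injective e).symm) (fun e => hne (Sum.inr_injective e))))
  have col3 : ∀ {y x₁ x₂ x}, D x₁ y ≠ 0 → D x₂ y ≠ 0 → x₁ ≠ x₂ → D x y ≠ 0 → x = x₁ ∨ x = x₂ := by
    intro y x₁ x₂ x h₁ h₂ hne h
    by_contra! hx
    exact hx.2 (Sum.inl_injective (h3 (Sum.inr y) (Sum.inl x₁) (Sum.inl x) (Sum.inl x₂) h₁ h h₂
      (fun e => hx.1 (Sum.inl_injective e).symm) (fun e => hne (Sum.inl_injective e))))
  -- All degrees are now exactly two and the graph is connected, so it is a cycle. The consecutive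
  -- vertices `y₂`, `x`, `y₁`, `x₀`, `y₀` are named.
  obtain ⟨x⟩ := hX
  obtain ⟨y⟩ := hY
  obtain ⟨y₁, -, h₁⟩ := hr x y
  obtain ⟨y₂, hy₂, h₂⟩ := hr x y₁
  obtain ⟨x₀, hx₀, h₀₁⟩ := hl y₁ x
  obtain ⟨y₀, hy₀, h₀₀⟩ := hr x₀ y₁
  by_cases h : y₀ = y₂
  · subst h
    obtain ⟨hS, hB⟩ := hc {x, x₀} {y₁, y₀} (Set.subset_univ _) (Or.inl ⟨x, by simp⟩) (by
      intro p q _ hpq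
      constructor
      · rintro (rfl | rfl)
        exacts [row3 h₁ h₂ hy₂.symm hpq, row3 h₀₁ h₀₀ hy₂.symm hpq]
      · rintro (rfl | rfl)
        exacts [col3 h₁ h₀₁ hx₀.symm hpq, col3 h₂ h₀₀ hx₀.symm hpq])
    exact L.liftable_two_by_two hD hx₀.symm hy₂.symm (fun p => (hS ▸ Set.mem_univ p :))
      (fun p => (hB ▸ Set.mem_univ p :)) h₁ h₂ h₀₁ h₀₀
  -- The cycle is longer than four. Pivoting on `x`, `y₁` keeps the edges from `x₀` to `y₁` and `y₀`
  -- and adds one to `y₂`, so `x₀` gets three neighbours.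
  · have z1 : D x₀ y₂ = 0 := by
      by_contra hz
      rcases row3 h₀₁ h₀₀ hy₀.symm hz with e | e
      exacts [hy₂ e, h e.symm]
    have z2 : D x y₀ = 0 := by
      by_contra hz
      rcases row3 h₁ h₂ hy₂.symm hz with e | e
      exacts [hy₀ e, h e]
    have u₁ := unit x y₁ h₁
    have hP := hD.pivot (G := ⊤) trivial x y₁ u₁
    refine L.liftable_of_pivot u₁ (L.liftable_of_three_neighbours hP (hc.pivot trivial u₁)
      (subCol hP) (subRow hP) (c := Sum.inl x₀) (a₁ := Sum.inr y₁) (a₂ := Sum.inr y₂)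
      (a₃ := Sum.inr y₀) ?_ ?_ ?_ ?_ ?_ ?_)
    · change pivot D x y₁ x₀ y₁ ≠ 0
      rw [pivot_col _ _ hx₀]
      exact (((unit _ _ h₀₁).mul u₁.ringInverse).neg).ne_zero
    · change pivot D x y₁ x₀ y₂ ≠ 0
      rw [pivot_of_ne _ hx₀ hy₂, z1, zero_sub]
      exact ((((unit _ _ h₀₁).mul u₁.ringInverse).mul (unit _ _ h₂)).neg).ne_zero
    · change pivot D x y₁ x₀ y₀ ≠ 0
      rw [pivot_of_ne _ hx₀ hy₀, z2, mul_zero, sub_zero]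
      exact h₀₀
    · exact fun e => hy₂ (Sum.inr_injective e).symm
    · exact fun e => hy₀ (Sum.inr_injective e).symm
    · exact fun e => h (Sum.inr_injective e).symm

/-- The lift theorem: a matrix whose minors are zero or units is the image of a matrix whose minors
are zero or in `G`. -/
theorem liftable (L : IsLifting G φ ψ) {X Y : Type*} [Finite X] [Finite Y] {D : Matrix X Y R}
    (hD : MinorsIn (⊤ : Subgroup Rˣ) D) : Liftable G φ D :=
  L.liftable_of_card _ rfl hD

theorem ringRepresentable {α : Type*} {M : Matroid α} [M.Finite] (L : IsLifting G φ ψ)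
    (h : RingRepresentable (⊤ : Subgroup Rˣ) M) : RingRepresentable G M := by
  obtain ⟨r, D, hD, hM⟩ := h
  have : Finite M.E := M.ground_finite
  obtain ⟨A, hA, rfl⟩ := L.liftable hD
  refine ⟨r, A, hA, fun B => (hM B).trans (exists_congr fun f => and_congr_right fun _ => ?_)⟩
  rw [submatrix_map, ← RingHom.mapMatrix_apply, ← RingHom.map_det, ne_eq,
    L.map_eq_zero_iff (hA r id f)]

end IsLifting

end PartialField

namespace PartialField

open Polynomial

/-- The ring `ℤ[α, 1/α, 1/(1-α)]`. -/
abbrev NearRegularRing : Type := Localization.Away (X * (1 - X) : ℤ[X])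

/-! ### The ring `ℤ[α, 1/α, 1/(1-α)]` and the fundamental elements of its group. -/

namespace NearRegularRing

section Eval

variable {R : Type*} [CommRing R] (a : R) (ha : IsUnit a) (hb : IsUnit (1 - a))

/-- The ring homomorphism that maps the indeterminate to `a`. -/
noncomputable def eval : NearRegularRing →+* R :=
  IsLocalization.Away.lift (X * (1 - X) : ℤ[X]) (g := eval₂RingHom (Int.castRingHom R) a)
    (by simpa using ⟨ha, hb⟩)

theorem eval_algebraMap (p : ℤ[X]) :
    eval a ha hb (algebraMap _ _ p) = eval₂RingHom (Int.castRingHom R) a p :=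
  IsLocalization.Away.lift_eq _ _ _

end Eval

theorem isUnit_algebraMap : IsUnit (algebraMap ℤ[X] NearRegularRing X) ∧
    IsUnit (algebraMap ℤ[X] NearRegularRing (1 - X)) := by
  rw [← IsUnit.mul_iff, ← map_mul]
  exact IsLocalization.Away.algebraMap_isUnit _

/-- The indeterminate. -/
noncomputable def alpha : NearRegularRingˣ := isUnit_algebraMap.1.unit

/-- One minus the indeterminate. -/
noncomputable def beta : NearRegularRingˣ := isUnit_algebraMap.2.unit

theorem alpha_add_beta : (alpha : NearRegularRing) + beta = 1 := by
  change algebraMap ℤ[X] NearRegularRing X + algebraMap ℤ[X] NearRegularRing (1 - X) = 1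
  rw [← map_add, add_sub_cancel, map_one]

/-- The group generated by `α`, `1 - α` and `-1`. -/
noncomputable def group : Subgroup NearRegularRingˣ := Subgroup.closure {alpha, beta, -1}

theorem alpha_mem : alpha ∈ group := Subgroup.subset_closure (by simp)
theorem beta_mem : beta ∈ group := Subgroup.subset_closure (by simp)
theorem neg_one_mem : -1 ∈ group := Subgroup.subset_closure (by simp)

theorem neg_mem {g : NearRegularRingˣ} (h : g ∈ group) : -g ∈ group := by
  simpa using group.mul_mem neg_one_mem h

section Eval

variable {R : Type*} [CommRing R] (a : R) (ha : IsUnit a) (hb : IsUnit (1 - a))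

theorem eval_alpha : eval a ha hb alpha = a := by
  change eval a ha hb (algebraMap _ _ X) = a
  rw [eval_algebraMap]
  simp

theorem eval_beta : eval a ha hb beta = 1 - a := by
  have h := congrArg (eval a ha hb) alpha_add_beta
  rw [map_add, map_one, eval_alpha] at h
  exact eq_sub_of_add_eq' h

end Eval

theorem mem_group {g : NearRegularRingˣ} (h : g ∈ group) : ∃ (s : ℤˣ) (m n : ℤ),
    (g = alpha ^ m * beta ^ n ∧ s = 1) ∨ (g = -(alpha ^ m * beta ^ n) ∧ s = -1) := by
  suffices ∃ m n : ℤ, g = alpha ^ m * beta ^ n ∨ g = -(alpha ^ m * beta ^ n) by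
    obtain ⟨m, n, h | h⟩ := this
    exacts [⟨1, m, n, Or.inl ⟨h, rfl⟩⟩, ⟨-1, m, n, Or.inr ⟨h, rfl⟩⟩]
  induction h using Subgroup.closure_induction with
  | mem x hx =>
    rcases hx with rfl | rfl | rfl
    exacts [⟨1, 0, by simp⟩, ⟨0, 1, by simp⟩, ⟨0, 0, by simp⟩]
  | one => exact ⟨0, 0, by simp⟩
  | mul x y _ _ hx hy =>
    obtain ⟨m, n, hx⟩ := hx
    obtain ⟨m', n', hy⟩ := hy
    refine ⟨m + m', n + n', ?_⟩
    have e : alpha ^ (m + m') * beta ^ (n + n') =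
        alpha ^ m * beta ^ n * (alpha ^ m' * beta ^ n') := by
      rw [zpow_add, zpow_add, mul_mul_mul_comm]
    rw [e]
    rcases hx with rfl | rfl <;> rcases hy with rfl | rfl <;> simp
  | inv x _ hx =>
    obtain ⟨m, n, hx⟩ := hx
    refine ⟨-m, -n, ?_⟩
    rw [zpow_neg, zpow_neg, ← mul_inv]
    rcases hx with rfl | rfl <;> simp

theorem pow_two_cases {a b c : ℕ} {s t : ℤˣ} (h0 : a = 0 ∨ b = 0 ∨ c = 0)
    (h : (s : ℤ) * 2 ^ a + (t : ℤ) * 2 ^ b = 2 ^ c) :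
    (a = c ∧ s = -1) ∨ (a = c + 1 ∧ s = 1) ∨ (a + 1 = c ∧ s = 1) := by
  have hs : (s = 1 ∧ (s : ℤ) = 1) ∨ (s = -1 ∧ (s : ℤ) = -1) := by
    rcases Int.units_eq_one_or s with rfl | rfl <;> simp
  have ht : (t : ℤ) = 1 ∨ (t : ℤ) = -1 := by
    rcases Int.units_eq_one_or t with rfl | rfl <;> simp
  -- Since one of the three powers is `1`, it suffices to know each power as `1`, `2` or a positive
  -- multiple of `4`; the rest is linear arithmetic.
  have two : ∀ n : ℕ, n = 0 ∧ (2 : ℤ) ^ n = 1 ∨ n = 1 ∧ (2 : ℤ) ^ n = 2 ∨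
      2 ≤ n ∧ ∃ k : ℤ, 0 < k ∧ (2 : ℤ) ^ n = 4 * k := by
    intro n
    match n with
    | 0 => simp
    | 1 => simp
    | n + 2 => exact Or.inr (Or.inr ⟨by omega, 2 ^ n, by positivity, by ring⟩)
  rcases hs with ⟨rfl, hs⟩ | ⟨rfl, hs⟩ <;> rw [hs] at h <;> rcases ht with ht | ht <;>
    rw [ht] at h <;> simp only [and_true, and_false, false_or, or_false,
      show ((1 : ℤˣ) = -1) = False by simp, show ((-1 : ℤˣ) = 1) = False by simp] <;>
    rcases two a with ⟨ha, ha'⟩ | ⟨ha, ha'⟩ | ⟨ha, k, hk, ha'⟩ <;>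
    rcases two b with ⟨hb, hb'⟩ | ⟨hb, hb'⟩ | ⟨hb, l, hl, hb'⟩ <;>
    rcases two c with ⟨hc, hc'⟩ | ⟨hc, hc'⟩ | ⟨hc, m, hm, hc'⟩ <;>
    rw [ha', hb', hc'] at h <;> omega

theorem zpow_two_cases {n k : ℤ} {s t : ℤˣ}
    (h : ((s : ℤ) : ℚ) * 2 ^ n + ((t : ℤ) : ℚ) * 2 ^ k = 1) :
    (n = 0 ∧ s = -1) ∨ (n = 1 ∧ s = 1) ∨ (n = -1 ∧ s = 1) := by
  -- Multiplying by the least sufficient power of `2` clears denominators and makes one of the three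
  -- exponents zero.
  obtain ⟨d, hd⟩ : ∃ d : ℤ, d = max 0 (max (-n) (-k)) := ⟨_, rfl⟩
  obtain ⟨a, ha⟩ := Int.eq_ofNat_of_zero_le (show 0 ≤ n + d by omega)
  obtain ⟨b, hb⟩ := Int.eq_ofNat_of_zero_le (show 0 ≤ k + d by omega)
  obtain ⟨c, hc⟩ := Int.eq_ofNat_of_zero_le (show 0 ≤ d by omega)
  have e1 : (2 : ℚ) ^ n * 2 ^ d = 2 ^ a := by rw [← zpow_add₀ two_ne_zero, ha, zpow_natCast]
  have e2 : (2 : ℚ) ^ k * 2 ^ d = 2 ^ b := by rw [← zpow_add₀ two_ne_zero, hb, zpow_natCast]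
  have e3 : (2 : ℚ) ^ d = 2 ^ c := by rw [hc, zpow_natCast]
  have h' : ((s : ℤ) : ℚ) * 2 ^ a + ((t : ℤ) : ℚ) * 2 ^ b = 2 ^ c := by
    linear_combination (2 : ℚ) ^ d * h - ((s : ℤ) : ℚ) * e1 - ((t : ℤ) : ℚ) * e2 + e3
  rcases pow_two_cases (a := a) (b := b) (c := c) (by omega)
    (by exact_mod_cast h') with ⟨h, hs⟩ | ⟨h, hs⟩ | ⟨h, hs⟩
  · exact Or.inl ⟨by omega, hs⟩
  · exact Or.inr (Or.inl ⟨by omega, hs⟩)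
  · exact Or.inr (Or.inr ⟨by omega, hs⟩)

/-- The only elements `f` of the group for which `1 - f` is in the group are the six associates
of `α`; the value `-1` is also allowed here. -/
theorem mem_associates {f h : NearRegularRingˣ} (hf : f ∈ group) (hh : h ∈ group)
    (hfh : (h : NearRegularRing) = 1 - f) : f ∈ ({alpha, beta, alpha⁻¹, beta⁻¹,
      -(alpha * beta⁻¹), -(beta * alpha⁻¹), -1} : Set NearRegularRingˣ) := by
  obtain ⟨s, m, n, hf⟩ := mem_group hf
  obtain ⟨t, k, l, hh⟩ := mem_group hh
  have val : ∀ (c : ℚ) (hc : c ≠ 0) (hc' : 1 - c ≠ 0),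
      ((s : ℤ) : ℚ) * (c ^ m * (1 - c) ^ n) + ((t : ℤ) : ℚ) * (c ^ k * (1 - c) ^ l) = 1 := by
    intro c hc hc'
    have e : ∀ {s : ℤˣ} {m n : ℤ} {g : NearRegularRingˣ},
        (g = alpha ^ m * beta ^ n ∧ s = 1) ∨ (g = -(alpha ^ m * beta ^ n) ∧ s = -1) →
        eval c hc.isUnit hc'.isUnit g = ((s : ℤ) : ℚ) * (c ^ m * (1 - c) ^ n) := by
      intro s m n g hg
      have ea : Units.map (eval c hc.isUnit hc'.isUnit).toMonoidHom alpha = Units.mk0 c hc :=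
        Units.ext (eval_alpha c _ _)
      have eb : Units.map (eval c hc.isUnit hc'.isUnit).toMonoidHom beta = Units.mk0 (1 - c) hc' :=
        Units.ext (eval_beta c _ _)
      have key : eval c hc.isUnit hc'.isUnit ((alpha ^ m * beta ^ n : NearRegularRingˣ)) =
          c ^ m * (1 - c) ^ n := by
        change ((Units.map (eval c hc.isUnit hc'.isUnit).toMonoidHom (alpha ^ m * beta ^ n) : ℚˣ) :
          ℚ) = _
        rw [map_mul, map_zpow, map_zpow, ea, eb]
        simp
      rcases hg with ⟨rfl, rfl⟩ | ⟨rfl, rfl⟩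
      · rw [key]; simp
      · rw [Units.val_neg, map_neg, key]; simp
    rw [← e hf, ← e hh, hfh, ← map_add, add_sub_cancel, map_one]
  have sgn : ∀ (s : ℤˣ) (m : ℤ), ((s : ℤ) : ℚ) * (-1) ^ m = (((s * (-1) ^ m : ℤˣ) : ℤ) : ℚ) := by
    intro s m
    rcases Int.even_or_odd m with h | h <;> simp [h.neg_one_zpow]
  -- At `α = -1, 2, 1/2` both `α` and `1 - α` are powers of `2` up to sign. The three resulting
  -- equations restrict `n`, `m` and `-(m + n)` to `-1, 0, 1` and tie their values to the signs.
  have h1 := val (-1) (by norm_num) (by norm_num)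
  have h2 := val 2 (by norm_num) (by norm_num)
  have h3 := val (2⁻¹) (by norm_num) (by norm_num)
  rw [show (1 - -1 : ℚ) = 2 by norm_num, ← mul_assoc, ← mul_assoc, sgn, sgn] at h1
  rw [show (1 - 2 : ℚ) = -1 by norm_num, mul_comm (2 ^ m : ℚ), mul_comm (2 ^ k : ℚ), ← mul_assoc,
    ← mul_assoc, sgn, sgn] at h2
  rw [show (1 - 2⁻¹ : ℚ) = 2⁻¹ by norm_num, ← zpow_add₀ (by norm_num), ← zpow_add₀ (by norm_num),
    inv_zpow', inv_zpow'] at h3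
  have c1 := zpow_two_cases h1
  have c2 := zpow_two_cases h2
  have c3 := zpow_two_cases h3
  simp only [Set.mem_insert_iff, Set.mem_singleton_iff]
  rcases c1 with ⟨rfl, c1⟩ | ⟨rfl, c1⟩ | ⟨rfl, c1⟩ <;>
    rcases c2 with ⟨rfl, c2⟩ | ⟨rfl, c2⟩ | ⟨rfl, c2⟩ <;>
    rcases c3 with ⟨c0, c3⟩ | ⟨c0, c3⟩ | ⟨c0, c3⟩ <;>
    first
    | omega
    | subst c3
      rcases hf with ⟨rfl, h⟩ | ⟨rfl, h⟩ <;>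
        first | exact absurd h (by decide) | simp [mul_comm]

end NearRegularRing

end PartialField

namespace PartialField

namespace NearRegularRing

/-! ### Exceptional units as associates, and a criterion for lifting. -/

section Associates

variable {R : Type*} [CommRing R]

/-- The six associates of an element `p` of a ring, in terms of `p` and `q = 1 - p`. -/
def associates (p q : Rˣ) : List Rˣ := [p, q, p⁻¹, q⁻¹, -(p * q⁻¹), -(q * p⁻¹)]

/-- A coincidence between two of the six elements either makes `2` a unit or gives `p ^ 2 - p + 1 =
0`, that is `p * q = 1`. -/
theorem associates_pairwise {p q : Rˣ} (h : (p : R) + q = 1) (h2 : ¬ IsUnit (2 : R))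
    (hpq : (p : R) * q ≠ 1) : (associates p q).Nodup := by
  have unit : ∀ {x : R} {u : Rˣ}, (2 : R) * x = u → False := fun {x u} hx =>
    h2 (isUnit_of_mul_isUnit_left (hx ▸ u.isUnit))
  obtain ⟨p, P, hp, hp'⟩ := p
  obtain ⟨q, Q, hq, hq'⟩ := q
  have h1 : p ≠ q := fun e => unit (x := p) (u := 1) (by simp; linear_combination h + e)
  have hp1 : p + 1 ≠ 0 := fun e => unit (x := 1) (u := ⟨q, Q, hq, hq'⟩) (by simp; linear_combination e - h)
  have hq1 : q + 1 ≠ 0 := fun e => unit (x := 1) (u := ⟨p, P, hp, hp'⟩) (by simp; linear_combination e - h)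
  clear unit
  simp only [associates, List.nodup_cons, List.mem_cons, List.not_mem_nil, Units.ext_iff, not_or,
    Units.inv_mk, Units.val_mul, Units.val_neg, or_false, not_false_eq_true, List.nodup_nil,
    and_true] at *
  refine ⟨⟨?_, ?_, ?_, ?_, ?_⟩, ⟨?_, ?_, ?_, ?_⟩, ⟨?_, ?_, ?_⟩, ⟨?_, ?_⟩, ?_⟩ <;> intro e <;> grind

theorem associates_one_sub {p q : Rˣ} (h : (p : R) + q = 1) {u : Rˣ} (hu : u ∈ associates p q) :
    ∃ v ∈ associates p q, (v : R) = 1 - u := by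
  have hp := p.mul_inv
  have hq := q.mul_inv
  simp only [associates, List.mem_cons, List.not_mem_nil, or_false] at hu
  rcases hu with rfl | rfl | rfl | rfl | rfl | rfl
  · exact ⟨q, by simp [associates], by linear_combination h⟩
  · exact ⟨p, by simp [associates], by linear_combination h⟩
  · exact ⟨-(q * p⁻¹), by simp [associates], by
      push_cast; linear_combination hp - (p⁻¹ : Rˣ) * h⟩
  · exact ⟨-(p * q⁻¹), by simp [associates], by
      push_cast; linear_combination hq - (q⁻¹ : Rˣ) * h⟩
  · exact ⟨q⁻¹, by simp [associates], by push_cast; linear_combination hq - (q⁻¹ : Rˣ) * h⟩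
  · exact ⟨p⁻¹, by simp [associates], by push_cast; linear_combination hp - (p⁻¹ : Rˣ) * h⟩

/-- The units `x` of `R` for which `1 - x` is a unit. -/
def exceptionalUnits (R : Type*) [CommRing R] : Set R := {x | IsUnit x ∧ IsUnit (1 - x)}

theorem exists_associate [Finite R] {p q : Rˣ} (h : (p : R) + q = 1) (h2 : ¬ IsUnit (2 : R))
    (hpq : (p : R) * q ≠ 1) (hcard : (exceptionalUnits R).ncard ≤ 6) {x : R}
    (hx : x ∈ exceptionalUnits R) : ∃ u ∈ associates p q, (u : R) = x := by
  classical
  have hsub : Units.val '' {u | u ∈ associates p q} ⊆ exceptionalUnits R := by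
    rintro _ ⟨u, hu, rfl⟩
    obtain ⟨v, -, hv⟩ := associates_one_sub h hu
    exact ⟨u.isUnit, hv ▸ v.isUnit⟩
  have hc : (Units.val '' {u | u ∈ associates p q}).ncard = 6 := by
    rw [Set.ncard_image_of_injective _ Units.val_injective, ← List.coe_toFinset,
      Set.ncard_coe_finset, List.toFinset_card_of_nodup (associates_pairwise h h2 hpq)]
    rfl
  rw [← Set.eq_of_subset_of_ncard_le hsub (by omega) (Set.toFinite _)] at hx
  exact hx

/-- With at most six exceptional units in `R`, the six distinct images of the associates of `α`
exhaust them. This gives existence and uniqueness of lifts, and `hunit` makes the map onto all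
units. -/
theorem isLifting_eval [Finite R] {F : Type*} [Field F] (ψ : R →+* F)
    (ternary : ∀ x : F, x = 0 ∨ x = 1 ∨ x = -1) (two_ne_zero : (2 : F) ≠ 0)
    (two : ¬ IsUnit (2 : R)) (a : R) (ha : IsUnit a) (hb : IsUnit (1 - a))
    (hab : a * (1 - a) ≠ 1) (hcard : (exceptionalUnits R).ncard ≤ 6)
    (hunit : ∀ u : Rˣ, ∃ s ∈ exceptionalUnits R, ∃ t ∈ exceptionalUnits R,
      (u : R) = s * t ∨ (u : R) = -(s * t)) :
    IsLifting group (eval a ha hb) ψ := by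
  set φ := eval a ha hb with hφ
  have hpq : ((imageUnit φ alpha : Rˣ) : R) + imageUnit φ beta = 1 := by
    change φ alpha + φ beta = 1
    rw [← map_add, alpha_add_beta, map_one]
  have hpq1 : ((imageUnit φ alpha : Rˣ) : R) * imageUnit φ beta ≠ 1 := by
    change φ alpha * φ beta ≠ 1
    rwa [eval_alpha, eval_beta]
  have hmap : (associates alpha beta).map (imageUnit φ) =
      associates (imageUnit φ alpha) (imageUnit φ beta) := by
    simp only [associates, List.map_cons, List.map_nil, map_inv, Units.ext_iff,
      List.cons.injEq, and_true, true_and]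
    have hneg : ∀ g, imageUnit φ (-g) = -imageUnit φ g := fun g =>
      Units.ext (map_neg φ (g : NearRegularRing))
    simp only [hneg, map_inv, map_mul, and_self]
  have hmem : ∀ g ∈ associates alpha beta, g ∈ group := by
    intro g hg
    simp only [associates, List.mem_cons, List.not_mem_nil, or_false] at hg
    rcases hg with rfl | rfl | rfl | rfl | rfl | rfl
    exacts [alpha_mem, beta_mem, inv_mem alpha_mem, inv_mem beta_mem,
      neg_mem (mul_mem alpha_mem (inv_mem beta_mem)),
      neg_mem (mul_mem beta_mem (inv_mem alpha_mem))]
  have hlift : ∀ x ∈ exceptionalUnits R, ∃ g ∈ associates alpha beta, φ g = x := by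
    intro x hx
    obtain ⟨u, hu, rfl⟩ := exists_associate hpq two hpq1 hcard hx
    rw [← hmap, List.mem_map] at hu
    obtain ⟨g, hg, rfl⟩ := hu
    exact ⟨g, hg, rfl⟩
  refine ⟨neg_one_mem, ?_, ?_, ?_, ternary, two_ne_zero, two⟩
  · intro u
    obtain ⟨s, hs, t, ht, hu⟩ := hunit u
    obtain ⟨g, hg, rfl⟩ := hlift s hs
    obtain ⟨g', hg', rfl⟩ := hlift t ht
    rcases hu with hu | hu
    · refine ⟨g * g', mul_mem (hmem g hg) (hmem g' hg'), Units.ext ?_⟩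
      rw [hu, ← map_mul]
      rfl
    · refine ⟨-(g * g'), neg_mem (mul_mem (hmem g hg) (hmem g' hg')), Units.ext ?_⟩
      rw [hu, ← map_mul, ← map_neg]
      rfl
  · intro x hx hx'
    obtain ⟨g, hg, rfl⟩ := hlift x ⟨hx, hx'⟩
    obtain ⟨h, hh, e⟩ := associates_one_sub alpha_add_beta hg
    exact ⟨g, hmem g hg, ⟨h, hmem h hh, e⟩, rfl⟩
  · have key : ∀ g ∈ group, (∃ h ∈ group, (h : NearRegularRing) = 1 - g) →
        g ∈ associates alpha beta := by
      rintro g hg ⟨h, hh, e⟩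
      have := mem_associates hg hh e
      simp only [Set.mem_insert_iff, Set.mem_singleton_iff] at this
      simp only [associates, List.mem_cons, List.not_mem_nil, or_false]
      -- The value `-1` left open by `mem_associates` would put `2` in the group, and its image in
      -- `R` would be a unit.
      have hne : g ≠ -1 := by
        rintro rfl
        apply two
        have h2 : (imageUnit φ h : R) = 2 := by
          change φ h = 2
          rw [e, Units.val_neg, Units.val_one, sub_neg_eq_add, one_add_one_eq_two, map_ofNat]
        exact h2 ▸ (imageUnit φ h).isUnit
      tauto
    intro g hg g' hg' h h' e
    have hnd := associates_pairwise hpq two hpq1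
    rw [← hmap] at hnd
    exact List.inj_on_of_nodup_map hnd (key g hg h) (key g' hg' h') (Units.ext e)

end Associates

end NearRegularRing
end PartialField

namespace PartialField

/-! ### Exceptional units of fields and of products. -/

section ExceptionalUnits

open NearRegularRing

theorem exceptionalUnits_prod (R S : Type*) [CommRing R] [CommRing S] :
    exceptionalUnits (R × S) = exceptionalUnits R ×ˢ exceptionalUnits S := by
  ext ⟨x, y⟩
  simp only [exceptionalUnits, Set.mem_ofPred_eq, Set.mem_prod, Prod.isUnit_iff, Prod.fst_sub,
    Prod.snd_sub, Prod.fst_one, Prod.snd_one]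
  tauto

theorem mem_exceptionalUnits {K : Type*} [Field K] {x : K} :
    x ∈ exceptionalUnits K ↔ x ≠ 0 ∧ x ≠ 1 := by
  rw [exceptionalUnits, Set.mem_ofPred_eq, isUnit_iff_ne_zero, isUnit_iff_ne_zero, sub_ne_zero,
    ne_comm (a := (1 : K))]

theorem ncard_exceptionalUnits (K : Type*) [Field K] [Finite K] :
    (exceptionalUnits K).ncard = Nat.card K - 2 := by
  have h : exceptionalUnits K = ({0, 1} : Set K)ᶜ := by
    ext x
    simp [mem_exceptionalUnits]
  rw [h, Set.ncard_compl, Set.ncard_pair zero_ne_one]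

theorem exists_notMem_of_lt_card {K : Type*} [Finite K] (s : Finset K) (h : s.card < Nat.card K) :
    ∃ x, x ∉ s := by
  by_contra! hs
  have : Fintype K := Fintype.ofFinite K
  rw [Nat.card_eq_fintype_card, ← Finset.card_univ, ← Finset.eq_univ_iff_forall.2 hs] at h
  exact h.false

theorem exists_mem_exceptionalUnits {K : Type*} [Field K] [Finite K] (h : 3 ≤ Nat.card K) :
    ∃ x, x ∈ exceptionalUnits K := by
  classical
  obtain ⟨x, hx⟩ := exists_notMem_of_lt_card ({0, 1} : Finset K)
    ((Finset.card_le_two).trans_lt h)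
  exact ⟨x, mem_exceptionalUnits.2 (by simpa using hx)⟩

theorem exists_eq_mul {K : Type*} [Field K] [Finite K] (h : 4 ≤ Nat.card K) {v : K} (hv : v ≠ 0) :
    ∃ s ∈ exceptionalUnits K, ∃ t ∈ exceptionalUnits K, v = s * t := by
  classical
  -- Excluding `v` as well ensures `v / s ≠ 1`.
  obtain ⟨s, hs⟩ := exists_notMem_of_lt_card ({0, 1, v} : Finset K)
    ((Finset.card_le_three).trans_lt h)
  simp only [Finset.mem_insert, Finset.mem_singleton, not_or] at hs
  refine ⟨s, mem_exceptionalUnits.2 ⟨hs.1, hs.2.1⟩, v / s, mem_exceptionalUnits.2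
    ⟨div_ne_zero hv hs.1, ?_⟩, (mul_div_cancel₀ v hs.1).symm⟩
  rw [Ne, div_eq_one_iff_eq hs.1]
  exact fun e => hs.2.2 e.symm

/-- Up to sign, every unit is a product of two exceptional units. -/
def UnitsGenerated (R : Type*) [CommRing R] : Prop :=
  ∀ u : Rˣ, ∃ s ∈ exceptionalUnits R, ∃ t ∈ exceptionalUnits R,
    (u : R) = s * t ∨ (u : R) = -(s * t)

/-- The sign must be the same in both factors. It is dictated by `R`, and in `K` either `v` or `-v`
can be factored accordingly. -/
theorem UnitsGenerated.prod {R K : Type*} [CommRing R] [Field K] [Finite K]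
    (hR : UnitsGenerated R) (h : 4 ≤ Nat.card K) : UnitsGenerated (R × K) := by
  intro u
  obtain ⟨h1, h2⟩ := Prod.isUnit_iff.1 u.isUnit
  obtain ⟨u1, hu1⟩ := h1
  obtain ⟨s, hs, t, ht, hst⟩ := hR u1
  rw [exceptionalUnits_prod]
  rcases hst with hst | hst
  · obtain ⟨x, hx, y, hy, hxy⟩ := exists_eq_mul h h2.ne_zero
    exact ⟨(s, x), ⟨hs, hx⟩, (t, y), ⟨ht, hy⟩, Or.inl (Prod.ext (hu1 ▸ hst) hxy)⟩
  · obtain ⟨x, hx, y, hy, hxy⟩ := exists_eq_mul h (neg_ne_zero.2 h2.ne_zero)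
    exact ⟨(s, x), ⟨hs, hx⟩, (t, y), ⟨ht, hy⟩, Or.inr (Prod.ext (hu1 ▸ hst)
      (neg_eq_iff_eq_neg.1 hxy))⟩

end ExceptionalUnits

/-! ### The lifting property for the two products of finite fields. -/

section Ternary

open NearRegularRing

theorem two_ne_zero_galoisField_three : (2 : GaloisField 3 1) ≠ 0 := by
  intro h
  have := (CharP.cast_eq_zero_iff (GaloisField 3 1) 3 2).1 (by exact_mod_cast h)
  omega

theorem galoisField_three_cases (x : GaloisField 3 1) : x = 0 ∨ x = 1 ∨ x = -1 := by
  have : Fintype (GaloisField 3 1) := Fintype.ofFinite _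
  have hc := GaloisField.card 3 1 one_ne_zero
  have h := FiniteField.pow_card x
  rw [← Nat.card_eq_fintype_card, hc] at h
  have h' : x * ((x - 1) * (x + 1)) = 0 := by linear_combination h
  rcases mul_eq_zero.1 h' with h' | h'
  · exact Or.inl h'
  rcases mul_eq_zero.1 h' with h' | h'
  · exact Or.inr (Or.inl (sub_eq_zero.1 h'))
  · exact Or.inr (Or.inr (eq_neg_of_add_eq_zero_left h'))

theorem neg_one_mem_exceptionalUnits {K : Type*} [Field K] (h : (2 : K) ≠ 0) :
    -1 ∈ exceptionalUnits K :=
  mem_exceptionalUnits.2 ⟨neg_ne_zero.2 one_ne_zero, fun e => h (by linear_combination -e)⟩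

theorem unitsGenerated_galoisField_three : UnitsGenerated (GaloisField 3 1) := by
  have hm := neg_one_mem_exceptionalUnits two_ne_zero_galoisField_three
  intro u
  refine ⟨-1, hm, -1, hm, ?_⟩
  rcases galoisField_three_cases u with h | h | h
  · exact absurd h u.ne_zero
  · exact Or.inl (by rw [h]; ring)
  · exact Or.inr (by rw [h]; ring)

/-- Over `GF(3) × GF(8)`, matrices all whose minors are zero or units lift to near-regular
matrices. -/
theorem exists_isLifting_three_eight :
    ∃ φ : NearRegularRing →+* GaloisField 3 1 × GaloisField 2 3,
      IsLifting group φ (RingHom.fst _ _) := by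
  have c3 := GaloisField.card 3 1 one_ne_zero
  have c8 := GaloisField.card 2 3 three_ne_zero
  obtain ⟨w, hw⟩ := exists_mem_exceptionalUnits (K := GaloisField 2 3) (by omega)
  have h2 : (2 : GaloisField 2 3) = 0 := CharTwo.two_eq_zero
  have hmem : ((-1, w) : GaloisField 3 1 × GaloisField 2 3) ∈ exceptionalUnits _ := by
    rw [exceptionalUnits_prod]
    exact ⟨neg_one_mem_exceptionalUnits two_ne_zero_galoisField_three, hw⟩
  refine ⟨eval _ hmem.1 hmem.2, isLifting_eval _ galoisField_three_cases
    two_ne_zero_galoisField_three ?_ _ _ _ ?_ ?_ ?_⟩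
  · intro h
    exact (Prod.isUnit_iff.1 h).2.ne_zero h2
  · intro h
    have hw1 : w * (1 - w) = 1 := congrArg Prod.snd h
    have : Fintype (GaloisField 2 3) := Fintype.ofFinite _
    have h8 := FiniteField.pow_card w
    rw [← Nat.card_eq_fintype_card, c8] at h8
    -- Here `w ^ 2 - w + 1 = 0`. Together with `w ^ 8 = w` this gives `w ^ 2 = w`, contradicting
    -- that `w` is neither `0` nor `1`.
    have h3 : w ^ 3 = -1 := by linear_combination -(w + 1) * hw1
    have h9 : w ^ 2 ^ 3 = w ^ 2 := by
      rw [show w ^ 2 ^ 3 = (w ^ 3) ^ 2 * w ^ 2 by ring, h3]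
      ring
    rw [h9] at h8
    have : w * (w - 1) = 0 := by linear_combination h8
    rcases mul_eq_zero.1 this with h | h
    · exact (mem_exceptionalUnits.1 hw).1 h
    · exact (mem_exceptionalUnits.1 hw).2 (sub_eq_zero.1 h)
  · rw [exceptionalUnits_prod, Set.ncard_prod, ncard_exceptionalUnits, ncard_exceptionalUnits, c3,
      c8]
    norm_num
  · exact unitsGenerated_galoisField_three.prod (by omega)

/-- Over `GF(3) × GF(4) × GF(5)`, matrices all whose minors are zero or units lift to near-regular
matrices. -/
theorem exists_isLifting_three_four_five :
    ∃ φ : NearRegularRing →+* (GaloisField 3 1 × GaloisField 2 2) × GaloisField 5 1,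
      IsLifting group φ ((RingHom.fst _ _).comp (RingHom.fst _ _)) := by
  have c3 := GaloisField.card 3 1 one_ne_zero
  have c4 := GaloisField.card 2 2 two_ne_zero
  have c5 := GaloisField.card 5 1 one_ne_zero
  obtain ⟨w, hw⟩ := exists_mem_exceptionalUnits (K := GaloisField 2 2) (by omega)
  have h2 : (2 : GaloisField 2 2) = 0 := CharTwo.two_eq_zero
  have cast5 : ∀ n : ℕ, (n : GaloisField 5 1) = 0 → 5 ∣ n := fun n =>
    (CharP.cast_eq_zero_iff (GaloisField 5 1) 5 n).1
  have h25 : (2 : GaloisField 5 1) ≠ 0 := fun h => by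
    have := cast5 2 (by exact_mod_cast h)
    omega
  have hmem : (((-1, w), -1) : (GaloisField 3 1 × GaloisField 2 2) × GaloisField 5 1) ∈
      exceptionalUnits _ := by
    rw [exceptionalUnits_prod, exceptionalUnits_prod]
    exact ⟨⟨neg_one_mem_exceptionalUnits two_ne_zero_galoisField_three, hw⟩,
      neg_one_mem_exceptionalUnits h25⟩
  refine ⟨eval _ hmem.1 hmem.2, isLifting_eval _ galoisField_three_cases
    two_ne_zero_galoisField_three ?_ _ _ _ ?_ ?_ ?_⟩
  · intro h
    exact (Prod.isUnit_iff.1 (Prod.isUnit_iff.1 h).1).2.ne_zero h2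
  · intro h
    -- Only the factor `GF(5)` is used: there `-2 = 1` would mean `3 = 0`.
    have h5 : (-1 : GaloisField 5 1) * (1 - -1) = 1 := congrArg Prod.snd h
    have := cast5 3 (by push_cast; linear_combination -h5)
    omega
  · rw [exceptionalUnits_prod, exceptionalUnits_prod, Set.ncard_prod, Set.ncard_prod,
      ncard_exceptionalUnits, ncard_exceptionalUnits, ncard_exceptionalUnits, c3, c4, c5]
    norm_num
  · exact (unitsGenerated_galoisField_three.prod (by omega)).prod (by omega)

end Ternary

end PartialField

namespace PartialField

open Matrix

/-! ### The partial fields of the theorem as subsets of rings. -/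

section Embeddings

theorem isRingEmbedding_id (F : Type*) [Field F] :
    IsRingEmbedding (⊤ : Subgroup Fˣ) (MonoidWithZeroHom.id F) where
  mem_padd p q r := Part.mem_some_iff
  zeroOrMem_iff x := by
    refine ⟨fun _ => ⟨x, rfl⟩, fun _ => ?_⟩
    rw [zeroOrMem_top_iff, isUnit_iff_ne_zero]
    exact em _

/-- The inclusion of `ℙ(R, S)` in `R`. -/
def FromRing.val (R : Type*) [CommRing R] [Nontrivial R] (S : Set Rˣ) : FromRing R S →*₀ R where
  toFun := Subtype.val
  map_zero' := rfl
  map_one' := rfl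
  map_mul' _ _ := rfl

theorem isRingEmbedding_val (R : Type*) [CommRing R] [Nontrivial R] (S : Set Rˣ) :
    IsRingEmbedding (Subgroup.closure (S ∪ {-1})) (FromRing.val R S) where
  mem_padd _ _ _ := FromRing.mem_add
  zeroOrMem_iff x := ⟨fun h => ⟨⟨x, h⟩, rfl⟩, by rintro ⟨p, rfl⟩; exact p.2⟩

/-- The product of two embeddings of partial fields in rings. -/
def DirectProduct.map {P Q R S : Type*} [PartialField P] [PartialField Q] [CommRing R] [CommRing S]
    (e : P →*₀ R) (f : Q →*₀ S) : DirectProduct P Q →*₀ R × S where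
  toFun x := (e x.1.1, f x.1.2)
  map_zero' := Prod.ext (map_zero e) (map_zero f)
  map_one' := Prod.ext (map_one e) (map_one f)
  map_mul' x y := Prod.ext (map_mul e x.1.1 y.1.1) (map_mul f x.1.2 y.1.2)

theorem IsRingEmbedding.directProduct {P Q R S : Type*} [PartialField P] [PartialField Q]
    [CommRing R] [CommRing S] {e : P →*₀ R} {f : Q →*₀ S}
    (he : IsRingEmbedding (⊤ : Subgroup Rˣ) e) (hf : IsRingEmbedding (⊤ : Subgroup Sˣ) f) :
    IsRingEmbedding (⊤ : Subgroup (R × S)ˣ) (DirectProduct.map e f) where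
  mem_padd p q r := by
    rw [Prod.ext_iff]
    exact DirectProduct.mem_add.trans (and_congr (he.mem_padd _ _ _) (hf.mem_padd _ _ _))
  zeroOrMem_iff x := by
    have := he.nontrivial
    have := hf.nontrivial
    constructor
    · intro h
      rcases zeroOrMem_top_iff.1 h with rfl | h
      · exact ⟨0, map_zero _⟩
      · obtain ⟨h1, h2⟩ := Prod.isUnit_iff.1 h
        obtain ⟨p, hp⟩ := (he.zeroOrMem_iff x.1).1 (zeroOrMem_top_iff.2 (Or.inr h1))
        obtain ⟨q, hq⟩ := (hf.zeroOrMem_iff x.2).1 (zeroOrMem_top_iff.2 (Or.inr h2))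
        refine ⟨⟨(p, q), ?_⟩, Prod.ext hp hq⟩
        rw [ne_eq, ne_eq, ← he.eq_zero_iff, ← hf.eq_zero_iff, hp, hq]
        simp [h1.ne_zero, h2.ne_zero]
    · rintro ⟨p, rfl⟩
      rw [zeroOrMem_top_iff]
      by_cases h : p.1.1 = 0
      · have h' : p.1.2 = 0 := by
          by_contra h'
          exact p.2.2 h' h
        exact Or.inl (Prod.ext (he.eq_zero_iff.2 h) (hf.eq_zero_iff.2 h'))
      · have h1 : ZeroOrMem ⊤ (e p.1.1) := (he.zeroOrMem_iff _).2 ⟨_, rfl⟩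
        have h2 : ZeroOrMem ⊤ (f p.1.2) := (hf.zeroOrMem_iff _).2 ⟨_, rfl⟩
        exact Or.inr (Prod.isUnit_iff.2 ⟨h1.isUnit fun e0 => h (he.eq_zero_iff.1 e0),
          h2.isUnit fun e0 => p.2.1 h (hf.eq_zero_iff.1 e0)⟩)

end Embeddings

/-! ### Transporting and combining representations. -/

section RingRepresentable

variable {α R S : Type*} [CommRing R] [CommRing S] {M : Matroid α}

theorem RingRepresentable.map [Nontrivial S] {G : Subgroup Rˣ} {H : Subgroup Sˣ}
    (h : RingRepresentable G M) (φ : R →+* S) (hφ : ∀ g ∈ G, imageUnit φ g ∈ H) :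
    RingRepresentable H M := by
  obtain ⟨r, A, hA, hM⟩ := h
  refine ⟨r, A.map φ, hA.map φ hφ, fun B => (hM B).trans (exists_congr fun f =>
    and_congr_right fun _ => ?_)⟩
  rw [submatrix_map, ← RingHom.mapMatrix_apply, ← RingHom.map_det]
  rcases hA r id f with h | ⟨g, -, h⟩
  · simp [h]
  · have := φ.domain_nontrivial
    rw [← h]
    exact iff_of_true g.ne_zero (imageUnit φ g).ne_zero

theorem RingRepresentable.of_injective {G : Subgroup Rˣ} {H : Subgroup Sˣ}
    (h : RingRepresentable H M) (φ : R →+* S) (hinj : Function.Injective φ)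
    (hφ : ∀ h ∈ H, ∃ g ∈ G, imageUnit φ g = h) : RingRepresentable G M := by
  obtain ⟨r, A, hA, hM⟩ := h
  have lift : ∀ x, ZeroOrMem H x → ∃ y, ZeroOrMem G y ∧ φ y = x := by
    rintro x (rfl | ⟨h, hh, rfl⟩)
    · exact ⟨0, .zero, map_zero φ⟩
    · obtain ⟨g, hg, rfl⟩ := hφ h hh
      exact ⟨g, .of_mem hg, rfl⟩
  have hA' : ∀ i j, ∃ y, φ y = A i j := fun i j =>
    let ⟨y, _, hy⟩ := lift _ (hA.apply i j)
    ⟨y, hy⟩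
  choose A' hA' using hA'
  obtain rfl : (Matrix.of A').map φ = A := by ext i j; simp [hA']
  refine ⟨r, Matrix.of A', ?_, fun B => (hM B).trans (exists_congr fun f =>
    and_congr_right fun _ => ?_)⟩
  · intro k f g
    obtain ⟨y, hy, e⟩ := lift _ (hA k f g)
    rw [submatrix_map, ← RingHom.mapMatrix_apply, ← RingHom.map_det] at e
    rwa [← hinj e]
  · rw [submatrix_map, ← RingHom.mapMatrix_apply, ← RingHom.map_det, map_ne_zero_iff φ hinj]

/-- Two enumerations of a base differ by a permutation of the columns, which affects only the sign
of the determinant. -/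
theorem det_submatrix_ne_zero_iff {r : ℕ} {A : Matrix (Fin r) M.E R}
    (hA : ∀ B : Set α, M.IsBase B ↔
      ∃ f : Fin r ↪ M.E, Set.range (fun i => (f i : α)) = B ∧ (A.submatrix id f).det ≠ 0)
    (f : Fin r ↪ M.E) :
    (A.submatrix id f).det ≠ 0 ↔ M.IsBase (Set.range (fun i => (f i : α))) := by
  refine ⟨fun h => (hA _).2 ⟨f, rfl, h⟩, fun h => ?_⟩
  obtain ⟨f', hf', hd⟩ := (hA _).1 h
  have hσ : ∀ i, ∃ j, f j = f' i := by
    intro i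
    have hi : (f' i : α) ∈ Set.range (fun i => (f i : α)) := hf' ▸ ⟨i, rfl⟩
    obtain ⟨j, hj⟩ := hi
    exact ⟨j, Subtype.ext hj⟩
  choose σ hσ using hσ
  have hinj : Function.Injective σ := fun i j e => f'.injective (by rw [← hσ, ← hσ, e])
  let e : Equiv.Perm (Fin r) := Equiv.ofBijective σ (Finite.injective_iff_bijective.1 hinj)
  have he : A.submatrix id f' = (A.submatrix id f).submatrix id e := by
    ext i j
    simp [e, hσ]
  rw [he, det_permute'] at hd
  exact fun h0 => hd (by rw [h0, mul_zero])

/-- A representation over a field can be chosen to contain an identity matrix. -/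
theorem exists_submatrix_eq_one {K : Type*} [Field K] {r : ℕ} {A : Matrix (Fin r) M.E K}
    (hA : ∀ B : Set α, M.IsBase B ↔
      ∃ f : Fin r ↪ M.E, Set.range (fun i => (f i : α)) = B ∧ (A.submatrix id f).det ≠ 0)
    (f₀ : Fin r ↪ M.E) (h₀ : M.IsBase (Set.range (fun i => (f₀ i : α)))) :
    ∃ D : Matrix (Fin r) M.E K, D.submatrix id f₀ = 1 ∧ ∀ f : Fin r ↪ M.E,
      (D.submatrix id f).det ≠ 0 ↔ M.IsBase (Set.range (fun i => (f i : α))) := by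
  have hd := (det_submatrix_ne_zero_iff hA f₀).2 h₀
  have hsub : ∀ f : Fin r → M.E, ((A.submatrix id f₀)⁻¹ * A).submatrix id f =
      (A.submatrix id f₀)⁻¹ * A.submatrix id f := by
    intro f
    ext i j
    simp [mul_apply]
  refine ⟨(A.submatrix id f₀)⁻¹ * A, ?_, fun f => ?_⟩
  · rw [hsub, nonsing_inv_mul _ hd.isUnit]
  · rw [hsub, det_mul, det_nonsing_inv, mul_ne_zero_iff, det_submatrix_ne_zero_iff hA,
      and_iff_right hd.isUnit.ringInverse.ne_zero]

/-- Both matrices are normalized to the identity on a common base. Each minor with distinct rows is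
then a maximal minor, and its vanishing depends only on `M`, so it is zero in both fields or in
neither. -/
theorem RingRepresentable.prod {K L : Type*} [Field K] [Field L]
    (hK : RingRepresentable (⊤ : Subgroup Kˣ) M) (hL : RingRepresentable (⊤ : Subgroup Lˣ) M) :
    RingRepresentable (⊤ : Subgroup (K × L)ˣ) M := by
  obtain ⟨r, A, -, hA⟩ := hK
  obtain ⟨r', A', -, hA'⟩ := hL
  obtain ⟨B, hB⟩ := M.exists_isBase
  obtain ⟨f₀, rfl, -⟩ := (hA B).1 hB
  obtain ⟨f₁, hf₁, -⟩ := (hA' _).1 hB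
  obtain rfl : r' = r := by
    have h1 := Set.ncard_range_of_injective (Subtype.val_injective.comp f₀.injective)
    have h2 := Set.ncard_range_of_injective (Subtype.val_injective.comp f₁.injective)
    simp only [Function.comp_def, Nat.card_fin] at h1 h2
    rw [← h1, ← h2, hf₁]
  obtain ⟨D, hD₀, hD⟩ := exists_submatrix_eq_one hA f₀ hB
  obtain ⟨D', hD'₀, hD'⟩ := exists_submatrix_eq_one hA' f₀ hB
  let N : Matrix (Fin r') M.E (K × L) := Matrix.of fun i j => (D i j, D' i j)
  have fst : ∀ {k : ℕ} (f : Fin k → Fin r') (g : Fin k → M.E),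
      (N.submatrix f g).det.1 = (D.submatrix f g).det := fun f g =>
    (RingHom.fst K L).map_det (N.submatrix f g)
  have snd : ∀ {k : ℕ} (f : Fin k → Fin r') (g : Fin k → M.E),
      (N.submatrix f g).det.2 = (D'.submatrix f g).det := fun f g =>
    (RingHom.snd K L).map_det (N.submatrix f g)
  have hN₀ : N.submatrix id f₀ = 1 := by
    ext i j
    · have := congrFun (congrFun hD₀ i) j
      simp only [submatrix_apply, id, one_apply] at this
      simp only [N, submatrix_apply, of_apply, id, this, one_apply]
      split_ifs <;> rfl
    · have := congrFun (congrFun hD'₀ i) j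
      simp only [submatrix_apply, id, one_apply] at this
      simp only [N, submatrix_apply, of_apply, id, this, one_apply]
      split_ifs <;> rfl
  refine ⟨r', N, ?_, fun B => ?_⟩
  · intro k f g
    by_cases hf : Function.Injective f
    swap
    · rw [det_submatrix_eq_zero_of_not_injective_left _ _ hf]; exact .zero
    -- Rows outside the range of `f` receive their column of the identity submatrix.
    rw [det_submatrix_eq_maximal N f₀ hN₀ f hf g (Function.extend f g f₀)
      (fun i => hf.extend_apply _ _ i) (fun x hx => Function.extend_apply' _ _ _ hx)]
    by_cases hg : Function.Injective (Function.extend f g f₀)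
    swap
    · rw [det_submatrix_eq_zero_of_not_injective_right _ _ hg]; exact .zero
    have h1 := hD ⟨_, hg⟩
    have h2 := hD' ⟨_, hg⟩
    rw [zeroOrMem_top_iff, Prod.isUnit_iff, Prod.ext_iff, fst, snd, isUnit_iff_ne_zero,
      isUnit_iff_ne_zero]
    by_cases hb : M.IsBase (Set.range fun i => ((⟨_, hg⟩ : Fin r' ↪ M.E) i : α))
    · exact Or.inr ⟨h1.2 hb, h2.2 hb⟩
    · exact Or.inl ⟨not_not.1 (mt h1.1 hb), not_not.1 (mt h2.1 hb)⟩
  · constructor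
    · intro hB
      obtain ⟨f, hf, -⟩ := (hA B).1 hB
      refine ⟨f, hf, fun h => (hD f).2 (hf ▸ hB) ?_⟩
      rw [← fst, h]
      rfl
    · rintro ⟨f, rfl, h⟩
      by_contra hb
      refine h (Prod.ext ?_ ?_)
      · rw [fst]; exact not_not.1 (mt (hD f).1 hb)
      · rw [snd]; exact not_not.1 (mt (hD' f).1 hb)

end RingRepresentable

end PartialField

namespace PartialField

open Polynomial

/-! ### Near-regular matroids over `ℤ[α, 1/α, 1/(1-α)]` and over fields. -/

section NearRegular

open NearRegularRing

theorem one_sub_ratFunc_X_ne_zero : (1 - RatFunc.X : RatFunc ℚ) ≠ 0 := by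
  have h : (1 - X : ℚ[X]) ≠ 0 := fun h => by
    have := congrArg (Polynomial.eval 0) h
    simp at this
  rw [← RatFunc.algebraMap_X, ← map_one (algebraMap ℚ[X] (RatFunc ℚ)), ← map_sub]
  exact RatFunc.algebraMap_ne_zero h

/-- The inclusion of `ℤ[α, 1/α, 1/(1-α)]` in `ℚ(α)`. -/
noncomputable def toRatFunc : NearRegularRing →+* RatFunc ℚ :=
  eval RatFunc.X RatFunc.X_ne_zero.isUnit one_sub_ratFunc_X_ne_zero.isUnit

theorem toRatFunc_injective : Function.Injective toRatFunc := by
  have h : eval₂RingHom (Int.castRingHom (RatFunc ℚ)) RatFunc.X =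
      (algebraMap ℚ[X] (RatFunc ℚ)).comp (mapRingHom (Int.castRingHom ℚ)) := by
    ext <;> simp
  rw [injective_iff_map_eq_zero]
  intro x hx
  obtain ⟨⟨p, s⟩, hp⟩ := IsLocalization.surj (Submonoid.powers (X * (1 - X) : ℤ[X])) x
  have h0 : toRatFunc (algebraMap _ _ p) = 0 := by rw [← hp, map_mul, hx, zero_mul]
  -- The numerator `p` maps to zero in `ℚ(α)`, so `p = 0`, because `ℤ[X]` embeds in `ℚ[X]` and that
  -- in `ℚ(α)`.
  rw [toRatFunc, eval_algebraMap, h, RingHom.comp_apply,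
    map_eq_zero_iff _ (RatFunc.algebraMap_injective ℚ), coe_mapRingHom,
    Polynomial.map_eq_zero_iff (Int.castRingHom ℚ).injective_int] at h0
  rw [h0, map_zero] at hp
  exact ((IsLocalization.map_units NearRegularRing s).mul_left_eq_zero).1 hp

theorem map_group : group.map (imageUnit toRatFunc) =
    Subgroup.closure ({u : (RatFunc ℚ)ˣ | (u : RatFunc ℚ) = RatFunc.X ∨
      (u : RatFunc ℚ) = 1 - RatFunc.X} ∪ {-1}) := by
  have ha : ((imageUnit toRatFunc alpha : (RatFunc ℚ)ˣ) : RatFunc ℚ) = RatFunc.X :=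
    eval_alpha _ _ _
  have hb : ((imageUnit toRatFunc beta : (RatFunc ℚ)ˣ) : RatFunc ℚ) = 1 - RatFunc.X :=
    eval_beta _ _ _
  rw [group, MonoidHom.map_closure]
  congr 1
  ext u
  simp only [Set.image_insert_eq, Set.image_singleton, Set.mem_insert_iff, Set.mem_singleton_iff,
    Set.mem_union, Set.mem_ofPred_eq, or_assoc]
  rw [← hb, ← ha, ← Units.ext_iff, ← Units.ext_iff]
  have hn : imageUnit toRatFunc (-1) = -1 := Units.ext (by simp)
  rw [hn]

theorem nearRegular_iff {α : Type*} (M : Matroid α) : NearRegular M ↔ RingRepresentable group M := by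
  rw [NearRegular, (isRingEmbedding_val _ _).representable_iff, ← map_group]
  refine ⟨fun h => h.of_injective toRatFunc toRatFunc_injective fun _ h => h, fun h => h.map
    toRatFunc fun g hg => ⟨g, hg, rfl⟩⟩

/-- A near-regular matroid is representable over every field with at least three elements. -/
theorem RingRepresentable.field {α : Type*} {M : Matroid α} (h : RingRepresentable group M)
    {F : Type*} [Field F] (hF : 3 ≤ ENat.card F) : RingRepresentable (⊤ : Subgroup Fˣ) M := by
  obtain ⟨a, ha⟩ : ∃ a : F, a ∉ ({0, 1} : Set F) := by
    by_contra! hno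
    have h2 : ENat.card F = 2 := by
      rw [← Set.encard_univ, ← Set.eq_univ_of_forall hno, Set.encard_pair zero_ne_one]
    rw [h2] at hF
    exact absurd hF (by decide)
  have ha' := mem_exceptionalUnits.2 (by simpa using ha)
  exact h.map (eval a ha'.1 ha'.2) fun _ _ => trivial

/-- The hypothesis speaks of fields in one fixed universe, which a finite field in `Type` reaches
through `ULift`. -/
theorem ringRepresentable_of_forall_field {α : Type*} {M : Matroid α}
    (h : ∀ (F : Type*) [Field F], 3 ≤ ENat.card F → Representable F M) (K : Type) [Field K]
    [Finite K] (hK : 3 ≤ Nat.card K) : RingRepresentable (⊤ : Subgroup Kˣ) M := by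
  have := ((isRingEmbedding_id _).representable_iff M).1 (h (ULift K) (by
    rw [ENat.card_congr Equiv.ulift, ENat.card_eq_coe_natCard]
    exact_mod_cast hK))
  exact this.map (ULift.ringEquiv (R := K)).toRingHom fun _ _ => trivial

theorem representable_three_four_five_iff {α : Type*} (M : Matroid α) :
    Representable (DirectProduct (DirectProduct (GaloisField 3 1) (GaloisField 2 2))
      (GaloisField 5 1)) M ↔ RingRepresentable
        (⊤ : Subgroup ((GaloisField 3 1 × GaloisField 2 2) × GaloisField 5 1)ˣ) M :=
  (((isRingEmbedding_id _).directProduct (isRingEmbedding_id _)).directProduct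
    (isRingEmbedding_id _)).representable_iff M

theorem representable_three_eight_iff {α : Type*} (M : Matroid α) :
    Representable (DirectProduct (GaloisField 3 1) (GaloisField 2 3)) M ↔
      RingRepresentable (⊤ : Subgroup (GaloisField 3 1 × GaloisField 2 3)ˣ) M :=
  ((isRingEmbedding_id _).directProduct (isRingEmbedding_id _)).representable_iff M

end NearRegular

end PartialField

theorem mainTheorem9 {α : Type*} (M : Matroid α) [M.Finite] :
    List.TFAE [
      PartialField.Representable
        (PartialField.DirectProduct
          (PartialField.DirectProduct (GaloisField 3 1) (GaloisField 2 2)) (GaloisField 5 1)) M,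
      PartialField.Representable
        (PartialField.DirectProduct (GaloisField 3 1) (GaloisField 2 3)) M,
      PartialField.NearRegular M,
      ∀ (F : Type*) [Field F], 3 ≤ ENat.card F → PartialField.Representable F M] := by
  rw [PartialField.representable_three_four_five_iff, PartialField.representable_three_eight_iff,
    PartialField.nearRegular_iff]
  obtain ⟨φ, hφ⟩ := PartialField.exists_isLifting_three_four_five
  obtain ⟨φ', hφ'⟩ := PartialField.exists_isLifting_three_eight
  tfae_have 1 → 3 := hφ.ringRepresentable
  tfae_have 2 → 3 := hφ'.ringRepresentable
  tfae_have 3 → 1 := fun h => h.map φ fun _ _ => trivial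
  tfae_have 3 → 4 := fun h F _ hF =>
    ((PartialField.isRingEmbedding_id F).representable_iff M).2 (h.field hF)
  tfae_have 4 → 2 := fun h =>
    (PartialField.ringRepresentable_of_forall_field h _ (by
      rw [GaloisField.card 3 1 one_ne_zero]; norm_num)).prod
    (PartialField.ringRepresentable_of_forall_field h _ (by
      rw [GaloisField.card 2 3 three_ne_zero]; norm_num))
  tfae_finish
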